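/- Let $n>1$, and for $i\in[n]$ let $V_i\in\mathbb{R}^{d\times m_i}$ ($m_i\ge 1$) be a matrix whose columns are the given points, at most one of which is the origin, and let $\nu_i\in[\frac1{m_i},1]$. The reduced polytopes are $\Omega_i=\{V_i b : b\in\Delta^{m_i-1},\ b_j\le\nu_i\ \forall j\}$, where $\Delta^{m-1}=\{b\in\mathbb{R}^m_{\ge 0}:\sum_j b_j=1\}$. Assume $\bigcap_{i=1}^n\Omega_i=\varnothing$. Let $r^*$ be the infimum of all $r$ for which there are $z\in\mathbb{R}^d$ and $v_i\in\Omega_i$ with $\|z-v_i\|\le r$ for all $i\in[n]$, let $D$ be the (Euclidean) diameter of $\mathrm{conv}(\bigcup_i\Omega_i)$, let $R=D/r^*$, and let $N$ be the total number of nonzero entries of $V_1,\dots,V_n$. The model of computation is a real random access machine: exact real numbers with unit-cost $+,-,\times,/,\sqrt{\cdot},\exp$ and comparisons, integers with unit-cost $+$, truncated $-$ and comparisons, integer-to-real conversion, arrays of both sorts addressed by integers; programs contain no constants other than natural number literals. The matrices $V_i$ are given in compressed sparse column form. (1) There are a single program and a universal constant $C$ such that, for every such input and every $\varepsilon>0$,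 the program computes a $(1+\varepsilon)$-approximate smallest intersecting ball of $\Omega_1,\dots,\Omega_n$, that is, $z\in\mathbb{R}^d$, $v_i\in\Omega_i$ and $r\in\mathbb{R}$ with $\|z-v_i\|\le r$ for all $i\in[n]$ and $r\le(1+\varepsilon)r^*$, in at most $$C\cdot\frac{R^2\,(N+nd)\,\log n}{\min(\varepsilon,1)^2}$$ steps. (2) The linear oracle over the capped simplex is solved by a top-$k$ selection in worst-case linear time: there are a program and a universal constant $C$ such that, for all $m\ge1$, $h\in\mathbb{R}^m$ and $\nu\in[\frac1m,1]$, the program computes in at most $C\,m$ steps a minimizer $b$ of $h^Tb$ over $\{b\in\Delta^{m-1}: b_j\le\nu\ \forall j\}$ that has the following form: with $k=\lceil 1/\nu\rceil$ and for some ordering $h_{j_1}\le h_{j_2}\le\dots\le h_{j_m}$ of the entries of $h$, one has $b_{j_1}=\dots=b_{j_{k-1}}=\nu$, $b_{j_k}=1-\nu(k-1)$, and all other entries of $b$ are $0$. -/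

import Mathlib

open scoped Matrix

noncomputable section

/-! ## A real random access machine with a step count

Programs are structured pseudocode over finitely many named variables and arrays, of two sorts.
Cells of sort `ℕ` serve as counters and array indices (addition and truncated subtraction only);
cells of sort `ℝ` hold exact reals. Every elementary operation and every test costs one step.
The real operations are the four arithmetic operations, the square root and the exponential.
A program contains no real constants other than natural number literals, and there is no way to
convert a real to an integer (no floor). -/

namespace RealRAM

/-- The memory of the machine: variables and (unbounded) arrays, named by natural numbers. -/
structure Store where
  natVar : ℕ → ℕ
  realVar : ℕ → ℝ
  natArr : ℕ → ℕ → ℕ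
  realArr : ℕ → ℕ → ℝ

namespace Store

def setNat (s : Store) (x v : ℕ) : Store :=
  { s with natVar := Function.update s.natVar x v }

def setReal (s : Store) (x : ℕ) (v : ℝ) : Store :=
  { s with realVar := Function.update s.realVar x v }

def setNatArr (s : Store) (a k v : ℕ) : Store :=
  { s with natArr := Function.update s.natArr a (Function.update (s.natArr a) k v) }

def setRealArr (s : Store) (a k : ℕ) (v : ℝ) : Store :=
  { s with realArr := Function.update s.realArr a (Function.update (s.realArr a) k v) }

end Store

/-- Elementary instructions. The letters `x y z` name variables, `a` names an array, and
`c` is a literal. -/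
inductive Instr : Type
  | natConst (x c : ℕ)
  | natCopy (x y : ℕ)
  | natAdd (x y z : ℕ)
  | natSub (x y z : ℕ)
  | natRead (x a y : ℕ)
  | natWrite (a x y : ℕ)
  | realConst (x c : ℕ)
  | realCopy (x y : ℕ)
  | realOfNat (x y : ℕ)
  | realAdd (x y z : ℕ)
  | realSub (x y z : ℕ)
  | realMul (x y z : ℕ)
  | realDiv (x y z : ℕ)
  | realSqrt (x y : ℕ)
  | realExp (x y : ℕ)
  | realRead (x a y : ℕ)
  | realWrite (a x y : ℕ)

/-- Effect of an elementary instruction: `x := …`, or `a[x] := y` for the two write instructions.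
Indices of arrays are always contents of integer variables. -/
def Instr.exec (s : Store) : Instr → Store
  | natConst x c => s.setNat x c
  | natCopy x y => s.setNat x (s.natVar y)
  | natAdd x y z => s.setNat x (s.natVar y + s.natVar z)
  | natSub x y z => s.setNat x (s.natVar y - s.natVar z)
  | natRead x a y => s.setNat x (s.natArr a (s.natVar y))
  | natWrite a x y => s.setNatArr a (s.natVar x) (s.natVar y)
  | realConst x c => s.setReal x (c : ℝ)
  | realCopy x y => s.setReal x (s.realVar y)
  | realOfNat x y => s.setReal x (s.natVar y : ℝ)
  | realAdd x y z => s.setReal x (s.realVar y + s.realVar z)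
  | realSub x y z => s.setReal x (s.realVar y - s.realVar z)
  | realMul x y z => s.setReal x (s.realVar y * s.realVar z)
  | realDiv x y z => s.setReal x (s.realVar y / s.realVar z)
  | realSqrt x y => s.setReal x (Real.sqrt (s.realVar y))
  | realExp x y => s.setReal x (Real.exp (s.realVar y))
  | realRead x a y => s.setReal x (s.realArr a (s.natVar y))
  | realWrite a x y => s.setRealArr a (s.natVar x) (s.realVar y)

/-- Tests: comparisons of two variables of the same sort. -/
inductive Test : Type
  | natLt (x y : ℕ)
  | natLe (x y : ℕ)
  | realLt (x y : ℕ)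
  | realLe (x y : ℕ)

def Test.Holds (s : Store) : Test → Prop
  | natLt x y => s.natVar x < s.natVar y
  | natLe x y => s.natVar x ≤ s.natVar y
  | realLt x y => s.realVar x < s.realVar y
  | realLe x y => s.realVar x ≤ s.realVar y

/-- Programs. `loop t p` repeats `p` as long as the test `t` holds. -/
inductive Prog : Type
  | skip
  | instr (i : Instr)
  | seq (p q : Prog)
  | ite (t : Test) (p q : Prog)
  | loop (t : Test) (p : Prog)

/-- `Runs p s k s'`: the program `p`, started in memory `s`, terminates after exactly `k` steps
in memory `s'`. -/
inductive Runs : Prog → Store → ℕ → Store → Prop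
  | skip (s : Store) : Runs .skip s 1 s
  | instr (i : Instr) (s : Store) : Runs (.instr i) s 1 (i.exec s)
  | seq {p q : Prog} {s s' s'' : Store} {k l : ℕ} :
      Runs p s k s' → Runs q s' l s'' → Runs (.seq p q) s (k + l) s''
  | iteTrue {t : Test} {p q : Prog} {s s' : Store} {k : ℕ} :
      t.Holds s → Runs p s k s' → Runs (.ite t p q) s (k + 1) s'
  | iteFalse {t : Test} {p q : Prog} {s s' : Store} {k : ℕ} :
      ¬ t.Holds s → Runs q s k s' → Runs (.ite t p q) s (k + 1) s'
  | loopTrue {t : Test} {p : Prog} {s s' s'' : Store} {k l : ℕ} :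
      t.Holds s → Runs p s k s' → Runs (.loop t p) s' l s'' →
        Runs (.loop t p) s (k + l + 1) s''
  | loopFalse {t : Test} {p : Prog} {s : Store} :
      ¬ t.Holds s → Runs (.loop t p) s 1 s

/-- The array with the entries of the list `l`, followed by zeros. -/
def arrOfList {α : Type*} [Zero α] (l : List α) : ℕ → α := fun k => l.getD k 0

end RealRAM

/-! ## Smallest intersecting balls -/

namespace SIB

/-- Feasible tuples `(z, v₁, …, vₙ, r)`: `vᵢ ∈ Ωᵢ` and `‖z - vᵢ‖ ≤ r` for all `i`. -/
def Feasible {n d : ℕ} (Ω : Fin n → Set (EuclideanSpace ℝ (Fin d)))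
    (z : EuclideanSpace ℝ (Fin d)) (v : Fin n → EuclideanSpace ℝ (Fin d)) (r : ℝ) : Prop :=
  ∀ i, ‖z - v i‖ ≤ r ∧ v i ∈ Ω i

/-- The optimal value `r*`: the smallest radius of a ball that meets every `Ωᵢ`. -/
def optRadius {n d : ℕ} (Ω : Fin n → Set (EuclideanSpace ℝ (Fin d))) : ℝ :=
  sInf {r | ∃ z v, Feasible Ω z v r}

/-- `(z, v₁, …, vₙ, r)` is a `(1+ε)`-approximate solution. -/
def IsApproxSolution {n d : ℕ} (Ω : Fin n → Set (EuclideanSpace ℝ (Fin d))) (ε : ℝ)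
    (z : EuclideanSpace ℝ (Fin d)) (v : Fin n → EuclideanSpace ℝ (Fin d)) (r : ℝ) : Prop :=
  Feasible Ω z v r ∧ r ≤ (1 + ε) * optRadius Ω

/-- The diameter `D` of the input: the diameter of the convex hull of all the `Ωᵢ`. -/
def inputDiam {n d : ℕ} (Ω : Fin n → Set (EuclideanSpace ℝ (Fin d))) : ℝ :=
  Metric.diam (convexHull ℝ (⋃ i, Ω i))

/-- The capped simplex: points of the standard simplex whose coordinates are at most `ν`. -/
def cappedSimplex (m : ℕ) (ν : ℝ) : Set (Fin m → ℝ) :=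
  {b | b ∈ stdSimplex ℝ (Fin m) ∧ ∀ j, b j ≤ ν}

/-- The reduced polytope generated by the columns of `V` and the parameter `ν`. -/
def reducedPolytope {d m : ℕ} (V : Matrix (Fin d) (Fin m) ℝ) (ν : ℝ) :
    Set (EuclideanSpace ℝ (Fin d)) :=
  {u | ∃ b ∈ cappedSimplex m ν, u = WithLp.toLp 2 (V *ᵥ b)}

/-- The rows at which column `j` of `V` is nonzero, in increasing order. -/
def colSupport {d m : ℕ} (V : Matrix (Fin d) (Fin m) ℝ) (j : Fin m) : List (Fin d) :=
  open Classical in (List.finRange d).filter (fun k => V k j ≠ 0)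

/-- The number `N` of nonzero coordinates in the input matrices. -/
def numNonzero {n d : ℕ} {m : Fin n → ℕ} (V : ∀ i, Matrix (Fin d) (Fin (m i)) ℝ) : ℕ :=
  ∑ i, ∑ j, (colSupport (V i) j).length

/-- The initial memory for an instance, the matrices being stored in compressed sparse column
form: `n` and `d` in the integer variables `0` and `1`, `ε` in the real variable `0`; in the integer
arrays `0, 1, 2`, the numbers of points, the numbers of nonzero entries of the successive columns,
and the row indices of the successive nonzero entries; in the real arrays `0, 1`, the values
of the successive nonzero entries, and the parameters `νᵢ`. All other cells are zero. -/
def inputStore {n d : ℕ} {m : Fin n → ℕ} (V : ∀ i, Matrix (Fin d) (Fin (m i)) ℝ)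
    (ν : Fin n → ℝ) (ε : ℝ) : RealRAM.Store where
  natVar := RealRAM.arrOfList [n, d]
  realVar := RealRAM.arrOfList [ε]
  natArr
    | 0 => RealRAM.arrOfList (List.ofFn m)
    | 1 => RealRAM.arrOfList ((List.finRange n).flatMap fun i =>
        (List.finRange (m i)).map fun j => (colSupport (V i) j).length)
    | 2 => RealRAM.arrOfList ((List.finRange n).flatMap fun i =>
        (List.finRange (m i)).flatMap fun j => (colSupport (V i) j).map fun k => (k : ℕ))
    | _ => fun _ => 0
  realArr
    | 0 => RealRAM.arrOfList ((List.finRange n).flatMap fun i =>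
        (List.finRange (m i)).flatMap fun j => (colSupport (V i) j).map fun k => V i k j)
    | 1 => RealRAM.arrOfList (List.ofFn ν)
    | _ => fun _ => 0

/-- The center `z` is output in the real array `2`. -/
def outputCenter (d : ℕ) (s : RealRAM.Store) : EuclideanSpace ℝ (Fin d) :=
  WithLp.toLp 2 fun k => s.realArr 2 k

/-- The points `v₁, …, vₙ` are output one after the other in the real array `3`. -/
def outputPoints (n d : ℕ) (s : RealRAM.Store) (i : Fin n) : EuclideanSpace ℝ (Fin d) :=
  WithLp.toLp 2 fun k => s.realArr 3 ((i : ℕ) * d + k)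

/-- The radius `r` is output in the real variable `0`. -/
def outputRadius (s : RealRAM.Store) : ℝ := s.realVar 0

/-- The initial memory for the linear oracle over the capped simplex: `m` in the integer variable
`0`, `ν` in the real variable `0`, the cost vector `h` in the real array `0`. -/
def oracleStore {m : ℕ} (h : Fin m → ℝ) (ν : ℝ) : RealRAM.Store where
  natVar := RealRAM.arrOfList [m]
  realVar := RealRAM.arrOfList [ν]
  natArr := fun _ _ => 0
  realArr
    | 0 => RealRAM.arrOfList (List.ofFn h)
    | _ => fun _ => 0

/-- The answer of the linear oracle is output in the real array `1`. -/
def oracleOutput (m : ℕ) (s : RealRAM.Store) : Fin m → ℝ := fun j => s.realArr 1 j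

/-- `b` is given by a top-`k` selection from `h`, with `k = ⌈1/ν⌉`: for some arrangement `σ` of the
indices by increasing `h`, the first `k - 1` indices receive the weight `ν`, the `k`-th one
receives `1 - ν (k - 1)`, and all others receive `0`. -/
def IsTopSelection {m : ℕ} (h : Fin m → ℝ) (ν : ℝ) (b : Fin m → ℝ) : Prop :=
  ∃ σ : Equiv.Perm (Fin m), Monotone (h ∘ σ) ∧ ∀ j : Fin m,
    b (σ j) =
      if (j : ℕ) + 1 < ⌈1 / ν⌉₊ then ν
      else if (j : ℕ) + 1 = ⌈1 / ν⌉₊ then 1 - ν * ((⌈1 / ν⌉₊ : ℝ) - 1)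
      else 0

end SIB

end

/-! The algorithm is a multiplicative-weights scheme. Keep the sums `V_i` of the points chosen so
far in `Ω_i` and the sum `Z` of the chosen centers, and watch the potential `Φ = ∑ cosh (η ‖V_i -
Z‖)`. Its gradient gives one linear functional per polytope and, with opposite sign, one for the
center. The linear oracles return minimizers `v_i ∈ Ω_i` and a center `z` that is a minimizer over
the union of the `Ω_i`. A feasible center can be projected into the hull of its own points without
leaving its ball, so these answers compete with every feasible tuple: to first order, one iteration
increases `Φ` by at most `η r Φ` for every feasible radius `r` (`sum_inner_le_of_feasible`).

The second-order term comes from `cosh_norm_add_le`: `cosh √u` is convex in `u`, whence a step of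
length at most `ρ` with `η ρ ≤ 1` adds at most `(η ρ)² Φ`. Thus `Φ ≤ n exp (t ((η ρ)² + η r))` after
`t` iterations (`Phase.step`). With `η = δ / ρ²`, `exp L ≥ 2 n` and `t ≥ L ρ² / δ²`, averaging
yields a feasible tuple of radius at most `r* + 2 δ` (`Phase.norm_le`, `Phase.feasible`).

Neither the width `ρ` nor `r*` is known. The width starts at an observed distance and, once
exceeded, is reset to twice the new distance, so it never exceeds `2 D`; the accuracy `δ` is halved
until the radius found certifies itself, which happens while `δ ≥ min(ε,1) r* / 8`. Either change at
least quadruples the planned length `L ρ² / δ²` of a phase, so the iterations of all phases form a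
geometric series dominated by the last one: `O(L R² / min(ε,1)²)` iterations in total, with `L =
O(log n)`.

One iteration is linear in the size of the input. On sparse columns, a linear functional on a
reduced polytope pulls back to one on the capped simplex, where the minimizer fills the cheapest
coordinates up to the cap. It is found from the `k`-th smallest cost, `k = ⌈1/ν⌉`, by
median-of-medians selection (`median_of_medians`, `select_frame`) and proved optimal by comparing
every cost with that threshold (`IsThresholdSelection.spec`). Since a matrix has at most one zero
column and disjointness forces `d ≥ 1`, the size is `O(N + n d)`. -/

noncomputable section

/-! ### Program logic: frames, total correctness and step counts. -/

namespace RealRAM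

namespace Store

variable (s : Store) (x y a k v : ℕ) (r : ℝ)

@[simp] theorem setNat_natVar : (s.setNat x v).natVar y = if y = x then v else s.natVar y := by
  simp [setNat, Function.update_apply]
@[simp] theorem setNat_realVar : (s.setNat x v).realVar = s.realVar := rfl
@[simp] theorem setNat_natArr : (s.setNat x v).natArr = s.natArr := rfl
@[simp] theorem setNat_realArr : (s.setNat x v).realArr = s.realArr := rfl
@[simp] theorem setReal_natVar : (s.setReal x r).natVar = s.natVar := rfl
@[simp] theorem setReal_realVar :
    (s.setReal x r).realVar y = if y = x then r else s.realVar y := by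
  simp [setReal, Function.update_apply]
@[simp] theorem setReal_natArr : (s.setReal x r).natArr = s.natArr := rfl
@[simp] theorem setReal_realArr : (s.setReal x r).realArr = s.realArr := rfl
@[simp] theorem setNatArr_natVar : (s.setNatArr a k v).natVar = s.natVar := rfl
@[simp] theorem setNatArr_realVar : (s.setNatArr a k v).realVar = s.realVar := rfl
@[simp] theorem setNatArr_natArr :
    (s.setNatArr a k v).natArr y =
      if y = a then Function.update (s.natArr a) k v else s.natArr y := by
  simp [setNatArr, Function.update_apply]
@[simp] theorem setNatArr_realArr : (s.setNatArr a k v).realArr = s.realArr := rfl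
@[simp] theorem setRealArr_natVar : (s.setRealArr a k r).natVar = s.natVar := rfl
@[simp] theorem setRealArr_realVar : (s.setRealArr a k r).realVar = s.realVar := rfl
@[simp] theorem setRealArr_natArr : (s.setRealArr a k r).natArr = s.natArr := rfl
@[simp] theorem setRealArr_realArr :
    (s.setRealArr a k r).realArr y =
      if y = a then Function.update (s.realArr a) k r else s.realArr y := by
  simp [setRealArr, Function.update_apply]

end Store

attribute [simp] Instr.exec Test.Holds

/-- Whether an instruction writes the integer variable `x`. -/
def Instr.writesNat (x : ℕ) : Instr → Bool
  | natConst y _ | natCopy y _ | natAdd y _ _ | natSub y _ _ | natRead y _ _ => x == y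
  | _ => false

/-- Whether an instruction writes the real variable `x`. -/
def Instr.writesReal (x : ℕ) : Instr → Bool
  | realConst y _ | realCopy y _ | realOfNat y _ | realAdd y _ _ | realSub y _ _
  | realMul y _ _ | realDiv y _ _ | realSqrt y _ | realExp y _ | realRead y _ _ => x == y
  | _ => false

/-- Whether an instruction writes the integer array `a`. -/
def Instr.writesNatArr (a : ℕ) : Instr → Bool
  | natWrite b _ _ => a == b
  | _ => false

/-- Whether an instruction writes the real array `a`. -/
def Instr.writesRealArr (a : ℕ) : Instr → Bool
  | realWrite b _ _ => a == b
  | _ => false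

/-- Whether some instruction of a program satisfies `f`. -/
def Prog.any (f : Instr → Bool) : Prog → Bool
  | skip => false
  | instr i => f i
  | seq p q => p.any f || q.any f
  | ite _ p q => p.any f || q.any f
  | loop _ p => p.any f

/-- The memories `s` and `s'` agree on all that `P` does not write. -/
structure Frame (P : Prog) (s s' : Store) : Prop where
  nat : ∀ x, P.any (Instr.writesNat x) = false → s'.natVar x = s.natVar x
  real : ∀ x, P.any (Instr.writesReal x) = false → s'.realVar x = s.realVar x
  natArr : ∀ x, P.any (Instr.writesNatArr x) = false → s'.natArr x = s.natArr x
  realArr : ∀ x, P.any (Instr.writesRealArr x) = false → s'.realArr x = s.realArr x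

theorem Frame.refl (P : Prog) (s : Store) : Frame P s s :=
  ⟨fun _ _ => rfl, fun _ _ => rfl, fun _ _ => rfl, fun _ _ => rfl⟩

theorem Frame.trans {P : Prog} {s s' s'' : Store} (h : Frame P s s') (h' : Frame P s' s'') :
    Frame P s s'' :=
  ⟨fun x hx => (h'.nat x hx).trans (h.nat x hx), fun x hx => (h'.real x hx).trans (h.real x hx),
    fun x hx => (h'.natArr x hx).trans (h.natArr x hx),
    fun x hx => (h'.realArr x hx).trans (h.realArr x hx)⟩

/-- Every write of `P` is a write of `P'`. -/
def Prog.Sub (P P' : Prog) : Prop := ∀ f : Instr → Bool, P'.any f = false → P.any f = false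

theorem Frame.mono {P P' : Prog} {s s' : Store} (h : Frame P s s') (hP : P.Sub P') :
    Frame P' s s' :=
  ⟨fun x hx => h.nat x (hP _ hx), fun x hx => h.real x (hP _ hx),
    fun x hx => h.natArr x (hP _ hx), fun x hx => h.realArr x (hP _ hx)⟩

theorem Frame.instr (i : Instr) (s : Store) : Frame (.instr i) s (i.exec s) := by
  constructor <;> intro x hx <;> cases i <;>
    simp_all [Prog.any, Instr.writesNat, Instr.writesReal, Instr.writesNatArr,
      Instr.writesRealArr]

/-- What a program writes is a Boolean computation on its syntax. For concrete programs and cells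
the side conditions of `Frame` therefore close by `rfl`, and specifications need only mention the
cells of interest. -/
theorem Runs.frame {P : Prog} {s s' : Store} {k : ℕ} (h : Runs P s k s') : Frame P s s' := by
  induction h with
  | skip s => exact .refl _ _
  | instr i s => exact .instr i s
  | seq _ _ h1 h2 =>
    exact (h1.mono fun f hf => by simp_all [Prog.any]).trans
      (h2.mono fun f hf => by simp_all [Prog.any])
  | iteTrue _ _ h => exact h.mono fun f hf => by simp_all [Prog.any]
  | iteFalse _ _ h => exact h.mono fun f hf => by simp_all [Prog.any]
  | loopTrue _ _ _ h1 h2 => exact (h1.mono fun f hf => by simp_all [Prog.any]).trans h2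
  | loopFalse _ => exact .refl _ _

/-- `P`, started in `s`, terminates, and its step count and final memory satisfy `Q`. -/
def Tri (P : Prog) (s : Store) (Q : ℕ → Store → Prop) : Prop :=
  ∃ k s', Runs P s k s' ∧ Q k s'

namespace Tri

variable {P R : Prog} {s : Store} {Q Q' : ℕ → Store → Prop} {t : Test}

/-- The frame of the executed program is handed over together with its postcondition, so unchanged
cells can be recovered afterwards. -/
theorem mono (h : Tri P s Q) (hQ : ∀ k s', Frame P s s' → Q k s' → Q' k s') : Tri P s Q' := by
  obtain ⟨k, s', hr, hq⟩ := h
  exact ⟨k, s', hr, hQ _ _ hr.frame hq⟩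

theorem skip (h : Q 1 s) : Tri .skip s Q := ⟨_, _, .skip s, h⟩

theorem seq (h : Tri P s fun k s' => Tri R s' fun l s'' => Q (k + l) s'') :
    Tri (.seq P R) s Q := by
  obtain ⟨k, s', hr, l, s'', hr', hq⟩ := h
  exact ⟨_, _, .seq hr hr', hq⟩

theorem andThen (h : Tri P s Q')
    (h' : ∀ k s', Frame P s s' → Q' k s' → Tri R s' fun l s'' => Q (k + l) s'') :
    Tri (.seq P R) s Q := seq (h.mono h')

theorem ite (h1 : t.Holds s → Tri P s fun k => Q (k + 1))
    (h2 : ¬ t.Holds s → Tri R s fun k => Q (k + 1)) : Tri (.ite t P R) s Q := by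
  by_cases h : t.Holds s
  · obtain ⟨k, s', hr, hq⟩ := h1 h
    exact ⟨_, _, .iteTrue h hr, hq⟩
  · obtain ⟨k, s', hr, hq⟩ := h2 h
    exact ⟨_, _, .iteFalse h hr, hq⟩

theorem loop_true (ht : t.Holds s)
    (h : Tri P s fun k s' => Tri (.loop t P) s' fun l s'' => Q (k + l + 1) s'') :
    Tri (.loop t P) s Q := by
  obtain ⟨k, s', hr, l, s'', hr', hq⟩ := h
  exact ⟨_, _, .loopTrue ht hr hr', hq⟩

theorem loop_false (ht : ¬ t.Holds s) (h : Q 1 s) : Tri (.loop t P) s Q :=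
  ⟨_, _, .loopFalse ht, h⟩

/-- A loop whose number of iterations is bounded, with an invariant that counts iterations. -/
theorem loop_count {I : ℕ → Store → Prop} {B c : ℕ} (h0 : I 0 s)
    (hI : ∀ j s1, Frame P s s1 → I j s1 → t.Holds s1 →
      j < B ∧ Tri P s1 fun k s2 => k ≤ c ∧ I (j + 1) s2)
    (hQ : ∀ k s' j, Frame P s s' → k ≤ j * (c + 1) + 1 → j ≤ B → I j s' → ¬ t.Holds s' → Q k s') :
    Tri (.loop t P) s Q := by
  -- Induction on the number `r` of iterations still allowed; at `r = 0` the test must fail, since a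
  -- true test would give `j < B`.
  have key : ∀ r j s1, Frame P s s1 → I j s1 → j ≤ B → B - j = r →
      Tri (.loop t P) s1 fun k s' => ∃ j', Frame P s s' ∧
        j * (c + 1) + k ≤ j' * (c + 1) + 1 ∧ j' ≤ B ∧ I j' s' ∧ ¬ t.Holds s' := by
    intro r
    induction r with
    | zero =>
      intro j s1 hf hi hj hr
      have : ¬ t.Holds s1 := fun h => by have := (hI j s1 hf hi h).1; omega
      exact loop_false this ⟨j, hf, le_rfl, hj, hi, this⟩
    | succ r ih =>
      intro j s1 hf hi hj hr
      by_cases h : t.Holds s1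
      · obtain ⟨hjB, hT⟩ := hI j s1 hf hi h
        refine loop_true h (hT.mono ?_)
        rintro k s2 hf2 ⟨hk, hi2⟩
        refine (ih (j + 1) s2 (hf.trans hf2) hi2 hjB (by omega)).mono ?_
        rintro l s3 - ⟨j', h1, h2, h3⟩
        refine ⟨j', h1, ?_, h3⟩
        nlinarith
      · exact loop_false h ⟨j, hf, le_rfl, hj, hi, h⟩
  refine (key B 0 s (.refl _ _) h0 (Nat.zero_le _) rfl).mono ?_
  rintro k s' - ⟨j, h1, h2, h3, h4, h5⟩
  exact hQ k s' j h1 (by omega) h3 h4 h5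

end Tri

/-- A straight-line program. -/
def block : List Instr → Prog
  | [] => .skip
  | i :: l => .seq (.instr i) (block l)

theorem Tri.block {l : List Instr} {s : Store} {Q : ℕ → Store → Prop}
    (h : Q (l.length + 1) (l.foldl Instr.exec s)) : Tri (block l) s Q := by
  induction l generalizing s Q with
  | nil => exact Tri.skip h
  | cons i l ih =>
    refine Tri.seq ⟨1, _, .instr i s, ih ?_⟩
    simpa [add_comm, add_left_comm] using h

theorem Tri.block_seq {l : List Instr} {R : Prog} {s : Store} {Q : ℕ → Store → Prop}
    (h : Tri R (l.foldl Instr.exec s) fun k s' => Q (l.length + 1 + k) s') :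
    Tri (.seq (RealRAM.block l) R) s Q := Tri.seq (Tri.block h)

/-- `for x = 0, …, y - 1 do body` (the integer variable `99` is scratch). -/
def forN (x y : ℕ) (body : Prog) : Prog :=
  .seq (block [.natConst x 0])
    (.loop (.natLt x y) (.seq body (block [.natConst 99 1, .natAdd x x 99])))

/-- The `4` per round is the test plus the increment block, whose closing `skip` also costs a step;
the `3` is the initial block and the last, failing test. The invariant is required after the
increment. -/
theorem Tri.forN {x y : ℕ} {body : Prog} {s : Store} {Q : ℕ → Store → Prop} (N : ℕ)
    (I : ℕ → Store → Prop) (c : ℕ → ℕ) (hy : s.natVar y = N)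
    (hxb : body.any (Instr.writesNat x) = false) (hyb : body.any (Instr.writesNat y) = false)
    (hd : (x == 99 || x == y || y == 99) = false)
    (h0 : I 0 (s.setNat x 0))
    (hI : ∀ i < N, ∀ s1, Frame (forN x y body) s s1 → s1.natVar x = i → s1.natVar y = N →
      I i s1 → Tri body s1 fun k s2 => k ≤ c i ∧ I (i + 1) ((s2.setNat 99 1).setNat x (i + 1)))
    (hQ : ∀ k s', Frame (forN x y body) s s' → s'.natVar x = N →
      k ≤ (∑ i ∈ Finset.range N, (c i + 4)) + 3 → I N s' → Q k s') :
    Tri (forN x y body) s Q := by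
  have hx99 : x ≠ 99 ∧ x ≠ y ∧ y ≠ 99 := by
    simp only [Bool.or_eq_false_iff, beq_eq_false_iff_ne] at hd
    exact ⟨hd.1.1, hd.1.2, hd.2⟩
  obtain ⟨hx, hxy, hy99⟩ := hx99
  set T := RealRAM.forN x y body with hT
  have hinner : (body.seq (RealRAM.block [.natConst 99 1, .natAdd x x 99])).Sub T := by
    intro f hf
    simp only [hT, RealRAM.forN, Prog.any, Bool.or_eq_false_iff] at hf ⊢
    exact hf.2
  have hbody : body.Sub T := by
    intro f hf
    have := hinner f hf
    simp only [Prog.any, Bool.or_eq_false_iff] at this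
    exact this.1
  have key : ∀ r i s1, Frame T s s1 → s1.natVar x = i → s1.natVar y = N → I i s1 → i ≤ N →
      N - i = r → Tri (.loop (.natLt x y) (body.seq (RealRAM.block [.natConst 99 1, .natAdd x x 99])))
        s1 fun k s' => Frame T s s' ∧ s'.natVar x = N ∧
          (∑ i ∈ Finset.range i, (c i + 4)) + k ≤ (∑ i ∈ Finset.range N, (c i + 4)) + 1 ∧
          I N s' := by
    intro r
    induction r with
    | zero =>
      intro i s1 hf hi hyN hI1 hiN hr
      obtain rfl : i = N := by omega
      exact Tri.loop_false (by simp [hi, hyN]) ⟨hf, hi, le_rfl, hI1⟩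
    | succ r ih =>
      intro i s1 hf hi hyN hI1 hiN hr
      refine Tri.loop_true (by simp [hi, hyN]; omega) (Tri.andThen (hI i (by omega) s1 hf hi hyN hI1) ?_)
      rintro k s2 hf2 ⟨hk, hI2⟩
      have e1 : s2.natVar x = i := by rw [hf2.nat x hxb, hi]
      have e2 : s2.natVar y = N := by rw [hf2.nat y hyb, hyN]
      have e3 : ([.natConst 99 1, .natAdd x x 99] : List Instr).foldl Instr.exec s2
          = (s2.setNat 99 1).setNat x (i + 1) := by
        simp [hx, e1]
      refine Tri.block ?_
      rw [e3]
      refine (ih (i + 1) _ ((hf.trans (hf2.mono hbody)).trans ?_) (by simp) ?_ hI2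
        (by omega) (by omega)).mono ?_
      · rw [← e3]
        refine (Runs.frame (P := RealRAM.block [.natConst 99 1, .natAdd x x 99]) (k := 3) ?_).mono ?_
        · exact .seq (.instr _ _) (.seq (.instr _ _) (.skip _))
        · intro f hf
          have := hinner f hf
          simp only [Prog.any, Bool.or_eq_false_iff] at this
          exact this.2
      · simp [Ne.symm hxy, hy99, e2]
      · rintro l s3 - ⟨h1, h2, h3, h4⟩
        refine ⟨h1, h2, ?_, h4⟩
        rw [Finset.sum_range_succ] at h3
        simp only [List.length_cons, List.length_nil]
        omega
  refine Tri.block_seq ((key N 0 _ ?_ (by simp) ?_ h0 (Nat.zero_le _) rfl).mono ?_)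
  · refine (Runs.frame (P := RealRAM.block [.natConst x 0]) (k := 2) ?_).mono ?_
    · exact .seq (.instr _ _) (.skip _)
    · intro f hf
      simp only [hT, RealRAM.forN, Prog.any, Bool.or_eq_false_iff] at hf ⊢
      exact hf.1
  · simp [Ne.symm hxy, hy]
  · rintro k s' - ⟨h1, h2, h3, h4⟩
    refine hQ _ _ h1 h2 ?_ h4
    simp at h3 ⊢
    omega

end RealRAM

/-! ### Order statistics of lists. -/

namespace RealRAM

/-- The segment of length `n` of the array `f` that starts at `a`. -/
def seg (f : ℕ → ℝ) (a n : ℕ) : List ℝ := (List.range n).map fun t => f (a + t)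

@[simp] theorem length_seg (f : ℕ → ℝ) (a n : ℕ) : (seg f a n).length = n := by simp [seg]

@[simp] theorem seg_zero (f : ℕ → ℝ) (a : ℕ) : seg f a 0 = [] := rfl

theorem seg_succ (f : ℕ → ℝ) (a n : ℕ) : seg f a (n + 1) = seg f a n ++ [f (a + n)] := by
  simp [seg, List.range_succ]

theorem seg_add (f : ℕ → ℝ) (a n n' : ℕ) : seg f a (n + n') = seg f a n ++ seg f (a + n) n' := by
  induction n' with
  | zero => simp
  | succ n' ih => rw [← add_assoc, seg_succ, ih, seg_succ, List.append_assoc, add_assoc]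

theorem seg_congr {f g : ℕ → ℝ} {a n : ℕ} (h : ∀ j, a ≤ j → j < a + n → f j = g j) :
    seg f a n = seg g a n := by
  simp only [seg, List.map_inj_left, List.mem_range]
  intro t ht
  exact h _ (by omega) (by omega)

open Classical in
/-- `p` is the entry with index `k` (counted from `0`) of the sorted list `l`. -/
def IsRank (l : List ℝ) (k : ℕ) (p : ℝ) : Prop :=
  l.countP (· < p) ≤ k ∧ k < l.countP (· ≤ p)

section Rank

open Classical

theorem IsRank.exists_mem {l : List ℝ} {k : ℕ} {p : ℝ} (h : IsRank l k p) : p ∈ l := by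
  by_contra hp
  have : l.countP (· ≤ p) = l.countP (· < p) := by
    apply List.countP_congr
    intro x hx
    have : x ≠ p := fun e => hp (e ▸ hx)
    simp [le_iff_lt_or_eq, this]
  have := h.1; have := h.2; omega

theorem countP_le_add_countP_gt (l : List ℝ) (p : ℝ) :
    l.countP (· ≤ p) + l.countP (p < ·) = l.length := by
  rw [List.length_eq_countP_add_countP (fun x => decide (x ≤ p))]
  simp

/-- Lets the rank of a pivot be checked with the two strict filters, by counting the smaller and the
larger entries. -/
theorem IsRank.iff_gt {l : List ℝ} {k : ℕ} {p : ℝ} :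
    IsRank l k p ↔ l.countP (· < p) ≤ k ∧ k + l.countP (p < ·) < l.length := by
  have := countP_le_add_countP_gt l p
  unfold IsRank
  constructor <;> rintro ⟨h1, h2⟩ <;> exact ⟨h1, by omega⟩

/-- Take the least entry `p` with more than `k` entries `≤ p`. If more than `k` entries were `< p`,
the largest of these would be a smaller candidate. -/
theorem exists_isRank (l : List ℝ) (k : ℕ) (hk : k < l.length) : ∃ p, IsRank l k p := by
  have hf : ({p ∈ l.toFinset | k < l.countP (· ≤ p)} : Finset ℝ).Nonempty := by
    have hne : l.toFinset.Nonempty := by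
      rw [List.toFinset_nonempty_iff]; rintro rfl; simp at hk
    refine ⟨l.toFinset.max' hne, Finset.mem_filter.2 ⟨Finset.max'_mem _ _, ?_⟩⟩
    rw [List.countP_eq_length.2]
    · exact hk
    · intro x hx
      simpa using Finset.le_max' _ x (List.mem_toFinset.2 hx)
  set F : Finset ℝ := {p ∈ l.toFinset | k < l.countP (· ≤ p)} with hF
  refine ⟨F.min' hf, ?_, (Finset.mem_filter.1 (F.min'_mem hf)).2⟩
  by_contra hlt
  push Not at hlt
  set p := F.min' hf
  have hne : (l.toFinset.filter (· < p)).Nonempty := by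
    obtain ⟨x, hx, hxp⟩ := List.countP_pos_iff.1 (lt_of_le_of_lt (Nat.zero_le _) hlt)
    exact ⟨x, by simpa using ⟨hx, by simpa using hxp⟩⟩
  set q := (l.toFinset.filter (· < p)).max' hne
  have hq := Finset.mem_filter.1 ((l.toFinset.filter (· < p)).max'_mem hne)
  have hqF : q ∈ F := by
    refine Finset.mem_filter.2 ⟨hq.1, lt_of_lt_of_le hlt ?_⟩
    apply List.countP_mono_left
    intro x hx hxp
    simpa using Finset.le_max' _ x (by simpa using ⟨hx, by simpa using hxp⟩)
  exact absurd (F.min'_le q hqF) (not_le.2 hq.2)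

/-- The answer `q` lies below the pivot, so removing the entries `≥ p` changes neither count. This
justifies recursing into the lower part with the same rank. -/
theorem IsRank.of_filter_lt {l : List ℝ} {k : ℕ} {p q : ℝ}
    (h : IsRank (l.filter (· < p)) k q) : IsRank l k q := by
  have hq : q < p := by simpa using (List.mem_filter.1 h.exists_mem).2
  unfold IsRank at h ⊢
  rw [List.countP_filter, List.countP_filter] at h
  convert h using 3 <;> · 
    ext x
    simp
    intro hx
    linarith

/-- The answer lies above the pivot, so both counts lose exactly the entries `≤ p`, and the rank is
lowered by their number. -/
theorem IsRank.of_filter_gt {l : List ℝ} {k : ℕ} {p q : ℝ} (hk : l.countP (· ≤ p) ≤ k)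
    (h : IsRank (l.filter (p < ·)) (k - l.countP (· ≤ p)) q) : IsRank l k q := by
  have hq : p < q := by simpa using (List.mem_filter.1 h.exists_mem).2
  unfold IsRank at h ⊢
  have key : ∀ f : ℝ → Bool, (∀ x ≤ p, f x = true) →
      l.countP f = l.countP (· ≤ p) + (l.filter (p < ·)).countP f := by
    intro f hf
    clear h hk
    induction l with
    | nil => simp
    | cons x l ih =>
      rw [List.countP_cons, List.countP_cons, ih]
      rcases le_or_gt x p with hx | hx
      · simp [hf x hx, hx, not_lt.2 hx]; omega
      · simp [hx, not_le.2 hx, List.countP_cons]; omega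
  rw [key (· < q) (by intro x hx; simpa using hx.trans_lt hq),
    key (· ≤ q) (by intro x hx; simpa using (hx.trans_lt hq).le)]
  omega

end Rank

/-! ### Filtering a segment -/

/-- Appends to the array `dst`, at position `22`, the entries `21` of the segment `[20, 21)` of the
real array `10` that pass the test `t` against the real variable `20`. -/
def filt (t : Test) (dst : ℕ) : Prog :=
  .seq (block [.natSub 28 21 20])
    (forN 23 28 (.seq (block [.natAdd 25 20 23, .realRead 21 10 25])
      (.ite t (block [.realWrite dst 22 21, .natConst 39 1, .natAdd 22 22 39]) .skip)))

-- The destination may be the array being filtered, provided that the writing position `w` lies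
-- beyond the segment: this is how the selection stores its subproblems behind their parent.
open Classical in
theorem filt_spec {t : Test} {r : ℝ → ℝ → Prop}
    (ht : ∀ s, t.Holds s ↔ r (s.realVar 20) (s.realVar 21)) {dst : ℕ} {s : Store} {a n w : ℕ}
    (ha : s.natVar 20 = a) (hn : s.natVar 21 = a + n) (hw : s.natVar 22 = w)
    (hd : dst ≠ 10 ∨ a + n ≤ w) :
    Tri (filt t dst) s fun k s' =>
      k ≤ 15 * n + 5 ∧
      s'.natVar 22 = w + ((seg (s.realArr 10) a n).filter (r (s.realVar 20) ·)).length ∧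
      seg (s'.realArr dst) w ((seg (s.realArr 10) a n).filter (r (s.realVar 20) ·)).length =
        (seg (s.realArr 10) a n).filter (r (s.realVar 20) ·) ∧
      ∀ j < w, s'.realArr dst j = s.realArr dst j := by
  refine Tri.block_seq ?_
  refine Tri.forN n (fun i s1 => 
      (∀ j < a + n, s1.realArr 10 j = s.realArr 10 j) ∧
      s1.natVar 22 = w + ((seg (s.realArr 10) a i).filter (r (s.realVar 20) ·)).length ∧
      seg (s1.realArr dst) w ((seg (s.realArr 10) a i).filter (r (s.realVar 20) ·)).length =
        (seg (s.realArr 10) a i).filter (r (s.realVar 20) ·) ∧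
      ∀ j < w, s1.realArr dst j = s.realArr dst j) (fun _ => 8) ?_ rfl rfl rfl ?_ ?_ ?_
  · simp [ha, hn]
  · simp [hw]
  · rintro i hi s1 hf h23 h28 ⟨h1, h2, h3, h4⟩
    have h20 : s1.natVar 20 = a := by rw [hf.nat 20 rfl]; simp [ha]
    have hr20 : s1.realVar 20 = s.realVar 20 := by rw [hf.real 20 rfl]; simp
    refine Tri.block_seq (Tri.ite ?_ ?_)
    · intro h
      rw [ht] at h
      simp [h20, h23, hr20, h1 (a + i) (by omega)] at h
      refine Tri.block ⟨by simp, ?_⟩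
      have : (seg (s.realArr 10) a (i + 1)).filter (r (s.realVar 20) ·) =
          (seg (s.realArr 10) a i).filter (r (s.realVar 20) ·) ++ [s.realArr 10 (a + i)] := by
        simp [seg_succ, List.filter_append, h]
      rw [this]
      simp only [List.length_append, List.length_singleton, seg_succ]
      simp [h20, h23, h2, h1 (a + i) (by omega)]
      refine ⟨?_, rfl, ?_, ?_⟩
      · intro j hj
        split_ifs with hd'
        · subst hd'
          rw [Function.update_of_ne (by omega)]
          exact h1 j hj
        · exact h1 j hj
      · rw [← h3]
        simp only [length_seg]
        apply seg_congr
        intro j hj1 hj2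
        rw [Function.update_of_ne]
        omega
      · intro j hj
        rw [Function.update_of_ne (by omega)]
        exact h4 j hj
    · intro h
      rw [ht] at h
      simp [h20, h23, hr20, h1 (a + i) (by omega)] at h
      refine Tri.skip ⟨by simp, ?_⟩
      have : (seg (s.realArr 10) a (i + 1)).filter (r (s.realVar 20) ·) =
          (seg (s.realArr 10) a i).filter (r (s.realVar 20) ·) := by
        simp [seg_succ, List.filter_append, h]
      rw [this]
      simpa [h20, h23] using ⟨h1, h2, h3, h4⟩
  · rintro k s' hf - hk ⟨h1, h2, h3, h4⟩
    refine ⟨?_, h2, h3, h4⟩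
    simp at hk ⊢
    omega

end RealRAM

namespace RealRAM

open Classical in
theorem filt_lt_spec {dst : ℕ} {s : Store} {a n w : ℕ}
    (ha : s.natVar 20 = a) (hn : s.natVar 21 = a + n) (hw : s.natVar 22 = w)
    (hd : dst ≠ 10 ∨ a + n ≤ w) :
    Tri (filt (.realLt 21 20) dst) s fun k s' =>
      k ≤ 15 * n + 5 ∧
      s'.natVar 22 = w + (seg (s.realArr 10) a n).countP (· < s.realVar 20) ∧
      seg (s'.realArr dst) w ((seg (s.realArr 10) a n).countP (· < s.realVar 20)) =
        (seg (s.realArr 10) a n).filter (· < s.realVar 20) ∧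
      ∀ j < w, s'.realArr dst j = s.realArr dst j := by
  refine (filt_spec (r := fun p x => x < p) (fun s => Iff.rfl) ha hn hw hd).mono ?_
  rintro k s' - ⟨h1, h2, h3, h4⟩
  have e : (seg (s.realArr 10) a n).countP (· < s.realVar 20) =
      ((seg (s.realArr 10) a n).filter (fun x => decide (x < s.realVar 20))).length :=
    List.countP_eq_length_filter
  rw [e]
  refine ⟨h1, ?_, ?_, h4⟩
  · convert h2
  · convert h3

open Classical in
theorem filt_gt_spec {dst : ℕ} {s : Store} {a n w : ℕ}
    (ha : s.natVar 20 = a) (hn : s.natVar 21 = a + n) (hw : s.natVar 22 = w)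
    (hd : dst ≠ 10 ∨ a + n ≤ w) :
    Tri (filt (.realLt 20 21) dst) s fun k s' =>
      k ≤ 15 * n + 5 ∧
      s'.natVar 22 = w + (seg (s.realArr 10) a n).countP (s.realVar 20 < ·) ∧
      seg (s'.realArr dst) w ((seg (s.realArr 10) a n).countP (s.realVar 20 < ·)) =
        (seg (s.realArr 10) a n).filter (s.realVar 20 < ·) ∧
      ∀ j < w, s'.realArr dst j = s.realArr dst j := by
  refine (filt_spec (r := fun p x => p < x) (fun s => Iff.rfl) ha hn hw hd).mono ?_
  rintro k s' - ⟨h1, h2, h3, h4⟩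
  have e : (seg (s.realArr 10) a n).countP (s.realVar 20 < ·) =
      ((seg (s.realArr 10) a n).filter (fun x => decide (s.realVar 20 < x))).length :=
    List.countP_eq_length_filter
  rw [e]
  refine ⟨h1, ?_, ?_, h4⟩
  · convert h2
  · convert h3

/-! ### Selection in quadratic time -/

/-- Finds an entry of rank `26` of the segment `[20, 21)` of the real array `10`; the answer is
put into the real variable `22`. -/
def brute : Prog :=
  .seq (block [.natSub 29 21 20])
    (forN 27 29
      (.seq (block [.natAdd 40 20 27, .realRead 20 10 40, .natConst 22 0])
        (.seq (filt (.realLt 21 20) 11)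
          (.seq (block [.natCopy 24 22, .natConst 22 0])
            (.seq (filt (.realLt 20 21) 11)
              (.seq (block [.natAdd 41 26 22])
                (.ite (.natLe 24 26)
                  (.ite (.natLt 41 29) (block [.realCopy 22 20]) .skip) .skip)))))))

theorem brute_spec {s : Store} {a n q : ℕ} (ha : s.natVar 20 = a) (hn : s.natVar 21 = a + n)
    (hq : s.natVar 26 = q) (hqn : q < n) :
    Tri brute s fun k s' => k ≤ 100 * (n + 1) ^ 2 ∧
      IsRank (seg (s.realArr 10) a n) q (s'.realVar 22) := by
  refine Tri.block_seq ?_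
  -- A conditional invariant: several equal entries may pass the rank test, and each is a correct
  -- answer. That one does pass is supplied at the end by `exists_isRank`.
  refine Tri.forN n (fun i s1 => (∃ j < i, IsRank (seg (s.realArr 10) a n) q (s.realArr 10 (a + j))) →
      IsRank (seg (s.realArr 10) a n) q (s1.realVar 22)) (fun _ => 30 * n + 30)
      ?_ rfl rfl rfl ?_ ?_ ?_
  · simp [ha, hn]
  · simp
  · rintro i hi s1 hf h27 h29 h1
    have h20 : s1.natVar 20 = a := by rw [hf.nat 20 rfl]; simp [ha]
    have h21 : s1.natVar 21 = a + n := by rw [hf.nat 21 rfl]; simp [hn]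
    have h26 : s1.natVar 26 = q := by rw [hf.nat 26 rfl]; simp [hq]
    have hA : s1.realArr 10 = s.realArr 10 := by rw [hf.realArr 10 rfl]; simp
    refine Tri.block_seq ?_
    refine Tri.andThen (filt_lt_spec (a := a) (n := n) (w := 0) (by simp [h20]) (by simp [h21])
      (by simp) (by simp)) ?_
    rintro k1 s2 hf2 ⟨hk1, e1, -, -⟩
    simp [h20, h27, hA] at e1
    have a22 : s2.realVar 20 = s.realArr 10 (a + i) := by
      rw [hf2.real 20 rfl]; simp [h20, h27, hA]
    refine Tri.block_seq ?_
    refine Tri.andThen (filt_gt_spec (a := a) (n := n) (w := 0)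
      (by simp; rw [hf2.nat 20 rfl]; simp [h20])
      (by simp; rw [hf2.nat 21 rfl]; simp [h21]) (by simp) (by simp)) ?_
    rintro k2 s3 hf3 ⟨hk2, e2, -, -⟩
    have b10 : s2.realArr 10 = s.realArr 10 := by
      rw [hf2.realArr 10 rfl]; simp [hA]
    have b20 : s3.realVar 20 = s.realArr 10 (a + i) := by
      rw [hf3.real 20 rfl]; simp [a22]
    have b24 : s3.natVar 24 = s2.natVar 22 := by
      rw [hf3.nat 24 rfl]; simp
    have b26 : s3.natVar 26 = q := by
      rw [hf3.nat 26 rfl]; simp; rw [hf2.nat 26 rfl]; simp [h26]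
    have b29 : s3.natVar 29 = n := by
      rw [hf3.nat 29 rfl]; simp; rw [hf2.nat 29 rfl]; simp [h29]
    have b22 : s3.realVar 22 = s1.realVar 22 := by
      rw [hf3.real 22 rfl]; simp; rw [hf2.real 22 rfl]; simp
    simp [a22, b10] at e2
    refine Tri.block_seq ?_
    have hR : IsRank (seg (s.realArr 10) a n) q (s.realArr 10 (a + i)) ↔
        s3.natVar 24 ≤ q ∧ q + s3.natVar 22 < n := by
      rw [IsRank.iff_gt, b24, e1, e2]
      simp
    have hlast : ∀ s4 : Store, (s4.realVar 22 = if s3.natVar 24 ≤ q ∧ q + s3.natVar 22 < n then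
        s.realArr 10 (a + i) else s1.realVar 22) →
        ((∃ j < i + 1, IsRank (seg (s.realArr 10) a n) q (s.realArr 10 (a + j))) →
        IsRank (seg (s.realArr 10) a n) q (s4.realVar 22)) := by
      intro s4 h4
      rw [h4]
      split_ifs with hc
      · intro _; exact hR.2 hc
      · rintro ⟨j, hj, hjr⟩
        rcases Nat.lt_succ_iff_lt_or_eq.1 hj with hj | rfl
        · exact h1 ⟨j, hj, hjr⟩
        · exact absurd (hR.1 hjr) hc
    refine Tri.ite ?_ ?_
    · intro hc1
      simp [b26] at hc1
      refine Tri.ite ?_ ?_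
      · intro hc2
        simp [b26, b29] at hc2
        refine Tri.block ⟨?_, hlast _ ?_⟩
        · simp; omega
        · simp [b20, hc1, hc2]
      · intro hc2
        simp [b26, b29] at hc2
        refine Tri.skip ⟨?_, hlast _ ?_⟩
        · simp; omega
        · simp [b22, hc2]
    · intro hc1
      simp [b26] at hc1
      refine Tri.skip ⟨?_, hlast _ ?_⟩
      · simp; omega
      · simp [b22, hc1]
  · rintro k s' hf - hk h
    refine ⟨?_, h ?_⟩
    · simp at hk ⊢
      nlinarith
    · obtain ⟨p, hp⟩ := exists_isRank (seg (s.realArr 10) a n) q (by simpa using hqn)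
      have := hp.exists_mem
      simp only [seg, List.mem_map, List.mem_range] at this
      obtain ⟨j, hj, rfl⟩ := this
      exact ⟨j, hj, hp⟩

end RealRAM

namespace RealRAM

/-! ### Selection in linear time -/

section MedianOfMedians

open Classical

/-- A group whose median is not below `p` has at most `2` entries below `p`; any other group has at
most `5 = 2 + 3`. -/
theorem countP_lt_groups (f m : ℕ → ℝ) (a b : ℕ) (p : ℝ) (G : ℕ)
    (h : ∀ g < G, IsRank (seg f (a + 5 * g) 5) 2 (m (b + g))) :
    (seg f a (5 * G)).countP (· < p) ≤ 2 * G + 3 * (seg m b G).countP (· < p) := by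
  induction G with
  | zero => simp
  | succ G ih =>
    rw [mul_add, mul_one, seg_add f, seg_succ m, List.countP_append, List.countP_append]
    have := ih fun g hg => h g (by omega)
    have hG := h G (by omega)
    by_cases hp : m (b + G) < p
    · have h5 : (seg f (a + 5 * G) 5).countP (· < p) ≤ 5 :=
        List.countP_le_length.trans (by simp)
      simp [hp]
      omega
    · have h2 : (seg f (a + 5 * G) 5).countP (· < p) ≤ 2 := by
        refine le_trans (List.countP_mono_left ?_) hG.1
        intro x _ hx
        simp only [decide_eq_true_eq] at hx ⊢
        linarith
      simp [hp]
      omega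

theorem countP_gt_groups (f m : ℕ → ℝ) (a b : ℕ) (p : ℝ) (G : ℕ)
    (h : ∀ g < G, IsRank (seg f (a + 5 * g) 5) 2 (m (b + g))) :
    (seg f a (5 * G)).countP (p < ·) ≤ 2 * G + 3 * (seg m b G).countP (p < ·) := by
  induction G with
  | zero => simp
  | succ G ih =>
    rw [mul_add, mul_one, seg_add f, seg_succ m, List.countP_append, List.countP_append]
    have := ih fun g hg => h g (by omega)
    have hG := IsRank.iff_gt.1 (h G (by omega))
    by_cases hp : p < m (b + G)
    · have h5 : (seg f (a + 5 * G) 5).countP (p < ·) ≤ 5 :=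
        List.countP_le_length.trans (by simp)
      simp [hp]
      omega
    · have h2 : (seg f (a + 5 * G) 5).countP (p < ·) ≤
          (seg f (a + 5 * G) 5).countP (m (b + G) < ·) := by
        refine List.countP_mono_left ?_
        intro x _ hx
        simp only [decide_eq_true_eq] at hx ⊢
        linarith
      have := hG.2
      simp only [length_seg] at this
      simp [hp]
      omega

/-- At most `q` of the `2 q` medians lie on either side of their median `p`. The groups thus
contribute at most `2 (2 q) + 3 q = 7 q` entries to each side, and at most `9` entries belong to no
group. -/
theorem median_of_medians {f m : ℕ → ℝ} {a b n q : ℕ} {p : ℝ} (hn : 10 * q ≤ n)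
    (hn' : n < 10 * q + 10) (h : ∀ g < 2 * q, IsRank (seg f (a + 5 * g) 5) 2 (m (b + g)))
    (hp : IsRank (seg m b (2 * q)) q p) :
    (seg f a n).countP (· < p) ≤ 7 * q + 9 ∧ (seg f a n).countP (p < ·) ≤ 7 * q + 9 := by
  obtain ⟨r, rfl⟩ := Nat.exists_eq_add_of_le hn
  have h1 := countP_lt_groups f m a b p (2 * q) h
  have h2 := countP_gt_groups f m a b p (2 * q) h
  have e : 10 * q = 5 * (2 * q) := by ring
  rw [seg_add, List.countP_append, List.countP_append, e]
  have h3 := hp.1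
  have h4 := (IsRank.iff_gt.1 hp).2
  have h5 : (seg f (a + 5 * (2 * q)) r).countP (· < p) ≤ r :=
    List.countP_le_length.trans (by simp)
  have h6 : (seg f (a + 5 * (2 * q)) r).countP (p < ·) ≤ r :=
    List.countP_le_length.trans (by simp)
  rw [length_seg] at h4
  constructor <;> omega

end MedianOfMedians

/-- Appends to the segment `[30, 31)` of the real array `10` the medians of its successive groups
of five entries. -/
def groupMedians : Prog :=
  .seq (block [.natCopy 36 30, .natCopy 37 31, .natConst 38 0, .natConst 42 5, .natConst 43 10,
      .natAdd 44 36 43])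
    (.loop (.natLe 44 31)
      (.seq (block [.natCopy 20 36, .natAdd 21 20 42, .natConst 26 2])
        (.seq brute
          (.seq (block [.realWrite 10 37 22, .natConst 39 1, .natAdd 37 37 39, .natCopy 20 21,
              .natAdd 21 20 42])
            (.seq brute
              (block [.realWrite 10 37 22, .natConst 39 1, .natAdd 37 37 39, .natAdd 38 38 39,
                .natCopy 36 21, .natAdd 44 36 43]))))))

/-- Groups are treated in pairs: the number `q = ⌊n/10⌋` of rounds is then directly the rank of the
median among the `2 q` medians, and no integer division is needed. The at most nine remaining
entries get no median. -/
theorem groupMedians_spec {s : Store} {a n : ℕ} (ha : s.natVar 30 = a)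
    (hn : s.natVar 31 = a + n) :
    Tri groupMedians s fun k s' => ∃ q, k ≤ 800 * n + 10 ∧ 10 * q ≤ n ∧ n < 10 * q + 10 ∧
      s'.natVar 37 = a + n + 2 * q ∧ s'.natVar 38 = q ∧
      (∀ j < a + n, s'.realArr 10 j = s.realArr 10 j) ∧
      ∀ g < 2 * q, IsRank (seg (s.realArr 10) (a + 5 * g) 5) 2 (s'.realArr 10 (a + n + g)) := by
  refine Tri.block_seq ?_
  -- Two runs of `brute` on five entries cost at most `2 * 100 * 6 ^ 2 = 7200` steps; the rest is
  -- bookkeeping. With ten entries consumed per round this stays below `800 n`.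
  refine Tri.loop_count (B := n) (c := 7300) (I := fun q s1 => 10 * q ≤ n ∧
      s1.natVar 36 = a + 10 * q ∧ s1.natVar 44 = a + 10 * q + 10 ∧
      s1.natVar 37 = a + n + 2 * q ∧ s1.natVar 38 = q ∧
      (∀ j < a + n, s1.realArr 10 j = s.realArr 10 j) ∧
      ∀ g < 2 * q, IsRank (seg (s.realArr 10) (a + 5 * g) 5) 2 (s1.realArr 10 (a + n + g)))
    ?_ ?_ ?_
  · simp [ha, hn]
  · rintro q s1 hf ⟨h1, h2, h3, h4, h5, h6, h7⟩ hc
    have h31 : s1.natVar 31 = a + n := by rw [hf.nat 31 rfl]; simp [hn]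
    have h42 : s1.natVar 42 = 5 := by rw [hf.nat 42 rfl]; simp
    have h43 : s1.natVar 43 = 10 := by rw [hf.nat 43 rfl]; simp
    simp [h3, h31] at hc
    refine ⟨by omega, ?_⟩
    refine Tri.block_seq ?_
    refine Tri.andThen (brute_spec (a := a + 10 * q) (n := 5) (q := 2) (by simp [h2])
      (by simp [h2, h42]) (by simp) (by norm_num)) ?_
    rintro k1 s2 hf2 ⟨hk1, hr1⟩
    simp at hr1
    have b10 : s2.realArr 10 = s1.realArr 10 := by rw [hf2.realArr 10 rfl]; simp
    have b21 : s2.natVar 21 = a + 10 * q + 5 := by rw [hf2.nat 21 rfl]; simp [h2, h42]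
    have b42 : s2.natVar 42 = 5 := by rw [hf2.nat 42 rfl]; simp [h42]
    have b43 : s2.natVar 43 = 10 := by rw [hf2.nat 43 rfl]; simp [h43]
    have b37 : s2.natVar 37 = a + n + 2 * q := by rw [hf2.nat 37 rfl]; simp [h4]
    have b38 : s2.natVar 38 = q := by rw [hf2.nat 38 rfl]; simp [h5]
    have b26 : s2.natVar 26 = 2 := by rw [hf2.nat 26 rfl]; simp
    refine Tri.block_seq ?_
    refine Tri.andThen (brute_spec (a := a + 10 * q + 5) (n := 5) (q := 2) (by simp [b21])
      (by simp [b21, b42]) (by simp [b26]) (by norm_num)) ?_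
    rintro k2 s3 hf3 ⟨hk2, hr2⟩
    simp [b37, b10] at hr2
    have c10 : s3.realArr 10 = Function.update (s1.realArr 10) (a + n + 2 * q) (s2.realVar 22) := by
      rw [hf3.realArr 10 rfl]; simp [b37, b10]
    have c21 : s3.natVar 21 = a + 10 * q + 10 := by rw [hf3.nat 21 rfl]; simp [b21, b42]
    have c43 : s3.natVar 43 = 10 := by rw [hf3.nat 43 rfl]; simp [b43]
    have c37 : s3.natVar 37 = a + n + 2 * q + 1 := by rw [hf3.nat 37 rfl]; simp [b37]
    have c38 : s3.natVar 38 = q := by rw [hf3.nat 38 rfl]; simp [b38]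
    refine Tri.block ?_
    simp [c10, c21, c43, c37, c38]
    refine ⟨by omega, by omega, by ring, by ring, ?_, ?_⟩
    · intro j hj
      rw [Function.update_of_ne (by omega), Function.update_of_ne (by omega)]
      exact h6 j hj
    · intro g hg
      rw [seg_congr (g := s1.realArr 10) (fun j _ hj => (h6 j (by omega)).symm)]
      rcases Nat.lt_or_ge g (2 * q) with hg' | hg'
      · rw [Function.update_of_ne (by omega), Function.update_of_ne (by omega)]
        have := h7 g hg'
        rwa [seg_congr (g := s1.realArr 10) (fun j _ hj => (h6 j (by omega)).symm)] at this
      · rcases (by omega : g = 2 * q ∨ g = 2 * q + 1) with rfl | rfl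
        · rw [Function.update_of_ne (by omega), Function.update_self]
          convert hr1 using 2; ring
        · rw [← add_assoc, Function.update_self]
          rw [seg_congr (g := s1.realArr 10)] at hr2
          · convert hr2 using 2; ring
          · intro j _ hj
            rw [Function.update_of_ne (by omega)]
  · rintro k s' q hf hk - ⟨h1, h2, h3, h4, h5, h6, h7⟩ hc
    have h31 : s'.natVar 31 = a + n := by rw [hf.nat 31 rfl]; simp [hn]
    simp [h3, h31] at hc
    refine ⟨q, ?_, h1, by omega, h4, h5, h6, h7⟩
    simp; omega

/-- One step of the selection with an explicit stack. If the variable `34` is `0`, the entry of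
rank `32` of the segment `[30, 31)` is to be found; if it is `1`, the answer for the segment on
top of the stack of pending tasks is the real variable `22`. -/
def selectStep : Prog :=
  .ite (.natLe 34 45)
    (.seq (block [.natSub 48 31 30])
      (.ite (.natLt 48 47)
        (.seq (block [.natCopy 20 30, .natCopy 21 31, .natCopy 26 32])
          (.seq brute (block [.natConst 34 1])))
        (.seq (block [.natWrite 10 33 30, .natWrite 11 33 31, .natWrite 12 33 32,
            .natAdd 33 33 46])
          (.seq groupMedians (block [.natCopy 30 31, .natCopy 31 37, .natCopy 32 38])))))
    (.ite (.natLe 33 45) (block [.natConst 35 0])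
      (.seq (block [.natSub 33 33 46, .natRead 30 10 33, .natRead 31 11 33, .natRead 32 12 33,
          .natCopy 20 30, .natCopy 21 31, .natCopy 22 31, .realCopy 20 22])
        (.seq (filt (.realLt 21 20) 10)
          (.seq (block [.natSub 49 22 31])
            (.ite (.natLt 32 49) (block [.natCopy 30 31, .natCopy 31 22, .natConst 34 0])
              (.seq (block [.natCopy 22 31])
                (.seq (filt (.realLt 20 21) 10)
                  (.seq (block [.natSub 50 22 31, .natSub 51 31 30, .natSub 51 51 50])
                    (.ite (.natLt 32 51) .skip
                      (block [.natCopy 30 31, .natCopy 31 22, .natSub 32 32 51,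
                        .natConst 34 0]))))))))))

/-- The values of the variables that remain fixed during the selection. -/
structure SelectConsts (s : Store) : Prop where
  h35 : s.natVar 35 = 1
  h45 : s.natVar 45 = 0
  h46 : s.natVar 46 = 1
  h47 : s.natVar 47 = 100

/-- `s'` results from `s` by solving a task on a segment that ends at `e`. -/
structure SelectFrame (e : ℕ) (s s' : Store) : Prop where
  sp : s'.natVar 33 = s.natVar 33
  a10 : ∀ j < s.natVar 33, s'.natArr 10 j = s.natArr 10 j
  a11 : ∀ j < s.natVar 33, s'.natArr 11 j = s.natArr 11 j
  a12 : ∀ j < s.natVar 33, s'.natArr 12 j = s.natArr 12 j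
  arr : ∀ j < e, s'.realArr 10 j = s.realArr 10 j

theorem SelectFrame.trans {e e' : ℕ} {s s' s'' : Store} (h : SelectFrame e s s')
    (h' : SelectFrame e' s' s'') (he : e ≤ e') : SelectFrame e s s'' where
  sp := h'.sp.trans h.sp
  a10 j hj := (h'.a10 j (by rwa [h.sp])).trans (h.a10 j hj)
  a11 j hj := (h'.a11 j (by rwa [h.sp])).trans (h.a11 j hj)
  a12 j hj := (h'.a12 j (by rwa [h.sp])).trans (h.a12 j hj)
  arr j hj := (h'.arr j (by omega)).trans (h.arr j hj)

open Classical in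
/-- The step that uses the answer for a segment of medians as a pivot. -/
theorem selectStep_ascend {s : Store} {a n k : ℕ} (hc : SelectConsts s) (hm : s.natVar 34 = 1)
    (hsp : 0 < s.natVar 33) (h10 : s.natArr 10 (s.natVar 33 - 1) = a)
    (h11 : s.natArr 11 (s.natVar 33 - 1) = a + n) (h12 : s.natArr 12 (s.natVar 33 - 1) = k) :
    Tri selectStep s fun t s' => t ≤ 30 * n + 50 ∧ SelectConsts s' ∧
      s'.natVar 33 = s.natVar 33 - 1 ∧ s'.natArr = s.natArr ∧
      (∀ j < a + n, s'.realArr 10 j = s.realArr 10 j) ∧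
      ((∃ L, L = (seg (s.realArr 10) a n).countP (· < s.realVar 22) ∧ k < L ∧
          s'.natVar 34 = 0 ∧ s'.natVar 30 = a + n ∧ s'.natVar 31 = a + n + L ∧
          s'.natVar 32 = k ∧
          seg (s'.realArr 10) (a + n) L = (seg (s.realArr 10) a n).filter (· < s.realVar 22)) ∨
        (s'.natVar 34 = 1 ∧ s'.realVar 22 = s.realVar 22 ∧
          IsRank (seg (s.realArr 10) a n) k (s.realVar 22)) ∨
        (∃ G, G = (seg (s.realArr 10) a n).countP (s.realVar 22 < ·) ∧
          (seg (s.realArr 10) a n).countP (· ≤ s.realVar 22) ≤ k ∧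
          s'.natVar 34 = 0 ∧ s'.natVar 30 = a + n ∧ s'.natVar 31 = a + n + G ∧
          s'.natVar 32 = k - (seg (s.realArr 10) a n).countP (· ≤ s.realVar 22) ∧
          seg (s'.realArr 10) (a + n) G =
            (seg (s.realArr 10) a n).filter (s.realVar 22 < ·))) := by
  obtain ⟨h35, h45, h46, h47⟩ := hc
  refine Tri.ite (fun h => by simp [hm, h45] at h) fun _ =>
    Tri.ite (fun h => by simp [h45] at h; omega) fun _ => ?_
  refine Tri.block_seq ?_
  refine Tri.andThen (filt_lt_spec (a := a) (n := n) (w := a + n) (by simp [h46, h10])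
      (by simp [h46, h11]) (by simp [h46, h11]) (Or.inr le_rfl)) ?_
  rintro k1 s2 hf2 ⟨hk1, e1, g1, p1⟩
  simp at e1 g1 p1
  have b30 : s2.natVar 30 = a := by rw [hf2.nat 30 rfl]; simp [h46, h10]
  have b31 : s2.natVar 31 = a + n := by rw [hf2.nat 31 rfl]; simp [h46, h11]
  have b20 : s2.natVar 20 = a := by rw [hf2.nat 20 rfl]; simp [h46, h10]
  have b21 : s2.natVar 21 = a + n := by rw [hf2.nat 21 rfl]; simp [h46, h11]
  have b32 : s2.natVar 32 = k := by rw [hf2.nat 32 rfl]; simp [h46, h12]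
  have b33 : s2.natVar 33 = s.natVar 33 - 1 := by rw [hf2.nat 33 rfl]; simp [h46]
  have b34 : s2.natVar 34 = 1 := by rw [hf2.nat 34 rfl]; simp [hm]
  have b35 : s2.natVar 35 = 1 := by rw [hf2.nat 35 rfl]; simp [h35]
  have b45 : s2.natVar 45 = 0 := by rw [hf2.nat 45 rfl]; simp [h45]
  have b46 : s2.natVar 46 = 1 := by rw [hf2.nat 46 rfl]; simp [h46]
  have b47 : s2.natVar 47 = 100 := by rw [hf2.nat 47 rfl]; simp [h47]
  have bA : s2.natArr = s.natArr := by
    funext x; rw [hf2.natArr x rfl]; simp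
  have br20 : s2.realVar 20 = s.realVar 22 := by rw [hf2.real 20 rfl]; simp
  have br22 : s2.realVar 22 = s.realVar 22 := by rw [hf2.real 22 rfl]; simp
  refine Tri.block_seq (Tri.ite ?_ ?_)
  · intro hlt
    simp [b32, e1, b31] at hlt
    refine Tri.block ?_
    simp only [List.foldl, Instr.exec]
    refine ⟨?_, ⟨by simp [b35], by simp [b45], by simp [b46], by simp [b47]⟩, by simp [b33],
      by simp [bA], by simpa using p1, Or.inl ⟨_, rfl, hlt, by simp, by simp [b31],
        by simp [e1], by simp [b32], by simpa using g1⟩⟩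
    simp; omega
  · intro hlt
    simp [b32, e1, b31] at hlt
    refine Tri.block_seq ?_
    refine Tri.andThen (filt_gt_spec (a := a) (n := n) (w := a + n) (by simp [b20])
      (by simp [b21]) (by simp [b31]) (Or.inr le_rfl)) ?_
    have eseg : seg (s2.realArr 10) a n = seg (s.realArr 10) a n :=
      seg_congr fun j _ hj => p1 j hj
    rintro k2 s3 hf3 ⟨hk2, e2, g2, p2⟩
    simp [br20, eseg] at e2 g2 p2
    have c30 : s3.natVar 30 = a := by rw [hf3.nat 30 rfl]; simp [b30]
    have c31 : s3.natVar 31 = a + n := by rw [hf3.nat 31 rfl]; simp [b31]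
    have c32 : s3.natVar 32 = k := by rw [hf3.nat 32 rfl]; simp [b32]
    have c33 : s3.natVar 33 = s.natVar 33 - 1 := by rw [hf3.nat 33 rfl]; simp [b33]
    have c34 : s3.natVar 34 = 1 := by rw [hf3.nat 34 rfl]; simp [b34]
    have c35 : s3.natVar 35 = 1 := by rw [hf3.nat 35 rfl]; simp [b35]
    have c45 : s3.natVar 45 = 0 := by rw [hf3.nat 45 rfl]; simp [b45]
    have c46 : s3.natVar 46 = 1 := by rw [hf3.nat 46 rfl]; simp [b46]
    have c47 : s3.natVar 47 = 100 := by rw [hf3.nat 47 rfl]; simp [b47]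
    have cA : s3.natArr = s.natArr := by
      funext x; rw [hf3.natArr x rfl]; simp [bA]
    have cr22 : s3.realVar 22 = s.realVar 22 := by rw [hf3.real 22 rfl]; simp [br22]
    have hsum := countP_le_add_countP_gt (seg (s.realArr 10) a n) (s.realVar 22)
    rw [length_seg] at hsum
    -- The program never counts the entries `≤` the pivot; it subtracts the number of larger ones
    -- from `n`.
    have eLE : n - (s3.natVar 22 - (a + n)) =
        (seg (s.realArr 10) a n).countP (· ≤ s.realVar 22) := by
      rw [e2]; omega
    have hp : ∀ j < a + n, s3.realArr 10 j = s.realArr 10 j := fun j hj => by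
      rw [p2 j hj, p1 j hj]
    refine Tri.block_seq (Tri.ite ?_ ?_)
    · intro hlt2
      simp only [List.foldl, Instr.exec, Test.Holds] at hlt2
      simp [c30, c31, c32, eLE] at hlt2
      refine Tri.skip ?_
      simp only [List.foldl, Instr.exec]
      refine ⟨?_, ⟨by simp [c35], by simp [c45], by simp [c46], by simp [c47]⟩, by simp [c33],
        by simp [cA], by simpa using hp, Or.inr (Or.inl ⟨by simp [c34], by simp [cr22],
          hlt, hlt2⟩)⟩
      simp; omega
    · intro hlt2
      simp only [List.foldl, Instr.exec, Test.Holds] at hlt2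
      simp [c30, c31, c32, eLE] at hlt2
      refine Tri.block ?_
      simp only [List.foldl, Instr.exec]
      refine ⟨?_, ⟨by simp [c35], by simp [c45], by simp [c46], by simp [c47]⟩, by simp [c33],
        by simp [cA], by simpa using hp, Or.inr (Or.inr ⟨_, rfl, hlt2, by simp, by simp [c31],
          by simp [e2], by simp [c30, c31, c32, eLE], by simpa using g2⟩)⟩
      simp; omega

/-- The step that solves a small task. -/
theorem selectStep_small {s : Store} {a n k : ℕ} (hc : SelectConsts s) (hm : s.natVar 34 = 0)
    (h30 : s.natVar 30 = a) (h31 : s.natVar 31 = a + n) (h32 : s.natVar 32 = k) (hk : k < n)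
    (hn : n < 100) :
    Tri selectStep s fun t s' => t ≤ 100 * (n + 1) ^ 2 + 20 ∧ SelectConsts s' ∧
      s'.natVar 34 = 1 ∧ SelectFrame (a + n) s s' ∧
      IsRank (seg (s.realArr 10) a n) k (s'.realVar 22) := by
  obtain ⟨h35, h45, h46, h47⟩ := hc
  refine Tri.ite (fun _ => ?_) (fun h => by simp [hm, h45] at h)
  refine Tri.block_seq (Tri.ite (fun _ => ?_) (fun h => by simp [h30, h31, h47] at h; omega))
  refine Tri.block_seq ?_
  refine Tri.andThen (brute_spec (a := a) (n := n) (q := k) (by simp [h30]) (by simp [h31])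
    (by simp [h32]) hk) ?_
  rintro k1 s2 hf ⟨hk1, hr⟩
  simp at hr
  refine Tri.block ?_
  simp only [List.foldl, Instr.exec]
  refine ⟨by simp; omega, ⟨?_, ?_, ?_, ?_⟩, by simp, ⟨?_, ?_, ?_, ?_, ?_⟩, by simpa using hr⟩
  · simp; rw [hf.nat 35 rfl]; simp [h35]
  · simp; rw [hf.nat 45 rfl]; simp [h45]
  · simp; rw [hf.nat 46 rfl]; simp [h46]
  · simp; rw [hf.nat 47 rfl]; simp [h47]
  · simp; rw [hf.nat 33 rfl]; simp
  · intro j _; simp; rw [hf.natArr 10 rfl]; simp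
  · intro j _; simp; rw [hf.natArr 11 rfl]; simp
  · intro j _; simp; rw [hf.natArr 12 rfl]; simp
  · intro j _; simp; rw [hf.realArr 10 rfl]; simp

/-- The step that saves a large task and passes to the medians of its groups. -/
theorem selectStep_push {s : Store} {a n k : ℕ} (hc : SelectConsts s) (hm : s.natVar 34 = 0)
    (h30 : s.natVar 30 = a) (h31 : s.natVar 31 = a + n) (h32 : s.natVar 32 = k)
    (hn : 100 ≤ n) :
    Tri selectStep s fun t s' => ∃ q, t ≤ 800 * n + 30 ∧ 10 * q ≤ n ∧ n < 10 * q + 10 ∧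
      SelectConsts s' ∧ s'.natVar 34 = 0 ∧ s'.natVar 30 = a + n ∧
      s'.natVar 31 = a + n + 2 * q ∧ s'.natVar 32 = q ∧ s'.natVar 33 = s.natVar 33 + 1 ∧
      s'.natArr 10 = Function.update (s.natArr 10) (s.natVar 33) a ∧
      s'.natArr 11 = Function.update (s.natArr 11) (s.natVar 33) (a + n) ∧
      s'.natArr 12 = Function.update (s.natArr 12) (s.natVar 33) k ∧
      (∀ j < a + n, s'.realArr 10 j = s.realArr 10 j) ∧
      ∀ g < 2 * q, IsRank (seg (s.realArr 10) (a + 5 * g) 5) 2 (s'.realArr 10 (a + n + g)) := by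
  obtain ⟨h35, h45, h46, h47⟩ := hc
  refine Tri.ite (fun _ => ?_) (fun h => by simp [hm, h45] at h)
  refine Tri.block_seq (Tri.ite (fun h => by simp [h30, h31, h47] at h; omega) (fun _ => ?_))
  refine Tri.block_seq ?_
  refine Tri.andThen (groupMedians_spec (a := a) (n := n) (by simp [h30]) (by simp [h31])) ?_
  rintro k2 s2 hf2 ⟨q, hk2, hq1, hq2, e37, e38, earr, emed⟩
  simp at earr emed
  refine Tri.block ?_
  simp only [List.foldl, Instr.exec]
  refine ⟨q, by simp; omega, hq1, hq2, ⟨?_, ?_, ?_, ?_⟩, ?_, ?_, by simp [e37], by simp [e38],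
    ?_, ?_, ?_, ?_, by simpa using earr, by simpa using emed⟩
  · simp; rw [hf2.nat 35 rfl]; simp [h35]
  · simp; rw [hf2.nat 45 rfl]; simp [h45]
  · simp; rw [hf2.nat 46 rfl]; simp [h46]
  · simp; rw [hf2.nat 47 rfl]; simp [h47]
  · simp; rw [hf2.nat 34 rfl]; simp [hm]
  · simp; rw [hf2.nat 31 rfl]; simp [h31]
  · simp; rw [hf2.nat 33 rfl]; simp [h46]
  · simp; rw [hf2.natArr 10 rfl]; simp [h30]
  · simp; rw [hf2.natArr 11 rfl]; simp [h31]
  · simp; rw [hf2.natArr 12 rfl]; simp [h32]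

/-- Solving a task, in continuation-passing form. -/
theorem select_frame (n : ℕ) : ∀ (s : Store) (a k : ℕ) (Q : ℕ → Store → Prop),
    SelectConsts s → s.natVar 34 = 0 → s.natVar 30 = a → s.natVar 31 = a + n →
    s.natVar 32 = k → k < n →
    (∀ T s', T ≤ 150000 * n → SelectConsts s' → s'.natVar 34 = 1 → SelectFrame (a + n) s s' →
      IsRank (seg (s.realArr 10) a n) k (s'.realVar 22) →
      Tri (.loop (.natLt 45 35) selectStep) s' fun t => Q (T + t)) →
    Tri (.loop (.natLt 45 35) selectStep) s Q := by
  -- The program is one flat loop, so a recursive call is a stretch of a run rather than a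
  -- subprogram. With `Q` arbitrary, the induction hypothesis can be used twice in one run: for the
  -- `2 q` medians and for the part that survives the pivot, of size at most `7 q + 9`. Together
  -- these have size at most `9 n / 10 + 9 ≤ n - n / 100` when `n ≥ 100`. The saved `150000 * n /
  -- 100 = 1500 n` steps pay for the linear work of this level, and shorter segments go to `brute`.
  induction n using Nat.strong_induction_on with
  | _ n ih =>
  intro s a k Q hc hm h30 h31 h32 hk hQ
  refine Tri.loop_true (by simp [hc.h35, hc.h45]) ?_
  rcases Nat.lt_or_ge n 100 with hn | hn
  · refine (selectStep_small hc hm h30 h31 h32 hk hn).mono ?_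
    rintro k1 s2 hf ⟨hk1, hc2, hm2, hf2, hr⟩
    refine (hQ (k1 + 1) s2 (by nlinarith) hc2 hm2 hf2 hr).mono ?_
    intro t s' _ h
    rwa [add_right_comm]
  · refine (selectStep_push hc hm h30 h31 h32 hn).mono ?_
    rintro k2 s3 - ⟨q, hk2, hq1, hq2, hc3, hm3, c30, c31, c32, c33, c10, c11, c12, carr, cmed⟩
    refine ih (2 * q) (by omega) s3 (a + n) q _ hc3 hm3 c30 c31 c32 (by omega) ?_
    rintro T4 s4 hT4 hc4 hm4 ⟨sp4, f10, f11, f12, farr⟩ hr4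
    rw [c33] at sp4 f10 f11 f12
    refine Tri.loop_true (by simp [hc4.h35, hc4.h45]) ((selectStep_ascend (a := a) (n := n)
      (k := k) hc4 hm4 (by omega) ?_ ?_ ?_).mono ?_)
    · rw [sp4, Nat.add_sub_cancel, f10 _ (by omega), c10, Function.update_self]
    · rw [sp4, Nat.add_sub_cancel, f11 _ (by omega), c11, Function.update_self]
    · rw [sp4, Nat.add_sub_cancel, f12 _ (by omega), c12, Function.update_self]
    rintro k5 s5 - ⟨hk5, hc5, sp5, nA5, p5, hcases⟩
    have e4 : seg (s4.realArr 10) a n = seg (s.realArr 10) a n :=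
      seg_congr fun j _ hj => by rw [farr j (by omega), carr j hj]
    have hfr5 : SelectFrame (a + n) s s5 := by
      refine ⟨by rw [sp5, sp4, Nat.add_sub_cancel], ?_, ?_, ?_, ?_⟩
      · intro j hj
        rw [nA5, f10 j (Nat.lt_succ_of_lt hj), c10, Function.update_of_ne hj.ne]
      · intro j hj
        rw [nA5, f11 j (Nat.lt_succ_of_lt hj), c11, Function.update_of_ne hj.ne]
      · intro j hj
        rw [nA5, f12 j (Nat.lt_succ_of_lt hj), c12, Function.update_of_ne hj.ne]
      -- Medians and filtered parts are only written from position `a + n` on, so the segment of the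
      -- pending task is still intact when its pivot arrives.
      · intro j hj
        rw [p5 j hj, farr j (by omega), carr j hj]
    obtain ⟨hm1, hm2⟩ := median_of_medians hq1 hq2 cmed hr4
    rw [e4] at hcases
    rcases hcases with ⟨L, rfl, hkL, g34, g30, g31, g32, gseg⟩ | ⟨g34, g22, hr⟩ |
      ⟨G, rfl, hkG, g34, g30, g31, g32, gseg⟩
    · refine ih _ (by omega) s5 (a + n) k _ hc5 g34 g30 g31 g32 hkL ?_
      intro T6 s6 hT6 hc6 hm6 hfr6 hr6
      rw [gseg] at hr6
      refine (hQ (k2 + (T4 + (k5 + T6 + 1)) + 1) s6 (by omega) hc6 hm6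
        (hfr5.trans hfr6 (by omega)) hr6.of_filter_lt).mono fun t s' _ h => ?_
      have e : k2 + (T4 + (k5 + (T6 + t) + 1)) + 1 = k2 + (T4 + (k5 + T6 + 1)) + 1 + t := by omega
      rwa [e]
    · refine (hQ (k2 + (T4 + (k5 + 1)) + 1) s5 (by omega) hc5 g34 hfr5 (by rwa [g22])).mono
        fun t s' _ h => ?_
      have e : k2 + (T4 + (k5 + t + 1)) + 1 = k2 + (T4 + (k5 + 1)) + 1 + t := by omega
      rwa [e]
    · have hsum := countP_le_add_countP_gt (seg (s.realArr 10) a n) (s4.realVar 22)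
      rw [length_seg] at hsum
      refine ih _ (by omega) s5 (a + n) _ _ hc5 g34 g30 g31 g32 (by omega) ?_
      intro T6 s6 hT6 hc6 hm6 hfr6 hr6
      rw [gseg] at hr6
      refine (hQ (k2 + (T4 + (k5 + T6 + 1)) + 1) s6 (by omega) hc6 hm6
        (hfr5.trans hfr6 (by omega)) (hr6.of_filter_gt hkG)).mono fun t s' _ h => ?_
      have e : k2 + (T4 + (k5 + (T6 + t) + 1)) + 1 = k2 + (T4 + (k5 + T6 + 1)) + 1 + t := by omega
      rwa [e]

/-- Finds the entry of rank `32` of the first `31` entries of the real array `10`; the answer is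
put into the real variable `22`. -/
def select : Prog :=
  .seq (block [.natConst 30 0, .natConst 33 0, .natConst 34 0, .natConst 35 1, .natConst 45 0,
      .natConst 46 1, .natConst 47 100])
    (.loop (.natLt 45 35) selectStep)

theorem select_spec {s : Store} {n k : ℕ} (hn : s.natVar 31 = n) (hk : s.natVar 32 = k)
    (hkn : k < n) :
    Tri select s fun t s' => t ≤ 150000 * n + 30 ∧
      IsRank (seg (s.realArr 10) 0 n) k (s'.realVar 22) := by
  refine Tri.block_seq (select_frame n _ 0 k _ ⟨?_, ?_, ?_, ?_⟩ ?_ ?_ ?_ ?_ hkn ?_)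
  all_goals try simp only [List.foldl, Instr.exec]
  case refine_9 =>
    rintro T s' hT ⟨h35, h45, h46, h47⟩ h34 hf hr
    have h33 : s'.natVar 33 = 0 := by rw [hf.sp]; simp
    refine Tri.loop_true (by simp [h35, h45]) (Tri.ite (by simp [h34, h45]) fun _ =>
      Tri.ite (fun _ => Tri.block (Tri.loop_false ?_ ⟨?_, by simpa using hr⟩))
        (by simp [h33]))
    · simp [h45]
    · simp; omega
  all_goals simp [hn, hk]

end RealRAM

/-! ### Minimizing over the capped simplex by a threshold. -/

namespace SIB

/-- The weight that a top-`k` selection gives to the index in position `c`. -/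
def topWeight (k : ℕ) (ν : ℝ) (c : ℕ) : ℝ :=
  if c + 1 < k then ν else if c + 1 = k then 1 - ν * ((k : ℝ) - 1) else 0

theorem sum_topWeight {k m : ℕ} (ν : ℝ) (hk : 0 < k) (hkm : k ≤ m) :
    ∑ c ∈ Finset.range m, topWeight k ν c = 1 := by
  obtain ⟨k, rfl⟩ := Nat.exists_eq_add_of_lt hk
  obtain ⟨r, rfl⟩ := Nat.exists_eq_add_of_le hkm
  simp only [zero_add] at *
  rw [Finset.sum_range_add, Finset.sum_range_succ]
  rw [Finset.sum_congr rfl (g := fun _ => ν), Finset.sum_congr (s₁ := Finset.range r) rfl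
    (g := fun _ => 0)]
  · simp [topWeight]; ring
  · intro c _
    rw [topWeight, if_neg (by omega), if_neg (by omega)]
  · intro c hc
    rw [Finset.mem_range] at hc
    rw [topWeight, if_pos (by omega)]

section

variable {m : ℕ} {h : Fin m → ℝ} {ν p : ℝ} {b : Fin m → ℝ}

open Classical in
/-- The selection by a threshold `p`, ties being broken by the order of the indices. -/
def IsThresholdSelection (h : Fin m → ℝ) (k : ℕ) (ν p : ℝ) (b : Fin m → ℝ) : Prop :=
  ∀ j, b j = if h j < p then ν else if p < h j then 0 else
    topWeight k ν (Finset.card {i | h i < p} + Finset.card {i | i < j ∧ h i = p})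

-- `Tuple.sort` breaks ties by index. The sorted position of an index with cost `p` is therefore the
-- number of costs below `p` plus the number of earlier ties, which is the argument of `topWeight`.
-- The two cardinality bounds place the `k`-th position among the ties.
open Classical in
theorem IsThresholdSelection.apply_sort {k : ℕ} (hb : IsThresholdSelection h k ν p b)
    (h1 : Finset.card {i | h i < p} < k) (h2 : k ≤ Finset.card {i | h i ≤ p}) (j : Fin m) :
    b (Tuple.sort h j) = topWeight k ν j := by
  have hmono : Monotone (h ∘ Tuple.sort h) := Tuple.monotone_sort h
  have htie := (Tuple.eq_sort_iff.1 (rfl : Tuple.sort h = Tuple.sort h)).2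
  set σ := Tuple.sort h
  have hcard : ∀ (P : Fin m → Prop) [DecidablePred P], Finset.card {i | P i} = Finset.card {i | P (σ i)} := by
    intro P _
    refine (Finset.card_bij (fun i _ => σ i) ?_ ?_ ?_).symm
    · simp
    · intro a _ c _ hac; exact σ.injective hac
    · intro c hc
      exact ⟨σ.symm c, by simpa using hc, by simp⟩
  have hlt : ∀ i i', h (σ i) < h (σ i') → i < i' := fun i i' hi => by
    by_contra hc
    exact absurd (hmono (not_lt.1 hc)) (not_le.2 hi)
  have hIio : Finset.card {i : Fin m | i < j} = (j : ℕ) := by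
    rw [← Fin.card_Iio j]; congr 1; ext; simp
  have hIic : Finset.card {i : Fin m | i ≤ j} = (j : ℕ) + 1 := by
    rw [← Fin.card_Iic j]; congr 1; ext; simp
  rw [hb]
  split_ifs with hc1 hc2
  · have : Finset.card {i : Fin m | i ≤ j} ≤ Finset.card {i | h (σ i) < p} :=
      Finset.card_le_card fun i hi => by
        simp only [Finset.mem_filter, Finset.mem_univ, true_and] at hi ⊢
        exact (hmono hi).trans_lt hc1
    rw [← hcard fun x => h x < p, hIic] at this
    rw [topWeight, if_pos (by omega)]
  · have : Finset.card {i | h (σ i) ≤ p} ≤ Finset.card {i : Fin m | i < j} :=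
      Finset.card_le_card fun i hi => by
        simp only [Finset.mem_filter, Finset.mem_univ, true_and] at hi ⊢
        exact hlt i j (hi.trans_lt hc2)
    rw [← hcard fun x => h x ≤ p, hIio] at this
    rw [topWeight, if_neg (by omega), if_neg (by omega)]
  · have hp : h (σ j) = p := le_antisymm (not_lt.1 hc2) (not_lt.1 hc1)
    congr 1
    rw [← hIio, hcard fun x => h x < p, hcard fun x => x < σ j ∧ h x = p,
      ← Finset.card_union_of_disjoint]
    · congr 1
      ext i
      simp only [Finset.mem_union, Finset.mem_filter, Finset.mem_univ, true_and]
      constructor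
      · rintro (hi | ⟨hi, hip⟩)
        · exact hlt i j (hp ▸ hi)
        · by_contra hc
          rcases (not_lt.1 hc).lt_or_eq with hc | hc
          · exact absurd (htie j i hc (by rw [hp, hip])) (not_lt.2 hi.le)
          · exact hi.ne' (by rw [hc])
      · intro hi
        rcases (hmono hi.le).lt_or_eq with hh | hh
        · left; simpa [hp] using hh
        · right
          exact ⟨htie i j hi hh, hh.trans hp⟩
    · rw [Finset.disjoint_filter]
      rintro i - hi ⟨-, hi'⟩
      exact hi.ne hi'

/-- With `k = ⌈1/ν⌉`, the inequalities `k - 1 < 1/ν ≤ k` put the leftover weight into `[0, ν]`, and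
`ν ≥ 1/m` gives `k ≤ m`. -/
theorem ceil_inv_bounds {m : ℕ} (hm : 0 < m) (hν : ν ∈ Set.Icc (1 / (m : ℝ)) 1) :
    0 < ν ∧ 0 < ⌈1 / ν⌉₊ ∧ ⌈1 / ν⌉₊ ≤ m ∧ 0 ≤ 1 - ν * ((⌈1 / ν⌉₊ : ℝ) - 1) ∧
      1 - ν * ((⌈1 / ν⌉₊ : ℝ) - 1) ≤ ν := by
  have hm' : (0 : ℝ) < m := Nat.cast_pos.2 hm
  have hpos : 0 < ν := lt_of_lt_of_le (by positivity) hν.1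
  have hinv : 0 < 1 / ν := by positivity
  refine ⟨hpos, Nat.ceil_pos.2 hinv, ?_, ?_, ?_⟩
  · rw [Nat.ceil_le, div_le_iff₀ hpos]
    have := hν.1
    rwa [div_le_iff₀ hm', mul_comm] at this
  · have := Nat.ceil_lt_add_one hinv.le
    have h2 : (⌈1 / ν⌉₊ : ℝ) - 1 < 1 / ν := by linarith
    rw [lt_div_iff₀ hpos] at h2
    linarith
  · have := Nat.le_ceil (1 / ν)
    rw [div_le_iff₀ hpos] at this
    linarith

-- The threshold `p` acts as a Lagrange multiplier for `∑ b_j = 1`. For any competitor `c`, each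
-- `(h_j - p) (c_j - b_j)` is nonnegative, because `b_j` is `ν` where `h_j < p` and `0` where `h_j >
-- p`. Summation removes `p`, as both weight vectors have total `1`.
open Classical in
theorem IsThresholdSelection.spec (hm : 0 < m) (hν : ν ∈ Set.Icc (1 / (m : ℝ)) 1)
    (hb : IsThresholdSelection h ⌈1 / ν⌉₊ ν p b)
    (h1 : Finset.card {i | h i < p} < ⌈1 / ν⌉₊) (h2 : ⌈1 / ν⌉₊ ≤ Finset.card {i | h i ≤ p}) :
    IsTopSelection h ν b ∧ b ∈ cappedSimplex m ν ∧
      IsMinOn (fun b : Fin m → ℝ => h ⬝ᵥ b) (cappedSimplex m ν) b := by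
  obtain ⟨hpos, hk, hkm, hl0, hlν⟩ := ceil_inv_bounds hm hν
  have hs := hb.apply_sort h1 h2
  have hw : ∀ c, 0 ≤ topWeight ⌈1 / ν⌉₊ ν c ∧ topWeight ⌈1 / ν⌉₊ ν c ≤ ν := by
    intro c
    rw [topWeight]
    split_ifs
    · exact ⟨hpos.le, le_rfl⟩
    · exact ⟨hl0, hlν⟩
    · exact ⟨le_rfl, hpos.le⟩
  have hb' : ∀ j, b j = topWeight ⌈1 / ν⌉₊ ν ((Tuple.sort h).symm j) := fun j => by
    rw [← hs, Equiv.apply_symm_apply]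
  have hsum : ∑ j, b j = 1 := by
    rw [← Equiv.sum_comp (Tuple.sort h) b]
    simp only [hs]
    rw [Fin.sum_univ_eq_sum_range (fun c => topWeight ⌈1 / ν⌉₊ ν c), sum_topWeight ν hk hkm]
  have hcap : b ∈ cappedSimplex m ν :=
    ⟨⟨fun j => by rw [hb']; exact (hw _).1, hsum⟩, fun j => by rw [hb']; exact (hw _).2⟩
  refine ⟨⟨Tuple.sort h, Tuple.monotone_sort h, fun j => hs j⟩, hcap, ?_⟩
  intro c hc
  change h ⬝ᵥ b ≤ h ⬝ᵥ c
  have key : 0 ≤ ∑ j, (h j - p) * (c j - b j) := by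
    refine Finset.sum_nonneg fun j _ => ?_
    have hj := hb j
    split_ifs at hj with hc1 hc2
    · exact mul_nonneg_of_nonpos_of_nonpos (by linarith) (by rw [hj]; linarith [hc.2 j])
    · exact mul_nonneg (by linarith) (by rw [hj]; linarith [hc.1.1 j])
    · have : h j = p := le_antisymm (not_lt.1 hc2) (not_lt.1 hc1)
      simp [this]
  have e : ∑ j, (h j - p) * (c j - b j) = h ⬝ᵥ c - h ⬝ᵥ b - p * (∑ j, c j - ∑ j, b j) := by
    simp only [dotProduct, Finset.mul_sum, ← Finset.sum_sub_distrib]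
    refine Finset.sum_congr rfl fun j _ => ?_
    ring
  rw [e, hsum, hc.1.2] at key
  linarith

end

open Classical in
theorem countP_seg (f : ℕ → ℝ) (n : ℕ) (P : ℝ → Prop) :
    (RealRAM.seg f 0 n).countP (P ·) = Finset.card {i : Fin n | P (f i)} := by
  induction n with
  | zero => simp
  | succ n ih =>
    rw [RealRAM.seg_succ, List.countP_append, ih]
    rw [Finset.card_filter, Finset.card_filter, Fin.sum_univ_castSucc]
    simp [List.countP_cons]

open Classical in
theorem countP_seg_lt (f : ℕ → ℝ) {n : ℕ} (j : Fin n) (P : ℝ → Prop) :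
    (RealRAM.seg f 0 j).countP (P ·) = Finset.card {i : Fin n | i < j ∧ P (f i)} := by
  rw [countP_seg]
  refine Finset.card_bij (fun i _ => ⟨i, i.2.trans j.2⟩) ?_ ?_ ?_
  · intro i hi
    simp only [Finset.mem_filter, Finset.mem_univ, true_and] at hi ⊢
    exact ⟨i.2, hi⟩
  · intro i _ i' _ hi
    exact Fin.ext (by simpa using hi)
  · intro i hi
    simp only [Finset.mem_filter, Finset.mem_univ, true_and] at hi
    exact ⟨⟨i, hi.1⟩, by simpa using hi.2, rfl⟩

end SIB

namespace RealRAM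

/-! ### The linear oracle over the capped simplex -/

/-- Copies the first `60` entries of the real array `src` to the real array `dst`. -/
def copyArr (src dst : ℕ) : Prog :=
  forN 63 60 (block [.realRead 33 src 63, .realWrite dst 63 33])

theorem copyArr_spec {src dst : ℕ} {s : Store} {m : ℕ} (hm : s.natVar 60 = m)
    (hd : src ≠ dst) :
    Tri (copyArr src dst) s fun k s' => k ≤ 7 * m + 3 ∧
      ∀ j < m, s'.realArr dst j = s.realArr src j := by
  refine Tri.forN m (fun i s1 => s1.realArr src = s.realArr src ∧
    ∀ j < i, s1.realArr dst j = s.realArr src j) (fun _ => 3) hm rfl rfl rfl (by simp) ?_ ?_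
  · rintro i hi s1 hf h63 h60 ⟨h1, h2⟩
    refine Tri.block ⟨by simp, ?_, ?_⟩
    · simpa [hd] using h1
    · intro j hj
      rcases Nat.lt_succ_iff_lt_or_eq.1 hj with hj | rfl
      · simpa [h63, hj.ne] using h2 j hj
      · simp [h63, h1]
  · rintro k s' hf - hk ⟨-, h⟩
    refine ⟨?_, h⟩
    simp at hk; omega

/-- Puts the least `k` with `k ν ≥ 1` into the integer variable `61`. -/
def ceilInv : Prog :=
  .seq (block [.natConst 61 0, .realConst 31 0, .realConst 32 1, .natConst 62 1])
    (.loop (.realLt 31 32) (block [.natAdd 61 61 62, .realAdd 31 31 30]))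

/-- Without a floor, `⌈1/ν⌉` is found by adding `ν` until the sum reaches `1`; `ν ≥ 1/m` limits this
to `m` additions. -/
theorem ceilInv_spec {s : Store} {m : ℕ} (hm : 0 < m)
    (hν : s.realVar 30 ∈ Set.Icc (1 / (m : ℝ)) 1) :
    Tri ceilInv s fun k s' => k ≤ 4 * m + 6 ∧ s'.natVar 61 = ⌈1 / s.realVar 30⌉₊ ∧
      s'.natVar 62 = 1 ∧ s'.realVar 32 = 1 := by
  obtain ⟨hpos, -, hkm, -, -⟩ := SIB.ceil_inv_bounds hm hν
  refine Tri.block_seq ?_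
  refine Tri.loop_count (B := m) (c := 3) (I := fun j s1 => s1.natVar 61 = j ∧
    s1.realVar 31 = j * s.realVar 30 ∧ j ≤ ⌈1 / s.realVar 30⌉₊) (by simp) ?_ ?_
  · rintro j s1 hf ⟨h1, h2, h3⟩ hc
    have h62 : s1.natVar 62 = 1 := by rw [hf.nat 62 rfl]; simp
    have r32 : s1.realVar 32 = 1 := by rw [hf.real 32 rfl]; simp
    have r30 : s1.realVar 30 = s.realVar 30 := by rw [hf.real 30 rfl]; simp
    simp [h2, r32] at hc
    have hlt : j < ⌈1 / s.realVar 30⌉₊ := by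
      rw [Nat.lt_ceil, lt_div_iff₀ hpos]; exact hc
    refine ⟨by omega, Tri.block ⟨by simp, by simp [h1, h62], ?_, hlt⟩⟩
    simp [h2, r30]; ring
  · rintro k s' j hf hk hj ⟨h1, h2, h3⟩ hc
    have h62 : s'.natVar 62 = 1 := by rw [hf.nat 62 rfl]; simp
    have r32 : s'.realVar 32 = 1 := by rw [hf.real 32 rfl]; simp
    simp [h2, r32] at hc
    refine ⟨by simp; omega, ?_, h62, r32⟩
    rw [h1]
    refine le_antisymm h3 (Nat.ceil_le.2 ?_)
    rwa [div_le_iff₀ hpos]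

/-- Counts in the variable `64` the entries of the real array `5` below the real variable `22`. -/
def countBelow : Prog :=
  .seq (block [.natConst 64 0])
    (forN 63 60 (.seq (block [.realRead 33 5 63])
      (.ite (.realLt 33 22) (block [.natAdd 64 64 62]) .skip)))

open Classical in
theorem countBelow_spec {s : Store} {m : ℕ} (hm : s.natVar 60 = m) (h62 : s.natVar 62 = 1) :
    Tri countBelow s fun k s' => k ≤ 9 * m + 5 ∧
      s'.natVar 64 = (seg (s.realArr 5) 0 m).countP (· < s.realVar 22) := by
  refine Tri.block_seq ?_
  refine Tri.forN m (fun i s1 => s1.natVar 64 =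
    (seg (s.realArr 5) 0 i).countP (· < s.realVar 22)) (fun _ => 5) (by simp [hm]) rfl rfl rfl
    (by simp) ?_ ?_
  · rintro i hi s1 hf h63 h60 h1
    have b62 : s1.natVar 62 = 1 := by rw [hf.nat 62 rfl]; simp [h62]
    have b22 : s1.realVar 22 = s.realVar 22 := by rw [hf.real 22 rfl]; simp
    have b5 : s1.realArr 5 = s.realArr 5 := by rw [hf.realArr 5 rfl]; simp
    refine Tri.block_seq (Tri.ite ?_ ?_)
    · intro h
      simp [b22, b5, h63] at h
      exact Tri.block ⟨by simp, by simp [seg_succ, h1, h, b62]⟩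
    · intro h
      simp [b22, b5, h63] at h
      exact Tri.skip ⟨by simp, by simp [seg_succ, h1, not_lt.2 h]⟩
  · rintro k s' hf - hk h
    exact ⟨by simp at hk ⊢; omega, h⟩

/-- Writes the weights of a selection by the threshold `22` into the real array `6`. -/
def assign : Prog :=
  forN 63 60 (.seq (block [.realRead 33 5 63, .realConst 35 0])
    (.ite (.realLt 33 22) (block [.realWrite 6 63 30])
      (.ite (.realLt 22 33) (block [.realWrite 6 63 35])
        (.seq (block [.natAdd 64 64 62])
          (.ite (.natLt 64 61) (block [.realWrite 6 63 30])
            (.ite (.natLe 64 61) (block [.realWrite 6 63 34]) (block [.realWrite 6 63 35])))))))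

-- The variable `64` counts the costs below the threshold and the ties met so far. It is incremented
-- before it is compared with `k`, matching the `c + 1` in `topWeight`, whose positions start at
-- `0`.
open Classical in
theorem assign_spec {s : Store} {m k L : ℕ} {ν : ℝ} (hm : s.natVar 60 = m)
    (h61 : s.natVar 61 = k) (h62 : s.natVar 62 = 1) (h64 : s.natVar 64 = L)
    (r30 : s.realVar 30 = ν) (r34 : s.realVar 34 = 1 - ν * ((k : ℝ) - 1)) :
    Tri assign s fun t s' => t ≤ 20 * m + 5 ∧ ∀ j < m, s'.realArr 6 j =
      if s.realArr 5 j < s.realVar 22 then ν else if s.realVar 22 < s.realArr 5 j then 0 else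
        SIB.topWeight k ν (L + (seg (s.realArr 5) 0 j).countP (· = s.realVar 22)) := by
  refine Tri.forN m (fun i s1 => s1.natVar 64 =
      L + (seg (s.realArr 5) 0 i).countP (· = s.realVar 22) ∧ ∀ j < i, s1.realArr 6 j =
      if s.realArr 5 j < s.realVar 22 then ν else if s.realVar 22 < s.realArr 5 j then 0 else
        SIB.topWeight k ν (L + (seg (s.realArr 5) 0 j).countP (· = s.realVar 22)))
    (fun _ => 16) hm rfl rfl rfl (by simp [h64]) ?_ ?_
  · rintro i hi s1 hf h63 h60 ⟨h1, h2⟩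
    have b61 : s1.natVar 61 = k := by rw [hf.nat 61 rfl, h61]
    have b62 : s1.natVar 62 = 1 := by rw [hf.nat 62 rfl, h62]
    have b22 : s1.realVar 22 = s.realVar 22 := by rw [hf.real 22 rfl]
    have b30 : s1.realVar 30 = ν := by rw [hf.real 30 rfl, r30]
    have b34 : s1.realVar 34 = 1 - ν * ((k : ℝ) - 1) := by rw [hf.real 34 rfl, r34]
    have b5 : s1.realArr 5 = s.realArr 5 := by rw [hf.realArr 5 rfl]
    have hlast : ∀ (s2 : Store) (c : ℕ) (x : ℝ), s2.natVar 64 = c →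
        s2.realArr 6 = Function.update (s1.realArr 6) i x →
        c = L + (seg (s.realArr 5) 0 (i + 1)).countP (· = s.realVar 22) →
        (x = if s.realArr 5 i < s.realVar 22 then ν else if s.realVar 22 < s.realArr 5 i then 0
          else SIB.topWeight k ν (L + (seg (s.realArr 5) 0 i).countP (· = s.realVar 22))) →
        (s2.natVar 64 = L + (seg (s.realArr 5) 0 (i + 1)).countP (· = s.realVar 22) ∧
        ∀ j < i + 1, s2.realArr 6 j =
        if s.realArr 5 j < s.realVar 22 then ν else if s.realVar 22 < s.realArr 5 j then 0 else
          SIB.topWeight k ν (L + (seg (s.realArr 5) 0 j).countP (· = s.realVar 22))) := by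
      rintro s2 c x hc h6 e1 e2
      refine ⟨by rw [hc, e1], fun j hj => ?_⟩
      rw [h6]
      rcases Nat.lt_succ_iff_lt_or_eq.1 hj with hj | rfl
      · rw [Function.update_of_ne hj.ne, h2 j hj]
      · rw [Function.update_self, e2]
    refine Tri.block_seq (Tri.ite ?_ fun hc1 => Tri.ite ?_ fun hc2 => Tri.block_seq
      (Tri.ite ?_ fun hc3 => Tri.ite ?_ ?_))
    · intro hc
      simp [b22, b5, h63] at hc
      refine Tri.block ⟨by simp, hlast _ _ ν rfl (by simp [h63, b30]) ?_ (by simp [hc])⟩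
      simp [seg_succ, hc.ne, h1]
    · intro hc
      simp [b22, b5, h63] at hc
      refine Tri.block ⟨by simp, hlast _ _ 0 rfl (by simp [h63]) ?_ (by simp [hc, hc.le])⟩
      simp [seg_succ, hc.ne', h1]
    all_goals
      simp [b22, b5, h63] at hc1 hc2
      have he : s.realArr 5 i = s.realVar 22 := le_antisymm hc2 hc1
    · intro hc
      simp [h1, b61, b62] at hc
      refine Tri.block ⟨by simp, hlast _ _ ν rfl (by simp [h63, b30]) ?_ ?_⟩
      · simp [seg_succ, he, h1, b62, add_assoc]
      · simp [he, SIB.topWeight, hc]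
    · intro hc
      simp [h1, b61, b62] at hc hc3
      refine Tri.block ⟨by simp, hlast _ _ (1 - ν * ((k : ℝ) - 1)) rfl (by simp [h63, b34]) ?_ ?_⟩
      · simp [seg_succ, he, h1, b62, add_assoc]
      · simp only [he, lt_irrefl, if_false, SIB.topWeight]
        rw [if_neg (by omega), if_pos (by omega)]
    · intro hc
      simp [h1, b61, b62] at hc hc3
      refine Tri.block ⟨by simp, hlast _ _ 0 rfl (by simp [h63]) ?_ ?_⟩
      · simp [seg_succ, he, h1, b62, add_assoc]
      · simp only [he, lt_irrefl, if_false, SIB.topWeight]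
        rw [if_neg (by omega), if_neg (by omega)]
  · rintro k' s' hf - hk ⟨-, h⟩
    exact ⟨by simp at hk ⊢; omega, h⟩

/-- The linear oracle over the capped simplex: dimension in `60`, cap in the real variable `30`,
cost vector in the real array `5`, answer in the real array `6`. -/
def topSelect : Prog :=
  .seq ceilInv
    (.seq (copyArr 5 10)
      (.seq (block [.natCopy 31 60, .natSub 32 61 62])
        (.seq select
          (.seq countBelow
            (.seq (block [.realOfNat 34 61, .realSub 34 34 32, .realMul 34 30 34,
                .realSub 34 32 34])
              assign)))))

/-- The threshold is the entry of rank `⌈1/ν⌉ - 1`, ranks being counted from `0`. The two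
inequalities of `IsRank` are the hypotheses of `IsThresholdSelection.spec`; all other passes are
linear, so `select` dominates the cost. -/
theorem topSelect_spec {s : Store} {m : ℕ} {ν : ℝ} (hm : 0 < m) (h60 : s.natVar 60 = m)
    (r30 : s.realVar 30 = ν) (hν : ν ∈ Set.Icc (1 / (m : ℝ)) 1) :
    Tri topSelect s fun t s' => t ≤ 150200 * m ∧
      SIB.IsTopSelection (fun j : Fin m => s.realArr 5 j) ν (fun j : Fin m => s'.realArr 6 j) ∧
      (fun j : Fin m => s'.realArr 6 j) ∈ SIB.cappedSimplex m ν ∧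
      IsMinOn (fun b : Fin m → ℝ => (fun j : Fin m => s.realArr 5 j) ⬝ᵥ b)
        (SIB.cappedSimplex m ν) (fun j : Fin m => s'.realArr 6 j) := by
  classical
  obtain ⟨hpos, hk0, hkm, -, -⟩ := SIB.ceil_inv_bounds hm hν
  refine Tri.andThen (ceilInv_spec hm (by rwa [r30])) ?_
  rintro k1 s1 f1 ⟨hk1, a61, a62, a32⟩
  rw [r30] at a61
  have a60 : s1.natVar 60 = m := by rw [f1.nat 60 rfl, h60]
  have a30 : s1.realVar 30 = ν := by rw [f1.real 30 rfl, r30]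
  have a5 : s1.realArr 5 = s.realArr 5 := f1.realArr 5 rfl
  refine Tri.andThen (copyArr_spec a60 (by norm_num)) ?_
  rintro k2 s2 f2 ⟨hk2, h10⟩
  have b60 : s2.natVar 60 = m := by rw [f2.nat 60 rfl, a60]
  have b61 : s2.natVar 61 = ⌈1 / ν⌉₊ := by rw [f2.nat 61 rfl, a61]
  have b62 : s2.natVar 62 = 1 := by rw [f2.nat 62 rfl, a62]
  have b30 : s2.realVar 30 = ν := by rw [f2.real 30 rfl, a30]
  have b32 : s2.realVar 32 = 1 := by rw [f2.real 32 rfl, a32]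
  have b5 : s2.realArr 5 = s.realArr 5 := by rw [f2.realArr 5 rfl, a5]
  have b10 : seg (s2.realArr 10) 0 m = seg (s.realArr 5) 0 m := by
    rw [← a5]; exact seg_congr fun j _ hj => h10 j (by omega)
  refine Tri.block_seq ?_
  refine Tri.andThen (select_spec (n := m) (k := ⌈1 / ν⌉₊ - 1) (by simp [b60])
    (by simp [b61, b62]) (by omega)) ?_
  rintro k3 s3 f3 ⟨hk3, hr⟩
  simp [b10, -one_div] at hr
  have c60 : s3.natVar 60 = m := by rw [f3.nat 60 rfl]; simp [b60]
  have c61 : s3.natVar 61 = ⌈1 / ν⌉₊ := by rw [f3.nat 61 rfl]; simp [b61]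
  have c62 : s3.natVar 62 = 1 := by rw [f3.nat 62 rfl]; simp [b62]
  have c30 : s3.realVar 30 = ν := by rw [f3.real 30 rfl]; simp [b30]
  have c32 : s3.realVar 32 = 1 := by rw [f3.real 32 rfl]; simp [b32]
  have c5 : s3.realArr 5 = s.realArr 5 := by rw [f3.realArr 5 rfl]; simp [b5]
  refine Tri.andThen (countBelow_spec c60 c62) ?_
  rintro k4 s4 f4 ⟨hk4, h64⟩
  rw [c5] at h64
  have d60 : s4.natVar 60 = m := by rw [f4.nat 60 rfl]; simp [c60]
  have d61 : s4.natVar 61 = ⌈1 / ν⌉₊ := by rw [f4.nat 61 rfl]; simp [c61]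
  have d62 : s4.natVar 62 = 1 := by rw [f4.nat 62 rfl]; simp [c62]
  have d30 : s4.realVar 30 = ν := by rw [f4.real 30 rfl]; simp [c30]
  have d32 : s4.realVar 32 = 1 := by rw [f4.real 32 rfl]; simp [c32]
  have d22 : s4.realVar 22 = s3.realVar 22 := f4.real 22 rfl
  have d5 : s4.realArr 5 = s.realArr 5 := by rw [f4.realArr 5 rfl]; simp [c5]
  refine Tri.block_seq ?_
  refine (assign_spec (m := m) (k := ⌈1 / ν⌉₊) (ν := ν) (L := s4.natVar 64) (by simp [d60])
    (by simp [d61]) (by simp [d62]) (by simp) (by simp [d30]) (by simp [d61, d30, d32])).mono ?_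
  rintro k5 s5 - ⟨hk5, h6⟩
  simp [d5, d22, -one_div] at h6
  refine ⟨by simp; omega, SIB.IsThresholdSelection.spec (p := s3.realVar 22) hm hν ?_ ?_ ?_⟩
  · intro j
    have := h6 j j.2
    rw [h64] at this
    beta_reduce
    rw [this, ← SIB.countP_seg (s.realArr 5) m (· < s3.realVar 22),
      ← SIB.countP_seg_lt (s.realArr 5) j (· = s3.realVar 22)]
  · rw [← SIB.countP_seg (s.realArr 5) m (· < s3.realVar 22)]
    have := hr.1
    have e : (seg (s.realArr 5) 0 m).countP (· < s3.realVar 22) ≤ ⌈1 / ν⌉₊ - 1 := by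
      convert this
    convert (by omega : (seg (s.realArr 5) 0 m).countP (· < s3.realVar 22) < ⌈1 / ν⌉₊)
  · rw [← SIB.countP_seg (s.realArr 5) m (· ≤ s3.realVar 22)]
    have := hr.2
    have e : ⌈1 / ν⌉₊ - 1 < (seg (s.realArr 5) 0 m).countP (· ≤ s3.realVar 22) := by
      convert this
    convert (by omega : ⌈1 / ν⌉₊ ≤ (seg (s.realArr 5) 0 m).countP (· ≤ s3.realVar 22))

end RealRAM

namespace SIB

open RealRAM

theorem exists_oracle_program : ∃ (P : RealRAM.Prog) (C : ℝ),
      ∀ (m : ℕ) (h : Fin m → ℝ) (ν : ℝ),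
        0 < m →
        ν ∈ Set.Icc (1 / (m : ℝ)) 1 →
        ∃ (T : ℕ) (s : RealRAM.Store),
          RealRAM.Runs P (SIB.oracleStore h ν) T s ∧
          SIB.IsTopSelection h ν (SIB.oracleOutput m s) ∧
          SIB.oracleOutput m s ∈ SIB.cappedSimplex m ν ∧
          IsMinOn (fun b : Fin m → ℝ => h ⬝ᵥ b) (SIB.cappedSimplex m ν) (SIB.oracleOutput m s) ∧
          (T : ℝ) ≤ C * (m : ℝ) := by
  refine ⟨.seq (block [.natCopy 60 0, .realCopy 30 0])
    (.seq (copyArr 0 5) (.seq topSelect (copyArr 6 1))), 150300, ?_⟩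
  intro m h ν hm hν
  suffices H : Tri (.seq (block [.natCopy 60 0, .realCopy 30 0])
      (.seq (copyArr 0 5) (.seq topSelect (copyArr 6 1)))) (oracleStore h ν) fun T s =>
        SIB.IsTopSelection h ν (SIB.oracleOutput m s) ∧
          SIB.oracleOutput m s ∈ SIB.cappedSimplex m ν ∧
          IsMinOn (fun b : Fin m → ℝ => h ⬝ᵥ b) (SIB.cappedSimplex m ν) (SIB.oracleOutput m s) ∧
          (T : ℝ) ≤ 150300 * (m : ℝ) from H
  refine Tri.block_seq ?_
  refine Tri.andThen (copyArr_spec (m := m) (by simp [oracleStore, arrOfList]) (by norm_num)) ?_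
  rintro k1 s1 f1 ⟨hk1, h5⟩
  have a60 : s1.natVar 60 = m := by rw [f1.nat 60 rfl]; simp [oracleStore, arrOfList]
  have a30 : s1.realVar 30 = ν := by rw [f1.real 30 rfl]; simp [oracleStore, arrOfList]
  have eh : (fun j : Fin m => s1.realArr 5 j) = h := by
    funext j
    rw [h5 j j.2]
    simp [oracleStore, arrOfList]
  refine Tri.andThen (topSelect_spec hm a60 a30 hν) ?_
  rintro k2 s2 f2 ⟨hk2, h1, h2, h3⟩
  rw [eh] at h1 h3
  have b60 : s2.natVar 60 = m := by rw [f2.nat 60 rfl, a60]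
  refine (copyArr_spec b60 (by norm_num)).mono ?_
  rintro k3 s3 - ⟨hk3, h6⟩
  have e : oracleOutput m s3 = fun j : Fin m => s2.realArr 6 j := by
    funext j
    exact h6 j j.2
  rw [e]
  refine ⟨h1, h2, h3, ?_⟩
  have : [Instr.natCopy 60 0, .realCopy 30 0].length + 1 + (k1 + (k2 + k3)) ≤ 150300 * m := by
    simp; omega
  exact_mod_cast this

end SIB

/-! ### Compressed sparse columns and the oracle over a reduced polytope. -/

namespace SIB

/-- The vector stored in the array `f` from position `o` on. -/
def vecAt (d : ℕ) (f : ℕ → ℝ) (o : ℕ) : EuclideanSpace ℝ (Fin d) :=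
  WithLp.toLp 2 fun k => f (o + k)

@[simp] theorem vecAt_apply (d : ℕ) (f : ℕ → ℝ) (o : ℕ) (k : Fin d) :
    vecAt d f o k = f (o + k) := rfl

theorem vecAt_congr {d : ℕ} {f g : ℕ → ℝ} {o o' : ℕ} (h : ∀ k < d, f (o + k) = g (o' + k)) :
    vecAt d f o = vecAt d g o' := by
  ext k
  exact h k k.2

variable {d m : ℕ}

/-- The number of nonzero entries of the `j`-th column. -/
def colLen (V : Matrix (Fin d) (Fin m) ℝ) (j : ℕ) : ℕ :=
  if h : j < m then (colSupport V ⟨j, h⟩).length else 0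

theorem colLen_fin (V : Matrix (Fin d) (Fin m) ℝ) (j : Fin m) :
    colLen V j = (colSupport V j).length := by simp [colLen]

/-- The number of nonzero entries of the columns before the `j`-th one. -/
def nzOff (V : Matrix (Fin d) (Fin m) ℝ) (j : ℕ) : ℕ := ∑ j' ∈ Finset.range j, colLen V j'

theorem nzOff_succ (V : Matrix (Fin d) (Fin m) ℝ) (j : ℕ) :
    nzOff V (j + 1) = nzOff V j + colLen V j := Finset.sum_range_succ _ _

theorem nzOff_eq (V : Matrix (Fin d) (Fin m) ℝ) :
    nzOff V m = ∑ j, (colSupport V j).length := by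
  rw [nzOff, ← Fin.sum_univ_eq_sum_range]
  exact Finset.sum_congr rfl fun j _ => colLen_fin V j

/-- The compressed sparse column data of `V` are found in the given arrays, its columns from
position `c` on and its nonzero entries from position `e` on. -/
structure BlockAt (len row : ℕ → ℕ) (val : ℕ → ℝ) (V : Matrix (Fin d) (Fin m) ℝ)
    (c e : ℕ) : Prop where
  len : ∀ j : Fin m, len (c + j) = (colSupport V j).length
  row : ∀ (j : Fin m) (t : ℕ) (h : t < (colSupport V j).length),
    row (e + nzOff V j + t) = (colSupport V j)[t]
  val : ∀ (j : Fin m) (t : ℕ) (h : t < (colSupport V j).length),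
    val (e + nzOff V j + t) = V (colSupport V j)[t] j

theorem sum_fin_lt_succ {i : ℕ} (hi : i < m) (f : Fin m → ℝ) :
    (∑ j : Fin m, if (j : ℕ) < i + 1 then f j else 0) =
      (∑ j : Fin m, if (j : ℕ) < i then f j else 0) + f ⟨i, hi⟩ := by
  have h : f ⟨i, hi⟩ = ∑ j : Fin m, if j = ⟨i, hi⟩ then f j else 0 := by simp
  rw [h, ← Finset.sum_add_distrib]
  refine Finset.sum_congr rfl fun j _ => ?_
  have e : j = ⟨i, hi⟩ ↔ (j : ℕ) = i := Fin.ext_iff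
  rcases Nat.lt_trichotomy (j : ℕ) i with hj | hj | hj
  · simp [hj, hj.ne, e, Nat.lt_succ_of_lt hj]
  · simp [hj, e]
  · simp [hj.ne', e, not_lt.2 hj.le, not_lt.2 (Nat.succ_le_of_lt hj)]

/-- The entries left out are zero. This is why products with `V` can be computed in time
proportional to the number of nonzero entries and columns. -/
theorem sum_colSupport (V : Matrix (Fin d) (Fin m) ℝ) (j : Fin m) (y : Fin d → ℝ) :
    ((colSupport V j).map fun k => V k j * y k).sum = ∑ k, V k j * y k := by
  classical
  have key : ∀ l : List (Fin d),
      ((l.filter fun k => V k j ≠ 0).map fun k => V k j * y k).sum =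
        (l.map fun k => V k j * y k).sum := by
    intro l
    induction l with
    | nil => rfl
    | cons k l ih =>
      by_cases hk : V k j = 0
      · simpa [hk] using ih
      · simpa [hk] using ih
  rw [Fin.sum_univ_def]
  refine Eq.trans ?_ (key _)
  rw [colSupport]

end SIB

namespace RealRAM

open SIB

/-- Adds to the real variable `40` the inner product of the column with `75` nonzero entries that
starts at position `71` and the vector at position `72` of the real array `4`. -/
def colDot : Prog :=
  forN 74 75 (block [.natRead 77 2 71, .realRead 41 0 71, .natAdd 77 72 77, .realRead 42 4 77,
    .realMul 41 41 42, .realAdd 40 40 41, .natConst 76 1, .natAdd 71 71 76])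

theorem colDot_spec {d m : ℕ} {V : Matrix (Fin d) (Fin m) ℝ} {s : Store} {j : Fin m} {e yo : ℕ}
    (h75 : s.natVar 75 = (colSupport V j).length) (h71 : s.natVar 71 = e)
    (h72 : s.natVar 72 = yo)
    (hrow : ∀ (t : ℕ) (h : t < (colSupport V j).length),
      s.natArr 2 (e + t) = (colSupport V j)[t])
    (hval : ∀ (t : ℕ) (h : t < (colSupport V j).length),
      s.realArr 0 (e + t) = V (colSupport V j)[t] j) :
    Tri colDot s fun k s' => k ≤ 13 * (colSupport V j).length + 3 ∧
      s'.natVar 71 = e + (colSupport V j).length ∧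
      s'.realVar 40 = s.realVar 40 + ∑ k, V k j * s.realArr 4 (yo + k) := by
  refine Tri.forN _ (fun i s1 => s1.natVar 71 = e + i ∧ s1.realVar 40 = s.realVar 40 +
    (((colSupport V j).take i).map fun k => V k j * s.realArr 4 (yo + k)).sum) (fun _ => 9)
    h75 rfl rfl rfl (by simp [h71]) ?_ ?_
  · rintro i hi s1 hf h74 h75' ⟨h1, h2⟩
    have a72 : s1.natVar 72 = yo := by rw [hf.nat 72 rfl, h72]
    have a2 : s1.natArr 2 = s.natArr 2 := hf.natArr 2 rfl
    have a0 : s1.realArr 0 = s.realArr 0 := hf.realArr 0 rfl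
    have a4 : s1.realArr 4 = s.realArr 4 := hf.realArr 4 rfl
    refine Tri.block ⟨by simp, by simp [h1, add_assoc], ?_⟩
    rw [List.take_add_one, List.map_append, List.sum_append, ← add_assoc, ← h2]
    simp [h1, a72, a2, a0, a4, hrow i hi, hval i hi, hi]
  · rintro k s' hf - hk ⟨h1, h2⟩
    refine ⟨by simp at hk; omega, h1, ?_⟩
    rw [h2, List.take_length, sum_colSupport]

/-- Adds to the vector at position `0` of the real array `7` the multiple by the real variable `43`
of the column with `75` nonzero entries that starts at position `71`. -/
def colAdd : Prog :=
  forN 74 75 (block [.natRead 77 2 71, .realRead 41 0 71, .realMul 41 41 43, .realRead 40 7 77,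
    .realAdd 40 40 41, .realWrite 7 77 40, .natConst 76 1, .natAdd 71 71 76])

theorem colAdd_spec {d m : ℕ} {V : Matrix (Fin d) (Fin m) ℝ} {s : Store} {j : Fin m} {e : ℕ}
    (h75 : s.natVar 75 = (colSupport V j).length) (h71 : s.natVar 71 = e)
    (hrow : ∀ (t : ℕ) (h : t < (colSupport V j).length),
      s.natArr 2 (e + t) = (colSupport V j)[t])
    (hval : ∀ (t : ℕ) (h : t < (colSupport V j).length),
      s.realArr 0 (e + t) = V (colSupport V j)[t] j) :
    Tri colAdd s fun k s' => k ≤ 13 * (colSupport V j).length + 3 ∧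
      s'.natVar 71 = e + (colSupport V j).length ∧
      ∀ k : Fin d, s'.realArr 7 k = s.realArr 7 k + V k j * s.realVar 43 := by
  -- The change of coordinate `k` is written as a sum against an indicator vector, so that
  -- `sum_colSupport` evaluates it at the end.
  refine Tri.forN _ (fun i s1 => s1.natVar 71 = e + i ∧ ∀ k : Fin d, s1.realArr 7 k =
    s.realArr 7 k + (((colSupport V j).take i).map fun k' =>
      V k' j * if k' = k then s.realVar 43 else 0).sum) (fun _ => 9)
    h75 rfl rfl rfl (by simp [h71]) ?_ ?_
  · rintro i hi s1 hf h74 h75' ⟨h1, h2⟩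
    have a43 : s1.realVar 43 = s.realVar 43 := hf.real 43 rfl
    have a2 : s1.natArr 2 = s.natArr 2 := hf.natArr 2 rfl
    have a0 : s1.realArr 0 = s.realArr 0 := hf.realArr 0 rfl
    refine Tri.block ⟨by simp, by simp [h1, add_assoc], ?_⟩
    intro k
    rw [List.take_add_one, List.map_append, List.sum_append, ← add_assoc, ← h2]
    simp [h1, a43, a2, a0, hrow i hi, hval i hi, hi, Function.update_apply]
    by_cases hk : k = (colSupport V j)[i]
    · subst hk; simp
    · rw [if_neg (fun h => hk (Fin.ext h)), if_neg (fun h => hk h.symm), add_zero]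
  · rintro k s' hf - hk ⟨h1, h2⟩
    refine ⟨by simp at hk; omega, h1, fun k => ?_⟩
    rw [h2, List.take_length, sum_colSupport]
    simp

/-- The cost vector of the linear oracle for the block with `60` columns at positions `70`, `71`. -/
def blockCost : Prog :=
  forN 73 60 (.seq (block [.natAdd 76 70 73, .natRead 75 1 76, .realConst 40 0])
    (.seq colDot (block [.realWrite 5 73 40])))

theorem blockCost_spec {d m : ℕ} {V : Matrix (Fin d) (Fin m) ℝ} {s : Store} {c e yo : ℕ}
    (hB : BlockAt (s.natArr 1) (s.natArr 2) (s.realArr 0) V c e)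
    (h60 : s.natVar 60 = m) (h70 : s.natVar 70 = c) (h71 : s.natVar 71 = e)
    (h72 : s.natVar 72 = yo) :
    Tri blockCost s fun k s' => k ≤ 13 * nzOff V m + 13 * m + 3 ∧
      s'.natVar 71 = e + nzOff V m ∧
      ∀ j : Fin m, s'.realArr 5 j = ∑ k, V k j * s.realArr 4 (yo + k) := by
  refine Tri.forN m (fun i s1 => s1.natVar 71 = e + nzOff V i ∧ ∀ j : Fin m, (j : ℕ) < i →
    s1.realArr 5 j = ∑ k, V k j * s.realArr 4 (yo + k)) (fun i => 13 * colLen V i + 9)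
    h60 rfl rfl rfl ?_ ?_ ?_
  · simp [h71, nzOff]
  · rintro i hi s1 hf h73 h60' ⟨h1, h2⟩
    have a70 : s1.natVar 70 = c := by rw [hf.nat 70 rfl, h70]
    have a72 : s1.natVar 72 = yo := by rw [hf.nat 72 rfl, h72]
    have aN1 : s1.natArr 1 = s.natArr 1 := hf.natArr 1 rfl
    have aN2 : s1.natArr 2 = s.natArr 2 := hf.natArr 2 rfl
    have aR0 : s1.realArr 0 = s.realArr 0 := hf.realArr 0 rfl
    have aR4 : s1.realArr 4 = s.realArr 4 := hf.realArr 4 rfl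
    refine Tri.block_seq ?_
    refine Tri.andThen (colDot_spec (V := V) (j := ⟨i, hi⟩) (e := e + nzOff V i) (yo := yo)
      ?_ ?_ ?_ ?_ ?_) ?_
    · simp [a70, h73, aN1]; exact hB.len ⟨i, hi⟩
    · simp [h1]
    · simp [a72]
    · simp only [List.foldl, Instr.exec]; simp [aN2]; exact hB.row ⟨i, hi⟩
    · simp only [List.foldl, Instr.exec]; simp [aR0]; exact hB.val ⟨i, hi⟩
    rintro k1 s2 f2 ⟨hk1, b71, b40⟩
    have b73 : s2.natVar 73 = i := by rw [f2.nat 73 rfl]; simp [h73]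
    have b5 : s2.realArr 5 = s1.realArr 5 := by rw [f2.realArr 5 rfl]; simp
    simp [aR4] at b40
    refine Tri.block ⟨?_, ?_, ?_⟩
    · simp [colLen, hi]; omega
    · simp [b71, nzOff_succ, colLen, hi, add_assoc]
    · intro j hj
      simp [b73, b5]
      rcases Nat.lt_succ_iff_lt_or_eq.1 hj with hj | hj
      · rw [Function.update_of_ne hj.ne]
        exact h2 j hj
      · obtain rfl : j = ⟨i, hi⟩ := Fin.ext hj
        simp [b40]
  · rintro k s' hf - hk ⟨h1, h2⟩
    refine ⟨?_, h1, fun j => h2 j j.2⟩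
    rw [Finset.sum_add_distrib, Finset.sum_add_distrib, ← Finset.mul_sum, ← nzOff] at hk
    simp at hk
    omega

/-- Puts zeros into the first `1` entries of the real array `7`. -/
def blockZero : Prog := forN 73 1 (block [.realConst 40 0, .realWrite 7 73 40])

theorem blockZero_spec {s : Store} {d : ℕ} (h1 : s.natVar 1 = d) :
    Tri blockZero s fun k s' => k ≤ 7 * d + 3 ∧ ∀ k < d, s'.realArr 7 k = 0 := by
  refine Tri.forN d (fun i s1 => ∀ k < i, s1.realArr 7 k = 0) (fun _ => 3) h1 rfl rfl rfl
    (by simp) ?_ ?_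
  · rintro i hi s1 hf h73 - h2
    refine Tri.block ⟨by simp, fun k hk => ?_⟩
    simp [h73, Function.update_apply]
    intro hki
    exact h2 k (by omega)
  · rintro k s' hf - hk h
    exact ⟨by simp at hk; omega, h⟩

/-- Puts into the real array `7` the combination of the columns of a block with the coefficients
in the real array `6`. -/
def blockComb : Prog :=
  forN 73 60 (.seq (block [.natAdd 76 70 73, .natRead 75 1 76, .realRead 43 6 73]) colAdd)

theorem blockComb_spec {d m : ℕ} {V : Matrix (Fin d) (Fin m) ℝ} {s : Store} {c e : ℕ}
    (hB : BlockAt (s.natArr 1) (s.natArr 2) (s.realArr 0) V c e)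
    (h60 : s.natVar 60 = m) (h70 : s.natVar 70 = c) (h71 : s.natVar 71 = e)
    (h7 : ∀ k < d, s.realArr 7 k = 0) :
    Tri blockComb s fun k s' => k ≤ 13 * nzOff V m + 13 * m + 3 ∧
      s'.natVar 71 = e + nzOff V m ∧
      ∀ k : Fin d, s'.realArr 7 k = ∑ j : Fin m, V k j * s.realArr 6 j := by
  refine Tri.forN m (fun i s1 => s1.natVar 71 = e + nzOff V i ∧ ∀ k : Fin d,
    s1.realArr 7 k = ∑ j : Fin m, if (j : ℕ) < i then V k j * s.realArr 6 j else 0)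
    (fun i => 13 * colLen V i + 9) h60 rfl rfl rfl ?_ ?_ ?_
  · simp [h71, nzOff]; intro k; exact h7 k k.2
  · rintro i hi s1 hf h73 h60' ⟨h1, h2⟩
    have a70 : s1.natVar 70 = c := by rw [hf.nat 70 rfl, h70]
    have aN1 : s1.natArr 1 = s.natArr 1 := hf.natArr 1 rfl
    have aN2 : s1.natArr 2 = s.natArr 2 := hf.natArr 2 rfl
    have aR0 : s1.realArr 0 = s.realArr 0 := hf.realArr 0 rfl
    have aR6 : s1.realArr 6 = s.realArr 6 := hf.realArr 6 rfl
    refine Tri.block_seq ?_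
    refine (colAdd_spec (V := V) (j := ⟨i, hi⟩) (e := e + nzOff V i) ?_ ?_ ?_ ?_).mono ?_
    · simp [a70, h73, aN1]; exact hB.len ⟨i, hi⟩
    · simp [h1]
    · simp only [List.foldl, Instr.exec]; simp [aN2]; exact hB.row ⟨i, hi⟩
    · simp only [List.foldl, Instr.exec]; simp [aR0]; exact hB.val ⟨i, hi⟩
    rintro k1 s2 f2 ⟨hk1, b71, b7⟩
    simp [h73, aR6] at b7
    refine ⟨?_, ?_, ?_⟩
    · simp [colLen, hi]; omega
    · simp [b71, nzOff_succ, colLen, hi, add_assoc]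
    · intro k
      rw [sum_fin_lt_succ hi]
      simp only [Store.setNat_realArr]
      rw [b7, h2]
  · rintro k s' hf - hk ⟨h1, h2⟩
    refine ⟨?_, h1, fun j => by rw [h2]; simp⟩
    rw [Finset.sum_add_distrib, Finset.sum_add_distrib, ← Finset.mul_sum, ← nzOff] at hk
    simp at hk
    omega

/-- The linear oracle over a reduced polytope: dimension in `1`, number of columns in `60`, cap in
the real variable `30`, positions of the data in `70` and `71`, direction at position `72` of the
real array `4`. The minimizer is put into the real array `7`, and the positions are advanced. -/
def blockOracle : Prog :=
  .seq (block [.natCopy 78 71])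
    (.seq blockCost (.seq topSelect (.seq blockZero (.seq (block [.natCopy 71 78])
      (.seq blockComb (block [.natAdd 70 70 60]))))))

/-- Since `⟪y, V b⟫ = (Vᵀ y) ⬝ᵥ b`, the problem is the one over the capped simplex with cost `Vᵀ y`.
The data of the block are read twice, once for the cost and once for the combination, hence the
saved position `78`. -/
theorem blockOracle_spec {d m : ℕ} {V : Matrix (Fin d) (Fin m) ℝ} {ν : ℝ} {s : Store}
    {c e yo : ℕ} (hm : 0 < m) (hν : ν ∈ Set.Icc (1 / (m : ℝ)) 1)
    (hB : BlockAt (s.natArr 1) (s.natArr 2) (s.realArr 0) V c e)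
    (h1 : s.natVar 1 = d) (h60 : s.natVar 60 = m) (r30 : s.realVar 30 = ν)
    (h70 : s.natVar 70 = c) (h71 : s.natVar 71 = e) (h72 : s.natVar 72 = yo) :
    Tri blockOracle s fun k s' => k ≤ 160000 * (nzOff V m + m + d) ∧
      s'.natVar 70 = c + m ∧ s'.natVar 71 = e + nzOff V m ∧
      vecAt d (s'.realArr 7) 0 ∈ reducedPolytope V ν ∧
      ∀ w ∈ reducedPolytope V ν, inner ℝ (vecAt d (s.realArr 4) yo) (vecAt d (s'.realArr 7) 0) ≤
        inner ℝ (vecAt d (s.realArr 4) yo) w := by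
  refine Tri.block_seq ?_
  refine Tri.andThen (blockCost_spec (V := V) (c := c) (e := e) (yo := yo) (by simpa using hB)
    (by simp [h60]) (by simp [h70]) (by simp [h71]) (by simp [h72])) ?_
  rintro k1 s1 f1 ⟨hk1, -, h5⟩
  simp at h5
  have a1 : s1.natVar 1 = d := by rw [f1.nat 1 rfl]; simp [h1]
  have a60 : s1.natVar 60 = m := by rw [f1.nat 60 rfl]; simp [h60]
  have a70 : s1.natVar 70 = c := by rw [f1.nat 70 rfl]; simp [h70]
  have a78 : s1.natVar 78 = e := by rw [f1.nat 78 rfl]; simp [h71]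
  have a30 : s1.realVar 30 = ν := by rw [f1.real 30 rfl]; simp [r30]
  have aB : BlockAt (s1.natArr 1) (s1.natArr 2) (s1.realArr 0) V c e := by
    rw [f1.natArr 1 rfl, f1.natArr 2 rfl, f1.realArr 0 rfl]; simpa using hB
  refine Tri.andThen (topSelect_spec hm a60 a30 hν) ?_
  rintro k2 s2 f2 ⟨hk2, -, hcap, hmin⟩
  have b1 : s2.natVar 1 = d := by rw [f2.nat 1 rfl, a1]
  refine Tri.andThen (blockZero_spec b1) ?_
  rintro k3 s3 f3 ⟨hk3, h7⟩
  have c60 : s3.natVar 60 = m := by rw [f3.nat 60 rfl, f2.nat 60 rfl, a60]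
  have c70 : s3.natVar 70 = c := by rw [f3.nat 70 rfl, f2.nat 70 rfl, a70]
  have c78 : s3.natVar 78 = e := by rw [f3.nat 78 rfl, f2.nat 78 rfl, a78]
  have c6 : s3.realArr 6 = s2.realArr 6 := f3.realArr 6 rfl
  have cB : BlockAt (s3.natArr 1) (s3.natArr 2) (s3.realArr 0) V c e := by
    rw [f3.natArr 1 rfl, f3.natArr 2 rfl, f3.realArr 0 rfl, f2.natArr 1 rfl, f2.natArr 2 rfl,
      f2.realArr 0 rfl]
    exact aB
  refine Tri.block_seq ?_
  refine Tri.andThen (blockComb_spec (V := V) (c := c) (e := e) (by simpa using cB)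
    (by simp [c60]) (by simp [c70]) (by simp [c78]) (by simpa using h7)) ?_
  rintro k4 s4 f4 ⟨hk4, d71, d7⟩
  simp [c6] at d7
  have d60 : s4.natVar 60 = m := by rw [f4.nat 60 rfl]; simp [c60]
  have d70 : s4.natVar 70 = c := by rw [f4.nat 70 rfl]; simp [c70]
  set b : Fin m → ℝ := fun j => s2.realArr 6 j with hb
  have e7 : vecAt d (s4.realArr 7) 0 = WithLp.toLp 2 (V *ᵥ b) := by
    ext k
    simp [d7, Matrix.mulVec, dotProduct, hb]
  have key : ∀ b' : Fin m → ℝ, inner ℝ (vecAt d (s.realArr 4) yo) (WithLp.toLp 2 (V *ᵥ b')) =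
      (fun j : Fin m => s1.realArr 5 j) ⬝ᵥ b' := by
    intro b'
    simp only [PiLp.inner_apply, dotProduct, h5, Matrix.mulVec, vecAt_apply, RCLike.inner_apply,
      conj_trivial, Finset.sum_mul]
    rw [Finset.sum_comm]
    refine Finset.sum_congr rfl fun j _ => Finset.sum_congr rfl fun k _ => ?_
    ring
  refine Tri.block ⟨by simp; omega, by simp [d60, d70], by simp [d71], ?_, ?_⟩
  · simp only [List.foldl, Instr.exec, Store.setNat_realArr]
    rw [e7]
    exact ⟨b, hcap, rfl⟩
  · simp only [List.foldl, Instr.exec, Store.setNat_realArr]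
    rintro w ⟨b', hb', rfl⟩
    rw [e7, key, key]
    exact hmin hb'

end RealRAM

namespace SIB

/-- Concatenated lists are addressed by prefix sums of their lengths. The lengths are a function on
`ℕ` so that these prefix sums range over `Finset.range`. -/
theorem getD_flatMap_finRange {α : Type*} {n : ℕ} (f : Fin n → List α) (g : ℕ → ℕ)
    (hg : ∀ i : Fin n, g i = (f i).length) (i : Fin n) (t : ℕ) (ht : t < (f i).length) (x : α) :
    ((List.finRange n).flatMap f).getD ((∑ i' ∈ Finset.range i, g i') + t) x =
      (f i).getD t x := by
  induction n generalizing g with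
  | zero => exact i.elim0
  | succ n ih =>
    rw [List.finRange_succ, List.flatMap_cons, List.flatMap_map]
    refine Fin.cases ?_ (fun i => ?_) i (motive := fun i => ∀ ht : t < (f i).length,
      (f 0 ++ (List.finRange n).flatMap fun a => f a.succ).getD
        ((∑ i' ∈ Finset.range i, g i') + t) x = (f i).getD t x) ht
    · intro ht
      simp only [Fin.val_zero, Finset.range_zero, Finset.sum_empty, zero_add]
      rw [List.getD_append _ _ _ _ ht]
    · intro ht
      rw [Fin.val_succ, Finset.sum_range_succ', List.getD_append_right]
      · have h0 : g 0 = (f 0).length := hg 0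
        rw [← ih (fun i => f i.succ) (fun i => g (i + 1)) (fun i => hg i.succ) i ht, h0]
        congr 1
        omega
      · have h0 : g 0 = (f 0).length := hg 0
        omega

theorem sum_range_add_lt_length_flatMap {α : Type*} {n : ℕ} (f : Fin n → List α) (g : ℕ → ℕ)
    (hg : ∀ i : Fin n, g i = (f i).length) (i : Fin n) (t : ℕ) (ht : t < (f i).length) :
    (∑ i' ∈ Finset.range i, g i') + t < ((List.finRange n).flatMap f).length := by
  have h : ((List.finRange n).flatMap f).length = ∑ i' ∈ Finset.range n, g i' := by
    rw [List.length_flatMap, ← Fin.sum_univ_eq_sum_range, Fin.sum_univ_def]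
    congr 1
    exact List.map_congr_left fun i _ => (hg i).symm
  rw [h]
  have h2 : ∑ i' ∈ Finset.range (i + 1), g i' ≤ ∑ i' ∈ Finset.range n, g i' :=
    Finset.sum_le_sum_of_subset (Finset.range_mono i.2)
  rw [Finset.sum_range_succ, hg i] at h2
  omega

section

variable {n d : ℕ} {m : Fin n → ℕ} (V : ∀ i, Matrix (Fin d) (Fin (m i)) ℝ) (ν : Fin n → ℝ)

/-- The number of columns of the `i`-th block. -/
def blockCols (m : Fin n → ℕ) (i : ℕ) : ℕ := if h : i < n then m ⟨i, h⟩ else 0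

/-- The number of nonzero entries of the `i`-th block. -/
def blockNz (i : ℕ) : ℕ := if h : i < n then nzOff (V ⟨i, h⟩) (m ⟨i, h⟩) else 0

/-- The position of the first column of the `i`-th block. -/
def colStart (m : Fin n → ℕ) (i : ℕ) : ℕ := ∑ i' ∈ Finset.range i, blockCols m i'

/-- The position of the first nonzero entry of the `i`-th block. -/
def nzStart (i : ℕ) : ℕ := ∑ i' ∈ Finset.range i, blockNz V i'

/-- The memory `s` contains the input `V`, `ν`. -/
structure HasInput (s : RealRAM.Store) : Prop where
  rows : s.natVar 0 = n
  dim : s.natVar 1 = d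
  cols : ∀ i : Fin n, s.natArr 0 i = m i
  cap : ∀ i : Fin n, s.realArr 1 i = ν i
  block : ∀ i : Fin n, BlockAt (s.natArr 1) (s.natArr 2) (s.realArr 0) (V i) (colStart m i)
    (nzStart V i)

theorem hasInput_inputStore (ε : ℝ) : HasInput V ν (inputStore V ν ε) := by
  have hcols : ∀ i : Fin n, blockCols m i =
      ((List.finRange (m i)).map fun j => (colSupport (V i) j).length).length := fun i => by
    simp [blockCols]
  have hlen : ∀ i : Fin n, nzOff (V i) (m i) =
      ((List.finRange (m i)).map fun j => (colSupport (V i) j).length).sum := fun i => by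
    rw [nzOff_eq, Fin.sum_univ_def]
  have hnz : ∀ {α : Type} (f : ∀ i : Fin n, Fin (m i) → Fin d → α) (i : Fin n), blockNz V i =
      ((List.finRange (m i)).flatMap fun j => (colSupport (V i) j).map (f i j)).length :=
    fun f i => by
      simp [blockNz, hlen, List.length_flatMap]
  -- Generic in `f`, as it serves for the row indices and for the values; the address lemma is
  -- applied once for blocks and once for columns.
  have hget : ∀ {α : Type} (f : ∀ i : Fin n, Fin (m i) → Fin d → α) (i : Fin n) (j : Fin (m i))
      (t : ℕ) (h : t < (colSupport (V i) j).length) (x : α),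
      ((List.finRange n).flatMap fun i => (List.finRange (m i)).flatMap fun j =>
        (colSupport (V i) j).map (f i j)).getD (nzStart V i + nzOff (V i) j + t) x =
        f i j (colSupport (V i) j)[t] := by
    intro α f i j t h x
    have h' : t < ((colSupport (V i) j).map (f i j)).length := by simpa using h
    rw [nzStart, add_assoc, getD_flatMap_finRange _ _ (hnz f) i _ ?_ x, nzOff,
      getD_flatMap_finRange (fun j => (colSupport (V i) j).map (f i j)) (colLen (V i)) ?_ j t h']
    · rw [List.getD_eq_getElem _ _ h', List.getElem_map]
    · intro j; simp [colLen_fin]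
    · exact sum_range_add_lt_length_flatMap (fun j => (colSupport (V i) j).map (f i j))
        (colLen (V i)) (fun j => by simp [colLen_fin]) j t h'
  refine ⟨rfl, rfl, fun i => ?_, fun i => ?_, fun i => ⟨fun j => ?_, ?_, ?_⟩⟩
  · simp [inputStore, RealRAM.arrOfList]
  · simp [inputStore, RealRAM.arrOfList]
  · change ((List.finRange n).flatMap fun i =>
        (List.finRange (m i)).map fun j => (colSupport (V i) j).length).getD _ 0 = _
    have hj : (j : ℕ) < ((List.finRange (m i)).map fun j => (colSupport (V i) j).length).length := by
      simp
    rw [colStart, getD_flatMap_finRange _ _ hcols i j hj, List.getD_eq_getElem _ _ hj,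
      List.getElem_map, List.getElem_finRange]
    rfl
  · intro j t h
    have := hget (fun _ _ k => (k : ℕ)) i j t h 0
    simpa [inputStore, RealRAM.arrOfList, List.map_eq_flatMap] using this
  · intro j t h
    exact hget (fun i j k => V i k j) i j t h 0

end

end SIB

namespace RealRAM

open SIB

/-! ### Vector operations -/

/-- `row c of C := 46 * row a of A + 47 * row b of B`, the rows starting at the positions given by
the integer variables `c`, `a`, `b` and having length `1`. -/
def rowLin (C c A a B b : ℕ) : Prog :=
  forN 82 1 (block [.natAdd 83 a 82, .realRead 44 A 83, .realMul 44 44 46, .natAdd 83 b 82,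
    .realRead 43 B 83, .realMul 43 43 47, .realAdd 44 44 43, .natAdd 83 c 82, .realWrite C 83 44])

/-- A source array may be the target if its row is the target row, since each entry is read just
before it is overwritten. The conditions on `a`, `b`, `c` keep the row positions apart from the
written variables `82`, `83` and `99`. -/
theorem rowLin_spec {C c A a B b d : ℕ} {s : Store} (h1 : s.natVar 1 = d)
    (hA : A = C → s.natVar a = s.natVar c) (hB : B = C → s.natVar b = s.natVar c)
    (ha : 90 > a ∧ a ≠ 82 ∧ a ≠ 83) (hb : 90 > b ∧ b ≠ 82 ∧ b ≠ 83)
    (hc : 90 > c ∧ c ≠ 82 ∧ c ≠ 83) :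
    Tri (rowLin C c A a B b) s fun k s' => k ≤ 14 * d + 3 ∧
      vecAt d (s'.realArr C) (s.natVar c) =
        s.realVar 46 • vecAt d (s.realArr A) (s.natVar a) +
          s.realVar 47 • vecAt d (s.realArr B) (s.natVar b) ∧
      ∀ j, (j < s.natVar c ∨ s.natVar c + d ≤ j) → s'.realArr C j = s.realArr C j := by
  have hw : ∀ x, x < 90 → x ≠ 82 → x ≠ 83 →
      (rowLin C c A a B b).any (Instr.writesNat x) = false := by
    intro x h1 h2 h3
    have : x ≠ 99 := by omega
    simp [rowLin, RealRAM.forN, RealRAM.block, Prog.any, Instr.writesNat, h2, h3, this]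
  refine Tri.forN d (fun i s1 => (∀ x, x ≠ C → s1.realArr x = s.realArr x) ∧
      (∀ k < i, s1.realArr C (s.natVar c + k) = s.realVar 46 * s.realArr A (s.natVar a + k) +
        s.realVar 47 * s.realArr B (s.natVar b + k)) ∧
      ∀ j, (j < s.natVar c ∨ s.natVar c + i ≤ j) → s1.realArr C j = s.realArr C j)
    (fun _ => 10) h1 rfl rfl rfl ?_ ?_ ?_
  · simp
  · rintro i hi s1 hf h82 - ⟨hx, h2, h3⟩
    have ea : s1.natVar a = s.natVar a := hf.nat a (hw a ha.1 ha.2.1 ha.2.2)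
    have eb : s1.natVar b = s.natVar b := hf.nat b (hw b hb.1 hb.2.1 hb.2.2)
    have ec : s1.natVar c = s.natVar c := hf.nat c (hw c hc.1 hc.2.1 hc.2.2)
    have e46 : s1.realVar 46 = s.realVar 46 := hf.real 46 rfl
    have e47 : s1.realVar 47 = s.realVar 47 := hf.real 47 rfl
    have eA : s1.realArr A (s.natVar a + i) = s.realArr A (s.natVar a + i) := by
      by_cases h : A = C
      · rw [h, hA h]; exact h3 _ (Or.inr le_rfl)
      · rw [hx A h]
    have eB : s1.realArr B (s.natVar b + i) = s.realArr B (s.natVar b + i) := by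
      by_cases h : B = C
      · rw [h, hB h]; exact h3 _ (Or.inr le_rfl)
      · rw [hx B h]
    refine Tri.block ⟨by simp, ?_, ?_, ?_⟩
    · intro x hxC
      simp [hxC, hx x hxC]
    · intro k hk
      simp [hb.2.2, hc.2.2, ea, eb, ec, h82, eA, eB, e46, e47]
      rcases Nat.lt_succ_iff_lt_or_eq.1 hk with hk | rfl
      · rw [Function.update_of_ne (by omega)]
        exact h2 k hk
      · rw [Function.update_self]; ring
    · intro j hj
      simp [hb.2.2, hc.2.2, ea, eb, ec, h82]
      rw [Function.update_of_ne (by omega)]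
      exact h3 j (by omega)
  · rintro k s' hf - hk ⟨-, h2, h3⟩
    refine ⟨by simp at hk; omega, ?_, h3⟩
    ext k
    simpa using h2 k k.2

/-- The real variable `45` becomes the inner product of row `a` of `A` and row `b` of `B`. -/
def rowDot (A a B b : ℕ) : Prog :=
  .seq (block [.realConst 45 0])
    (forN 82 1 (block [.natAdd 83 a 82, .realRead 44 A 83, .natAdd 83 b 82,
      .realRead 43 B 83, .realMul 44 44 43, .realAdd 45 45 44]))

theorem rowDot_spec {A a B b d : ℕ} {s : Store} (h1 : s.natVar 1 = d)
    (ha : 90 > a ∧ a ≠ 82 ∧ a ≠ 83) (hb : 90 > b ∧ b ≠ 82 ∧ b ≠ 83) :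
    Tri (rowDot A a B b) s fun k s' => k ≤ 11 * d + 5 ∧
      s'.realVar 45 = inner ℝ (vecAt d (s.realArr A) (s.natVar a))
        (vecAt d (s.realArr B) (s.natVar b)) := by
  have hw : ∀ x, x < 90 → x ≠ 82 → x ≠ 83 →
      (rowDot A a B b).any (Instr.writesNat x) = false := by
    intro x h1 h2 h3
    have : x ≠ 99 := by omega
    simp [rowDot, RealRAM.forN, RealRAM.block, Prog.any, Instr.writesNat, h2, h3, this]
  refine Tri.block_seq ?_
  refine Tri.forN d (fun i s1 => s1.realVar 45 = ∑ k ∈ Finset.range i,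
      s.realArr A (s.natVar a + k) * s.realArr B (s.natVar b + k))
    (fun _ => 7) (by simp [h1]) rfl rfl rfl ?_ ?_ ?_
  · simp
  · rintro i hi s1 hf h82 - h2
    have hw' : ∀ x, x < 90 → x ≠ 82 → x ≠ 83 → s1.natVar x = s.natVar x := by
      intro x hx1 hx2 hx3
      rw [hf.nat x]
      · simp
      · have := hw x hx1 hx2 hx3
        simp only [rowDot, Prog.any, Bool.or_eq_false_iff] at this
        exact this.2
    have ea := hw' a ha.1 ha.2.1 ha.2.2
    have eb := hw' b hb.1 hb.2.1 hb.2.2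
    have eA : s1.realArr = s.realArr := by funext x; rw [hf.realArr x rfl]; simp
    refine Tri.block ⟨by simp, ?_⟩
    rw [Finset.sum_range_succ]
    simp [hb.2.2, ea, eb, eA, h82, h2]
  · rintro k s' hf - hk h
    refine ⟨by simp at hk ⊢; omega, ?_⟩
    rw [h, ← Fin.sum_univ_eq_sum_range (fun k => s.realArr A (s.natVar a + k) *
      s.realArr B (s.natVar b + k)), PiLp.inner_apply]
    refine Finset.sum_congr rfl fun k _ => ?_
    simp [mul_comm]

/-- All rows of `C` become `46` times those of `A` plus `47` times those of `B`. -/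
def allRows (C A B : ℕ) : Prog :=
  .seq (block [.natConst 81 0])
    (forN 80 0 (.seq (rowLin C 81 A 81 B 81) (block [.natAdd 81 81 1])))

/-- The integer variable `1` holds `d`, so `natAdd 81 81 1` moves on by one row; row offsets never
need a multiplication. -/
theorem allRows_spec {C A B n d : ℕ} {s : Store} (h0 : s.natVar 0 = n) (h1 : s.natVar 1 = d) :
    Tri (allRows C A B) s fun k s' => k ≤ 14 * (n * d) + 20 * n + 5 ∧
      ∀ i < n, vecAt d (s'.realArr C) (i * d) = s.realVar 46 • vecAt d (s.realArr A) (i * d) +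
          s.realVar 47 • vecAt d (s.realArr B) (i * d) := by
  refine Tri.block_seq ?_
  refine Tri.forN n (fun i s1 => s1.natVar 81 = i * d ∧
      (∀ x, x ≠ C → s1.realArr x = s.realArr x) ∧
      (∀ j, i * d ≤ j → s1.realArr C j = s.realArr C j) ∧
      ∀ i' < i, vecAt d (s1.realArr C) (i' * d) =
        s.realVar 46 • vecAt d (s.realArr A) (i' * d) +
          s.realVar 47 • vecAt d (s.realArr B) (i' * d)) (fun _ => 14 * d + 10) (by simp [h0])
    rfl rfl rfl (by simp) ?_ ?_
  · rintro i hi s1 hf h80 - ⟨h81, hx, h3, h4⟩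
    have a1 : s1.natVar 1 = d := by rw [hf.nat 1 rfl]; simp [h1]
    have a46 : s1.realVar 46 = s.realVar 46 := by rw [hf.real 46 rfl]; simp
    have a47 : s1.realVar 47 = s.realVar 47 := by rw [hf.real 47 rfl]; simp
    refine Tri.andThen (rowLin_spec a1 (fun _ => rfl) (fun _ => rfl) (by norm_num) (by norm_num)
      (by norm_num)) ?_
    rintro k s2 f2 ⟨hk, e1, e2⟩
    rw [h81] at e1 e2
    have b81 : s2.natVar 81 = i * d := by rw [f2.nat 81 rfl, h81]
    have b1 : s2.natVar 1 = d := by rw [f2.nat 1 rfl, a1]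
    have hrow : ∀ D, vecAt d (s1.realArr D) (i * d) = vecAt d (s.realArr D) (i * d) := by
      intro D
      by_cases hD : D = C
      · subst hD
        exact vecAt_congr fun k _ => h3 _ (Nat.le_add_right _ _)
      · rw [hx D hD]
    refine Tri.block ⟨by simp; omega, by simp [b81, b1]; ring, ?_, ?_, ?_⟩
    · intro x hxC
      simp
      rw [f2.realArr x]
      · exact hx x hxC
      · simp [rowLin, RealRAM.forN, RealRAM.block, Prog.any, Instr.writesRealArr, hxC]
    · intro j hj
      simp
      rw [add_mul, one_mul] at hj
      rw [e2 j (by omega), h3 j (by omega)]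
    · intro i' hi'
      simp
      rcases Nat.lt_succ_iff_lt_or_eq.1 hi' with hi' | rfl
      · rw [← h4 i' hi']
        refine vecAt_congr fun k hk => e2 _ (Or.inl ?_)
        have : (i' + 1) * d ≤ i * d := Nat.mul_le_mul_right d hi'
        rw [add_mul, one_mul] at this
        omega
      · rw [e1, a46, a47, hrow, hrow]
  · rintro k s' hf - hk ⟨-, -, -, h4⟩
    refine ⟨?_, h4⟩
    simp at hk ⊢
    nlinarith

/-- The real variable `52` becomes the maximal distance of the rows of `A` to the row of `B`. -/
def maxDist (A B : ℕ) : Prog :=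
  .seq (block [.natConst 81 0, .natConst 86 0, .realConst 52 0, .realConst 46 1, .realConst 47 0,
      .realSub 47 47 46])
    (forN 80 0 (.seq (rowLin 14 86 A 81 B 86) (.seq (rowDot 14 86 14 86)
      (.seq (block [.realSqrt 45 45, .natAdd 81 81 1])
        (.ite (.realLt 52 45) (block [.realCopy 52 45]) .skip)))))

/-- The maximum is characterized as the least nonnegative upper bound. Both halves matter later: the
upper bound for feasibility, the minimality for bounding the observed width by the diameter. -/
theorem maxDist_spec {A B n d : ℕ} {s : Store} (h0 : s.natVar 0 = n) (h1 : s.natVar 1 = d)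
    (hA : A ≠ 14) (hB : B ≠ 14) :
    Tri (maxDist A B) s fun k s' => k ≤ 25 * (n * d) + 30 * n + 11 ∧
      (∀ i < n, ‖vecAt d (s.realArr A) (i * d) - vecAt d (s.realArr B) 0‖ ≤ s'.realVar 52) ∧
      ∀ c, 0 ≤ c → (∀ i < n, ‖vecAt d (s.realArr A) (i * d) - vecAt d (s.realArr B) 0‖ ≤ c) →
        s'.realVar 52 ≤ c := by
  refine Tri.block_seq ?_
  refine Tri.forN n (fun i s1 => s1.natVar 81 = i * d ∧
      (∀ i' < i, ‖vecAt d (s.realArr A) (i' * d) - vecAt d (s.realArr B) 0‖ ≤ s1.realVar 52) ∧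
      ∀ c, 0 ≤ c → (∀ i' < i, ‖vecAt d (s.realArr A) (i' * d) - vecAt d (s.realArr B) 0‖ ≤ c) →
        s1.realVar 52 ≤ c) (fun _ => 25 * d + 20) (by simp [h0])
    rfl rfl rfl (by simp) ?_ ?_
  · rintro i hi s1 hf h80 - ⟨h81, h3, h4⟩
    have a1 : s1.natVar 1 = d := by rw [hf.nat 1 rfl]; simp [h1]
    have a86 : s1.natVar 86 = 0 := by rw [hf.nat 86 rfl]; simp
    have a46 : s1.realVar 46 = 1 := by rw [hf.real 46 rfl]; simp
    have a47 : s1.realVar 47 = -1 := by rw [hf.real 47 rfl]; simp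
    have aA : s1.realArr A = s.realArr A := by
      rw [hf.realArr A]
      · simp
      · simp [rowLin, rowDot, RealRAM.forN, RealRAM.block, Prog.any, Instr.writesRealArr, hA]
    have aB : s1.realArr B = s.realArr B := by
      rw [hf.realArr B]
      · simp
      · simp [rowLin, rowDot, RealRAM.forN, RealRAM.block, Prog.any, Instr.writesRealArr, hB]
    refine Tri.andThen (rowLin_spec a1 (fun h => absurd h hA) (fun h => absurd h hB)
      (by norm_num) (by norm_num) (by norm_num)) ?_
    rintro k2 s2 f2 ⟨hk2, e1, -⟩
    rw [h81, a86, a46, a47, aA, aB] at e1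
    have b1 : s2.natVar 1 = d := by rw [f2.nat 1 rfl, a1]
    have b86 : s2.natVar 86 = 0 := by rw [f2.nat 86 rfl, a86]
    refine Tri.andThen (rowDot_spec b1 (by norm_num) (by norm_num)) ?_
    rintro k3 s3 f3 ⟨hk3, e45⟩
    have c1 : s3.natVar 1 = d := by rw [f3.nat 1 rfl, b1]
    have c81 : s3.natVar 81 = i * d := by rw [f3.nat 81 rfl, f2.nat 81 rfl, h81]
    have c52 : s3.realVar 52 = s1.realVar 52 := by rw [f3.real 52 rfl, f2.real 52 rfl]
    rw [b86, e1, one_smul, neg_one_smul, ← sub_eq_add_neg, real_inner_self_eq_norm_sq] at e45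
    set D := ‖vecAt d (s.realArr A) (i * d) - vecAt d (s.realArr B) 0‖ with hD
    have hsq : √(D ^ 2) = D := Real.sqrt_sq (norm_nonneg _)
    refine Tri.block_seq (Tri.ite ?_ ?_)
    · intro h
      simp [e45, hsq, c52] at h
      refine Tri.block ⟨by simp; omega, by simp [c81, c1]; ring, ?_, ?_⟩
      · intro i' hi'
        simp [e45, hsq]
        rcases Nat.lt_succ_iff_lt_or_eq.1 hi' with hi' | rfl
        · exact (h3 i' hi').trans h.le
        · exact hD.ge
      · intro c _ hc
        simp [e45, hsq]
        exact hc i (Nat.lt_succ_self i)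
    · intro h
      simp [e45, hsq, c52] at h
      refine Tri.skip ⟨by simp; omega, by simp [c81, c1]; ring, ?_, ?_⟩
      · intro i' hi'
        simp [c52]
        rcases Nat.lt_succ_iff_lt_or_eq.1 hi' with hi' | rfl
        · exact h3 i' hi'
        · exact h
      · intro c hc0 hc
        simp [c52]
        exact h4 c hc0 fun i' hi' => hc i' (Nat.lt_succ_of_lt hi')
  · rintro k s' hf - hk ⟨-, h3, h4⟩
    refine ⟨?_, h3, h4⟩
    simp at hk ⊢
    nlinarith

end RealRAM

/-! ### The passes of one iteration: gradient, points, center. -/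

namespace SIB

/-- The weight of the block `X` in the gradient of `∑ i, 2 * cosh (η * ‖X i‖) / η`. -/
def gradWeight {d : ℕ} (η : ℝ) (X : EuclideanSpace ℝ (Fin d)) : ℝ :=
  (Real.exp (η * ‖X‖) - 1 / Real.exp (η * ‖X‖)) / ‖X‖

variable {n d : ℕ} {m : Fin n → ℕ}

/-- A measure of the size of the input. -/
def inputSize (V : ∀ i, Matrix (Fin d) (Fin (m i)) ℝ) : ℕ :=
  ∑ i ∈ Finset.range n, (blockNz V i + blockCols m i + d + 1)

theorem le_inputSize (V : ∀ i, Matrix (Fin d) (Fin (m i)) ℝ) : n * d + n ≤ inputSize V := by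
  have : ∑ i ∈ Finset.range n, (d + 1) ≤ inputSize V :=
    Finset.sum_le_sum fun i _ => by omega
  simpa [mul_add] using this

end SIB

namespace RealRAM

open SIB

/-- Whether a program leaves the input untouched. -/
def Prog.keepsInput (P : Prog) : Bool :=
  !(P.any (Instr.writesNat 0) || P.any (Instr.writesNat 1) || P.any (Instr.writesNatArr 0) ||
    P.any (Instr.writesNatArr 1) || P.any (Instr.writesNatArr 2) ||
    P.any (Instr.writesRealArr 0) || P.any (Instr.writesRealArr 1))

section

variable {n d : ℕ} {m : Fin n → ℕ} {V : ∀ i, Matrix (Fin d) (Fin (m i)) ℝ} {ν : Fin n → ℝ}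
  {s s' : Store}

theorem _root_.SIB.HasInput.frame {P : Prog} (h : HasInput V ν s) (f : Frame P s s')
    (hP : P.keepsInput = true) : HasInput V ν s' := by
  simp only [Prog.keepsInput, Bool.not_eq_true', Bool.or_eq_false_iff] at hP
  obtain ⟨⟨⟨⟨⟨⟨h0, h1⟩, h2⟩, h3⟩, h4⟩, h5⟩, h6⟩ := hP
  refine ⟨(f.nat 0 h0).trans h.rows, (f.nat 1 h1).trans h.dim, ?_, ?_, ?_⟩
  · rw [f.natArr 0 h2]; exact h.cols
  · rw [f.realArr 1 h6]; exact h.cap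
  · rw [f.natArr 1 h3, f.natArr 2 h4, f.realArr 0 h5]; exact h.block

/-- A straight-line program that only writes scratch memory. -/
theorem _root_.SIB.HasInput.exec (h : HasInput V ν s) {l : List Instr}
    (hP : (RealRAM.block l).keepsInput = true) : HasInput V ν (l.foldl Instr.exec s) := by
  obtain ⟨k, s', hr, rfl⟩ : Tri (RealRAM.block l) s fun _ s' => s' = l.foldl Instr.exec s :=
    Tri.block rfl
  exact h.frame hr.frame hP

end

/-- The gradient pass: row `i` of the array `4` becomes the weighted difference of row `i` of the
array `12` and the row of the array `13`, and row `84` becomes minus the sum of these. -/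
def gradient : Prog :=
  .seq (block [.natConst 81 0, .natConst 86 0, .realConst 46 0, .realConst 47 0,
      .realConst 48 1, .realSub 49 46 48])
    (.seq (rowLin 4 84 4 84 4 84)
      (forN 80 0 (.seq (block [.realCopy 46 48, .realCopy 47 49])
        (.seq (rowLin 14 86 12 81 13 86) (.seq (rowDot 14 86 14 86)
          (.seq (block [.realSqrt 45 45, .realMul 50 53 45, .realExp 50 50, .realDiv 51 48 50,
              .realSub 50 50 51, .realDiv 46 50 45, .realConst 47 0])
            (.seq (rowLin 4 81 14 86 14 86)
              (.seq (block [.realSub 47 47 46, .realCopy 46 48])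
                (.seq (rowLin 4 84 4 84 14 86) (block [.natAdd 81 81 1]))))))))))

/-- Row `n`, at position `n * d` in variable `84`, collects the direction for the center. The
division by `‖X i‖` needs no guard: at `X i = 0` the quotient multiplies the zero vector. -/
theorem gradient_spec {n d : ℕ} {s : Store} (h0 : s.natVar 0 = n) (h1 : s.natVar 1 = d)
    (h84 : s.natVar 84 = n * d) {X : ℕ → EuclideanSpace ℝ (Fin d)}
    (hX : ∀ i, X i = vecAt d (s.realArr 12) (i * d) - vecAt d (s.realArr 13) 0) :
    Tri gradient s fun k s' => k ≤ 60 * (n * d + n + d) + 30 ∧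
      (∀ i < n, vecAt d (s'.realArr 4) (i * d) = gradWeight (s.realVar 53) (X i) • X i) ∧
      vecAt d (s'.realArr 4) (n * d) =
        -∑ i ∈ Finset.range n, gradWeight (s.realVar 53) (X i) • X i := by
  refine Tri.block_seq ?_
  refine Tri.andThen (rowLin_spec (d := d) (by simp [h1]) (fun _ => rfl) (fun _ => rfl)
    (by norm_num) (by norm_num) (by norm_num)) ?_
  rintro k0 t f0 ⟨hk0, e0, -⟩
  simp [h84] at e0
  refine Tri.forN n (fun i s1 => s1.natVar 81 = i * d ∧
      (∀ i' < i, vecAt d (s1.realArr 4) (i' * d) = gradWeight (s.realVar 53) (X i') • X i') ∧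
      vecAt d (s1.realArr 4) (n * d) =
        -∑ i' ∈ Finset.range i, gradWeight (s.realVar 53) (X i') • X i')
      (fun _ => 53 * d + 40) (by rw [f0.nat 0 rfl]; simp [h0]) rfl rfl rfl ?_ ?_ ?_
  · simp [e0]; rw [f0.nat 81 rfl]; simp
  · rintro i hi s1 hf h80 - ⟨h81, h2, h3⟩
    have a1 : s1.natVar 1 = d := by rw [hf.nat 1 rfl, f0.nat 1 rfl]; simp [h1]
    have a84 : s1.natVar 84 = n * d := by rw [hf.nat 84 rfl, f0.nat 84 rfl]; simp [h84]
    have a86 : s1.natVar 86 = 0 := by rw [hf.nat 86 rfl, f0.nat 86 rfl]; simp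
    have a48 : s1.realVar 48 = 1 := by rw [hf.real 48 rfl, f0.real 48 rfl]; simp
    have a49 : s1.realVar 49 = -1 := by rw [hf.real 49 rfl, f0.real 49 rfl]; simp
    have a53 : s1.realVar 53 = s.realVar 53 := by rw [hf.real 53 rfl, f0.real 53 rfl]; simp
    have a12 : s1.realArr 12 = s.realArr 12 := by rw [hf.realArr 12 rfl, f0.realArr 12 rfl]; simp
    have a13 : s1.realArr 13 = s.realArr 13 := by rw [hf.realArr 13 rfl, f0.realArr 13 rfl]; simp
    refine Tri.block_seq ?_
    refine Tri.andThen (rowLin_spec (d := d) (by simp [a1]) (by simp) (by simp)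
      (by norm_num) (by norm_num) (by norm_num)) ?_
    rintro k2 s2 f2 ⟨hk2, e2, -⟩
    simp [h81, a86, a48, a49, a12, a13] at e2
    rw [← sub_eq_add_neg, ← hX] at e2
    have b1 : s2.natVar 1 = d := by rw [f2.nat 1 rfl]; simp [a1]
    have b86 : s2.natVar 86 = 0 := by rw [f2.nat 86 rfl]; simp [a86]
    refine Tri.andThen (rowDot_spec b1 (by norm_num) (by norm_num)) ?_
    rintro k3 s3 f3 ⟨hk3, e3⟩
    rw [b86, e2, real_inner_self_eq_norm_sq] at e3
    have c1 : s3.natVar 1 = d := by rw [f3.nat 1 rfl, b1]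
    have c86 : s3.natVar 86 = 0 := by rw [f3.nat 86 rfl, b86]
    have c81 : s3.natVar 81 = i * d := by rw [f3.nat 81 rfl, f2.nat 81 rfl]; simp [h81]
    have c84 : s3.natVar 84 = n * d := by rw [f3.nat 84 rfl, f2.nat 84 rfl]; simp [a84]
    have c48 : s3.realVar 48 = 1 := by rw [f3.real 48 rfl, f2.real 48 rfl]; simp [a48]
    have c53 : s3.realVar 53 = s.realVar 53 := by
      rw [f3.real 53 rfl, f2.real 53 rfl]; simp [a53]
    have c14 : s3.realArr 14 = s2.realArr 14 := f3.realArr 14 rfl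
    have c4 : s3.realArr 4 = s1.realArr 4 := by
      rw [f3.realArr 4 rfl, f2.realArr 4 rfl]; simp
    have hsq : √(‖X i‖ ^ 2) = ‖X i‖ := Real.sqrt_sq (norm_nonneg _)
    refine Tri.block_seq ?_
    refine Tri.andThen (rowLin_spec (d := d) (by simp [c1]) (by simp) (by simp)
      (by norm_num) (by norm_num) (by norm_num)) ?_
    rintro k4 s4 f4 ⟨hk4, e4, p4⟩
    simp [c81, c86, e3, hsq, c53, c48, c14, c4, e2] at e4 p4
    have ew : gradWeight (s.realVar 53) (X i) =
        (Real.exp (s.realVar 53 * ‖X i‖) - (Real.exp (s.realVar 53 * ‖X i‖))⁻¹) / ‖X i‖ := by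
      rw [gradWeight, one_div]
    rw [← ew] at e4
    have d1 : s4.natVar 1 = d := by rw [f4.nat 1 rfl]; simp [c1]
    have d81 : s4.natVar 81 = i * d := by rw [f4.nat 81 rfl]; simp [c81]
    have d84 : s4.natVar 84 = n * d := by rw [f4.nat 84 rfl]; simp [c84]
    have d86 : s4.natVar 86 = 0 := by rw [f4.nat 86 rfl]; simp [c86]
    have d46 : s4.realVar 46 = gradWeight (s.realVar 53) (X i) := by
      rw [f4.real 46 rfl]; simp [e3, hsq, c53, c48, ew]
    have d47 : s4.realVar 47 = 0 := by rw [f4.real 47 rfl]; simp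
    have d48 : s4.realVar 48 = 1 := by rw [f4.real 48 rfl]; simp [c48]
    have d14 : vecAt d (s4.realArr 14) 0 = X i := by
      rw [f4.realArr 14 rfl]; simp [c14, e2]
    refine Tri.block_seq ?_
    refine Tri.andThen (rowLin_spec (d := d) (by simp [d1]) (by simp) (by simp)
      (by norm_num) (by norm_num) (by norm_num)) ?_
    rintro k5 s5 f5 ⟨hk5, e5, p5⟩
    simp [d84, d86, d46, d47, d48, d14] at e5 p5
    have hrow : ∀ i' < n, vecAt d (s5.realArr 4) (i' * d) = vecAt d (s4.realArr 4) (i' * d) := by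
      intro i' hi'
      refine vecAt_congr fun k hk => p5 _ (Or.inl ?_)
      have : (i' + 1) * d ≤ n * d := Nat.mul_le_mul_right d hi'
      rw [add_mul, one_mul] at this
      omega
    refine Tri.block ⟨by simp; omega, ?_, ?_, ?_⟩
    · simp; rw [f5.nat 81 rfl, f5.nat 1 rfl]; simp [d81, d1]; ring
    · intro i' hi'
      simp
      rw [hrow i' (by omega)]
      rcases Nat.lt_succ_iff_lt_or_eq.1 hi' with hi' | rfl
      · rw [← h2 i' hi']
        refine vecAt_congr fun k hk => p4 _ (Or.inl ?_)
        have : (i' + 1) * d ≤ i * d := Nat.mul_le_mul_right d hi'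
        rw [add_mul, one_mul] at this
        omega
      · exact e4
    · simp
      rw [e5, Finset.sum_range_succ, neg_add, ← h3]
      congr 1
      refine vecAt_congr fun k hk => p4 _ (Or.inr ?_)
      have : (i + 1) * d ≤ n * d := Nat.mul_le_mul_right d hi
      rw [add_mul, one_mul] at this
      omega
  · rintro k s' hf - hk ⟨-, h2, h3⟩
    refine ⟨?_, h2, h3⟩
    simp at hk ⊢
    nlinarith

/-- The linear oracle for block `80` and the direction at position `off` of the array `4`. -/
def oracleAt (off : ℕ) : Prog :=
  .seq (block [.natRead 60 0 80, .realRead 30 1 80, .natCopy 72 off]) blockOracle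

section

variable {n d : ℕ} {m : Fin n → ℕ} {V : ∀ i, Matrix (Fin d) (Fin (m i)) ℝ} {ν : Fin n → ℝ}

theorem oracleAt_spec {off : ℕ} {s : Store} (hoff : off ≠ 60) (hm : ∀ i, 0 < m i)
    (hν : ∀ i, ν i ∈ Set.Icc (1 / (m i : ℝ)) 1) (hI : HasInput V ν s) (i : Fin n)
    (h80 : s.natVar 80 = i) (h70 : s.natVar 70 = colStart m i)
    (h71 : s.natVar 71 = nzStart V i) :
    Tri (oracleAt off) s fun k s' => k ≤ 160000 * (blockNz V i + blockCols m i + d) + 4 ∧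
      s'.natVar 70 = colStart m (i + 1) ∧ s'.natVar 71 = nzStart V (i + 1) ∧
      vecAt d (s'.realArr 7) 0 ∈ reducedPolytope (V i) (ν i) ∧
      ∀ w ∈ reducedPolytope (V i) (ν i),
        inner ℝ (vecAt d (s.realArr 4) (s.natVar off)) (vecAt d (s'.realArr 7) 0) ≤
          inner ℝ (vecAt d (s.realArr 4) (s.natVar off)) w := by
  have e1 : blockNz V i = nzOff (V i) (m i) := by simp [blockNz]
  have e2 : blockCols m i = m i := by simp [blockCols]
  refine Tri.block_seq ((blockOracle_spec (V := V i) (ν := ν i) (c := colStart m i)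
    (e := nzStart V i) (yo := s.natVar off) (hm i) (hν i) ?_ ?_ ?_ ?_ ?_ ?_ ?_).mono ?_)
  · simpa using hI.block i
  · simp [hI.dim]
  · simp [h80, hI.cols]
  · simp [h80, hI.cap]
  · simp [h70]
  · simp [h71]
  · simp [hoff]
  · rintro k s' - ⟨hk, h1, h2, h3, h4⟩
    refine ⟨?_, ?_, ?_, h3, ?_⟩
    · simp [e1, e2]; omega
    · rw [h1, colStart, colStart, Finset.sum_range_succ, e2]
    · rw [h2, nzStart, nzStart, Finset.sum_range_succ, e1]
    · simpa using h4

/-- For every block, the minimizer for the direction in its row of the array `4` is put into its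
row of the array `8`. -/
def pointsPass : Prog :=
  .seq (block [.natConst 70 0, .natConst 71 0, .natConst 81 0, .natConst 86 0])
    (forN 80 0 (.seq (oracleAt 81) (.seq (block [.realConst 46 1, .realConst 47 0])
      (.seq (rowLin 8 81 7 86 7 86) (block [.natAdd 81 81 1])))))

theorem pointsPass_spec {s : Store} (hm : ∀ i, 0 < m i)
    (hν : ∀ i, ν i ∈ Set.Icc (1 / (m i : ℝ)) 1) (hI : HasInput V ν s) :
    Tri pointsPass s fun k s' => k ≤ 170000 * inputSize V + 20 ∧
      ∀ i : Fin n, vecAt d (s'.realArr 8) (i * d) ∈ reducedPolytope (V i) (ν i) ∧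
        ∀ w ∈ reducedPolytope (V i) (ν i),
          inner ℝ (vecAt d (s.realArr 4) (i * d)) (vecAt d (s'.realArr 8) (i * d)) ≤
            inner ℝ (vecAt d (s.realArr 4) (i * d)) w := by
  refine Tri.block_seq ?_
  refine Tri.forN n (fun i s1 => s1.natVar 81 = i * d ∧ s1.natVar 70 = colStart m i ∧
      s1.natVar 71 = nzStart V i ∧ ∀ i' : Fin n, (i' : ℕ) < i →
      vecAt d (s1.realArr 8) (i' * d) ∈ reducedPolytope (V i') (ν i') ∧
        ∀ w ∈ reducedPolytope (V i') (ν i'),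
          inner ℝ (vecAt d (s.realArr 4) (i' * d)) (vecAt d (s1.realArr 8) (i' * d)) ≤
            inner ℝ (vecAt d (s.realArr 4) (i' * d)) w)
    (fun i => 160000 * (blockNz V i + blockCols m i + d) + 14 * d + 20)
    (by simp [hI.rows]) rfl rfl rfl ?_ ?_ ?_
  · simp [colStart, nzStart]
  · rintro i hi s1 hf h80 - ⟨h81, h70, h71, h2⟩
    have aI : HasInput V ν s1 := (hI.exec rfl).frame hf rfl
    have a4 : s1.realArr 4 = s.realArr 4 := by rw [hf.realArr 4 rfl]; simp
    have a86 : s1.natVar 86 = 0 := by rw [hf.nat 86 rfl]; simp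
    refine Tri.andThen (oracleAt_spec (by norm_num) hm hν aI ⟨i, hi⟩ h80 h70 h71) ?_
    rintro k2 s2 f2 ⟨hk2, b70, b71, hmem, hmin⟩
    have b1 : s2.natVar 1 = d := by rw [f2.nat 1 rfl, aI.dim]
    have b81 : s2.natVar 81 = i * d := by rw [f2.nat 81 rfl, h81]
    have b86 : s2.natVar 86 = 0 := by rw [f2.nat 86 rfl, a86]
    have b8 : s2.realArr 8 = s1.realArr 8 := f2.realArr 8 rfl
    rw [h81, a4] at hmin
    refine Tri.block_seq ?_
    refine Tri.andThen (rowLin_spec (d := d) (by simp [b1]) (by simp) (by simp)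
      (by norm_num) (by norm_num) (by norm_num)) ?_
    rintro k3 s3 f3 ⟨hk3, e3, p3⟩
    simp [b81, b86, b8] at e3 p3
    have c81 : s3.natVar 81 = i * d := by rw [f3.nat 81 rfl]; simp [b81]
    have c1 : s3.natVar 1 = d := by rw [f3.nat 1 rfl]; simp [b1]
    have c70 : s3.natVar 70 = colStart m (i + 1) := by rw [f3.nat 70 rfl]; simp [b70]
    have c71 : s3.natVar 71 = nzStart V (i + 1) := by rw [f3.nat 71 rfl]; simp [b71]
    refine Tri.block ⟨?_, ?_, by simp [c70], by simp [c71], ?_⟩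
    · simp at hk2 ⊢; omega
    · simp [c81, c1]; ring
    · intro i' hi'
      rcases Nat.lt_succ_iff_lt_or_eq.1 hi' with hi' | hi'
      · have e : vecAt d (s3.realArr 8) (i' * d) = vecAt d (s1.realArr 8) (i' * d) := by
          refine vecAt_congr fun k hk => p3 _ (Or.inl ?_)
          have : ((i' : ℕ) + 1) * d ≤ i * d := Nat.mul_le_mul_right d hi'
          rw [add_mul, one_mul] at this
          omega
        simp only [List.foldl, Instr.exec, Store.setNat_realArr, e]
        exact h2 i' hi'
      · obtain rfl : i' = ⟨i, hi⟩ := Fin.ext hi'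
        simp only [List.foldl, Instr.exec, Store.setNat_realArr, e3]
        exact ⟨hmem, hmin⟩
  · rintro k s' hf - hk ⟨-, -, -, h2⟩
    refine ⟨?_, fun i => h2 i i.2⟩
    have e : ∑ i ∈ Finset.range n,
        (160000 * (blockNz V i + blockCols m i + d) + 14 * d + 20 + 4) ≤
        ∑ i ∈ Finset.range n, 170000 * (blockNz V i + blockCols m i + d + 1) :=
      Finset.sum_le_sum fun i _ => by omega
    rw [← Finset.mul_sum] at e
    simp only [inputSize, List.length_cons, List.length_nil] at e ⊢
    omega

/-- The minimizer over the union of the blocks, for the direction at position `84` of the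
array `4`, is put into the array `9`. -/
def centerPass : Prog :=
  .seq (block [.natConst 70 0, .natConst 71 0, .natConst 86 0, .realConst 46 1,
      .realConst 47 0])
    (.seq (rowLin 9 86 8 86 8 86)
      (forN 80 0 (.seq (oracleAt 84) (.seq (rowDot 4 84 7 86) (.seq (block [.realCopy 51 45])
        (.seq (rowDot 4 84 9 86)
          (.ite (.realLt 51 45)
            (.seq (block [.realConst 46 1, .realConst 47 0]) (rowLin 9 86 7 86 7 86))
            .skip)))))))

/-- A linear functional on the hull of the union is minimized on one of the pieces, so it suffices
to keep the best block minimizer. Starting from the first point of the array `8` makes the candidate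
a member of some polytope from the outset. -/
theorem centerPass_spec {s : Store} (hm : ∀ i, 0 < m i)
    (hν : ∀ i, ν i ∈ Set.Icc (1 / (m i : ℝ)) 1) (hI : HasInput V ν s)
    (h84 : s.natVar 84 = n * d)
    (h8 : ∃ i, vecAt d (s.realArr 8) 0 ∈ reducedPolytope (V i) (ν i)) :
    Tri centerPass s fun k s' => k ≤ 170000 * inputSize V + 14 * d + 20 ∧
      (∃ i, vecAt d (s'.realArr 9) 0 ∈ reducedPolytope (V i) (ν i)) ∧
      ∀ i, ∀ w ∈ reducedPolytope (V i) (ν i),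
          inner ℝ (vecAt d (s.realArr 4) (n * d)) (vecAt d (s'.realArr 9) 0) ≤
            inner ℝ (vecAt d (s.realArr 4) (n * d)) w := by
  refine Tri.block_seq ?_
  refine Tri.andThen (rowLin_spec (d := d) (by simp [hI.dim]) (by simp) (by simp)
      (by norm_num) (by norm_num) (by norm_num)) ?_
  rintro k0 t f0 ⟨hk0, e0, -⟩
  simp at e0
  have tI : HasInput V ν t := (hI.exec rfl).frame f0 rfl
  refine Tri.forN n (fun i s1 => s1.natVar 70 = colStart m i ∧ s1.natVar 71 = nzStart V i ∧
      (∃ i, vecAt d (s1.realArr 9) 0 ∈ reducedPolytope (V i) (ν i)) ∧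
      ∀ i' : Fin n, (i' : ℕ) < i → ∀ w ∈ reducedPolytope (V i') (ν i'),
          inner ℝ (vecAt d (s.realArr 4) (n * d)) (vecAt d (s1.realArr 9) 0) ≤
            inner ℝ (vecAt d (s.realArr 4) (n * d)) w)
    (fun i => 160000 * (blockNz V i + blockCols m i + d) + 36 * d + 30)
    tI.rows rfl rfl rfl ?_ ?_ ?_
  · simp [colStart, nzStart, e0, h8]
    constructor
    · rw [f0.nat 70 rfl]; simp
    · rw [f0.nat 71 rfl]; simp
  · rintro i hi s1 hf h80 - ⟨h70, h71, h9, h2⟩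
    have aI : HasInput V ν s1 := tI.frame hf rfl
    have a4 : s1.realArr 4 = s.realArr 4 := by rw [hf.realArr 4 rfl, f0.realArr 4 rfl]; simp
    have a84 : s1.natVar 84 = n * d := by rw [hf.nat 84 rfl, f0.nat 84 rfl]; simp [h84]
    have a86 : s1.natVar 86 = 0 := by rw [hf.nat 86 rfl, f0.nat 86 rfl]; simp
    refine Tri.andThen (oracleAt_spec (by norm_num) hm hν aI ⟨i, hi⟩ h80 h70 h71) ?_
    rintro k2 s2 f2 ⟨hk2, b70, b71, hmem, hmin⟩
    rw [a84, a4] at hmin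
    have b1 : s2.natVar 1 = d := by rw [f2.nat 1 rfl, aI.dim]
    have b84 : s2.natVar 84 = n * d := by rw [f2.nat 84 rfl, a84]
    have b86 : s2.natVar 86 = 0 := by rw [f2.nat 86 rfl, a86]
    have b4 : s2.realArr 4 = s.realArr 4 := by rw [f2.realArr 4 rfl, a4]
    have b9 : s2.realArr 9 = s1.realArr 9 := f2.realArr 9 rfl
    refine Tri.andThen (rowDot_spec b1 (by norm_num) (by norm_num)) ?_
    rintro k3 s3 f3 ⟨hk3, e3⟩
    rw [b4, b84, b86] at e3
    have c1 : s3.natVar 1 = d := by rw [f3.nat 1 rfl, b1]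
    refine Tri.block_seq ?_
    refine Tri.andThen (rowDot_spec (d := d) (by simp [c1]) (by norm_num) (by norm_num)) ?_
    rintro k4 s4 f4 ⟨hk4, e4⟩
    simp at e4
    rw [f3.realArr 4 rfl, f3.realArr 9 rfl, f3.nat 84 rfl, f3.nat 86 rfl, b4, b9, b84, b86] at e4
    have d51 : s4.realVar 51 = s3.realVar 45 := by rw [f4.real 51 rfl]; simp
    have d70 : s4.natVar 70 = colStart m (i + 1) := by
      rw [f4.nat 70 rfl]; simp; rw [f3.nat 70 rfl, b70]
    have d71 : s4.natVar 71 = nzStart V (i + 1) := by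
      rw [f4.nat 71 rfl]; simp; rw [f3.nat 71 rfl, b71]
    have d1 : s4.natVar 1 = d := by rw [f4.nat 1 rfl]; simp [c1]
    have d86 : s4.natVar 86 = 0 := by
      rw [f4.nat 86 rfl]; simp; rw [f3.nat 86 rfl, b86]
    have d7 : s4.realArr 7 = s2.realArr 7 := by
      rw [f4.realArr 7 rfl]; simp; rw [f3.realArr 7 rfl]
    have d9 : s4.realArr 9 = s1.realArr 9 := by
      rw [f4.realArr 9 rfl]; simp; rw [f3.realArr 9 rfl, b9]
    refine Tri.ite ?_ ?_
    · intro h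
      simp [d51, e3, e4] at h
      refine Tri.block_seq ((rowLin_spec (d := d) (by simp [d1]) (by simp) (by simp)
        (by norm_num) (by norm_num) (by norm_num)).mono ?_)
      rintro k5 s5 f5 ⟨hk5, e5, -⟩
      simp [d86, d7] at e5
      refine ⟨?_, ?_, ?_, ?_, ?_⟩
      · simp at hk2 ⊢; omega
      · simp; rw [f5.nat 70 rfl]; simp [d70]
      · simp; rw [f5.nat 71 rfl]; simp [d71]
      · refine ⟨⟨i, hi⟩, ?_⟩
        simpa [e5] using hmem
      · intro i' hi' w hw
        simp only [Store.setNat_realArr, e5]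
        rcases Nat.lt_succ_iff_lt_or_eq.1 hi' with hi' | hi'
        · exact h.le.trans (h2 i' hi' w hw)
        · obtain rfl : i' = ⟨i, hi⟩ := Fin.ext hi'
          exact hmin w hw
    · intro h
      simp [d51, e3, e4] at h
      refine Tri.skip ⟨?_, ?_, ?_, ?_, ?_⟩
      · simp at hk2 ⊢; omega
      · simp [d70]
      · simp [d71]
      · simpa [d9] using h9
      · intro i' hi' w hw
        simp only [Store.setNat_realArr, d9]
        rcases Nat.lt_succ_iff_lt_or_eq.1 hi' with hi' | hi'
        · exact h2 i' hi' w hw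
        · obtain rfl : i' = ⟨i, hi⟩ := Fin.ext hi'
          exact h.trans (hmin w hw)
  · rintro k s' hf - hk ⟨-, -, h9, h2⟩
    refine ⟨?_, h9, fun i => h2 i i.2⟩
    have e : ∑ i ∈ Finset.range n,
        (160000 * (blockNz V i + blockCols m i + d) + 36 * d + 30 + 4) ≤
        ∑ i ∈ Finset.range n, 170000 * (blockNz V i + blockCols m i + d + 1) :=
      Finset.sum_le_sum fun i _ => by omega
    rw [← Finset.mul_sum] at e
    simp only [inputSize, List.length_cons, List.length_nil] at e ⊢
    omega

end

end RealRAM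

/-! ### The `cosh` potential. -/

namespace SIB

section Cosh

variable {E : Type*} [NormedAddCommGroup E] [InnerProductSpace ℝ E]

/-- Convexity of `u ↦ cosh √u`, for a chord between squares. -/
theorem cosh_le_of_sq_eq {a b c p q : ℝ} (hp : 0 ≤ p) (hq : 0 ≤ q) (hpq : p + q = 1)
    (h : c ^ 2 = p * a ^ 2 + q * b ^ 2) :
    Real.cosh c ≤ p * Real.cosh a + q * Real.cosh b := by
  -- `cosh` is a power series in the square of its argument with nonnegative coefficients, and `u ↦
  -- u ^ k` is convex on `[0, ∞)`; compare term by term.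
  refine hasSum_le (fun k => ?_) (Real.hasSum_cosh c)
    (((Real.hasSum_cosh a).mul_left p).add ((Real.hasSum_cosh b).mul_left q))
  have := (convexOn_pow (𝕜 := ℝ) k).2 (Set.mem_Ici.2 (sq_nonneg a)) (Set.mem_Ici.2 (sq_nonneg b))
    hp hq hpq
  simp only [smul_eq_mul] at this
  rw [← h, ← pow_mul, ← pow_mul, ← pow_mul] at this
  rw [← mul_div_assoc, ← mul_div_assoc, ← add_div]
  gcongr

/-- Write `a`, `b` for the norms and `θ` for the cosine of the angle. Convexity between `(a + b)²`
and `(a - b)²` gives `cosh a cosh b + θ sinh a sinh b`. The linear term is `θ b sinh a`; the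
remainder is at most `cosh a (cosh b + sinh b - b) = cosh a (exp b - b)`, and `exp b ≤ 1 + b + b²`
for `b ≤ 1`. -/
theorem cosh_norm_add_le (X S : E) (hS : ‖S‖ ≤ 1) :
    Real.cosh ‖X + S‖ ≤ Real.cosh ‖X‖ * (1 + ‖S‖ ^ 2) +
      Real.sinh ‖X‖ / ‖X‖ * inner ℝ X S := by
  have hb0 := norm_nonneg S
  have hexp : Real.cosh ‖S‖ + Real.sinh ‖S‖ - ‖S‖ ≤ 1 + ‖S‖ ^ 2 := by
    rw [Real.cosh_add_sinh]
    have := Real.abs_exp_sub_one_sub_id_le (x := ‖S‖) (by rwa [abs_of_nonneg hb0])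
    linarith [(abs_le.1 this).2]
  have hsb : ‖S‖ ≤ Real.sinh ‖S‖ := Real.self_le_sinh_iff.2 hb0
  rcases eq_or_ne X 0 with rfl | hX
  · simp; linarith
  rcases eq_or_ne S 0 with rfl | hS0
  · simp
  have ha : 0 < ‖X‖ := norm_pos_iff.2 hX
  have hb : 0 < ‖S‖ := norm_pos_iff.2 hS0
  set a := ‖X‖
  set b := ‖S‖
  set c := inner ℝ X S with hc
  have hcab : |c| ≤ a * b := abs_real_inner_le_norm X S
  have hab : 0 < a * b := mul_pos ha hb
  set θ := c / (a * b) with hθ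
  have hθ' : c = a * b * θ := by rw [hθ]; field_simp
  have hθ1 : |θ| ≤ 1 := by
    rw [hθ, abs_div, abs_of_pos hab, div_le_one hab]; exact hcab
  have h1 := (abs_le.1 hθ1).1
  have h2 := (abs_le.1 hθ1).2
  -- The law of cosines, read as a convex combination of the two collinear cases.
  have hsq : ‖X + S‖ ^ 2 = (1 + θ) / 2 * (a + b) ^ 2 + (1 - θ) / 2 * (a - b) ^ 2 := by
    rw [norm_add_sq_real, ← hc, hθ']; ring
  have key := cosh_le_of_sq_eq (by linarith) (by linarith) (by ring) hsq
  rw [Real.cosh_add, Real.cosh_sub] at key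
  have hsa : 0 ≤ Real.sinh a := Real.sinh_nonneg_iff.2 ha.le
  have hsc : Real.sinh a ≤ Real.cosh a := (Real.sinh_lt_cosh a).le
  have hca : 0 < Real.cosh a := Real.cosh_pos a
  have e : Real.sinh a / a * c = Real.sinh a * b * θ := by
    rw [hθ']; field_simp
  rw [e]
  have h3 : Real.sinh a * (Real.sinh b - b) * θ ≤ Real.cosh a * (Real.sinh b - b) := by
    have h4 : 0 ≤ Real.sinh b - b := by linarith
    calc Real.sinh a * (Real.sinh b - b) * θ ≤ Real.sinh a * (Real.sinh b - b) * 1 := by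
          gcongr
      _ ≤ _ := by rw [mul_one]; gcongr
  nlinarith [mul_le_mul_of_nonneg_left hexp hca.le]

theorem cosh_mul_norm_add_le {η : ℝ} (hη : 0 < η) (X S : E) (hS : η * ‖S‖ ≤ 1) :
    Real.cosh (η * ‖X + S‖) ≤ Real.cosh (η * ‖X‖) * (1 + (η * ‖S‖) ^ 2) +
      η * (Real.sinh (η * ‖X‖) / ‖X‖ * inner ℝ X S) := by
  have h := cosh_norm_add_le (η • X) (η • S)
  rw [← smul_add, norm_smul, norm_smul, norm_smul, Real.norm_of_nonneg hη.le,
    inner_smul_left, inner_smul_right] at h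
  refine (h hS).trans_eq ?_
  congr 1
  rcases eq_or_ne X 0 with rfl | hX
  · simp
  have : ‖X‖ ≠ 0 := norm_ne_zero_iff.2 hX
  simp
  field_simp

end Cosh

/-! ### Growth of the potential during a phase. -/

section Phase

variable {n d : ℕ} {Ω : Fin n → Set (EuclideanSpace ℝ (Fin d))}

theorem gradWeight_eq (η : ℝ) (X : EuclideanSpace ℝ (Fin d)) :
    gradWeight η X = 2 * (Real.sinh (η * ‖X‖) / ‖X‖) := by
  rw [gradWeight, Real.sinh_eq, Real.exp_neg, one_div]; ring

/-- A feasible center can be moved into the convex hull of the points. -/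
theorem exists_mem_convexHull_norm_sub_le (hn : 0 < n) (z : EuclideanSpace ℝ (Fin d))
    (v : Fin n → EuclideanSpace ℝ (Fin d)) :
    ∃ p ∈ convexHull ℝ (Set.range v), ∀ i, ‖p - v i‖ ≤ ‖z - v i‖ := by
  have hne : (convexHull ℝ (Set.range v)).Nonempty :=
    ⟨v ⟨0, hn⟩, subset_convexHull ℝ _ ⟨_, rfl⟩⟩
  have hc : IsCompact (convexHull ℝ (Set.range v)) := (Set.finite_range v).isCompact_convexHull ℝ
  obtain ⟨p, hp, hpz⟩ := exists_norm_eq_iInf_of_complete_convex hne hc.isComplete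
    (convex_convexHull ℝ _) z
  have hin := (norm_eq_iInf_iff_real_inner_le_zero (convex_convexHull ℝ _) hp).1 hpz
  refine ⟨p, hp, fun i => ?_⟩
  have h := hin (v i) (subset_convexHull ℝ _ ⟨i, rfl⟩)
  have e : ‖z - v i‖ ^ 2 = ‖z - p‖ ^ 2 - 2 * inner ℝ (z - p) (v i - p) + ‖p - v i‖ ^ 2 := by
    rw [← norm_sub_rev (v i) p, ← norm_sub_sq_real]
    congr 2
    abel
  refine le_of_sq_le_sq ?_ (norm_nonneg _)
  nlinarith [sq_nonneg ‖z - p‖]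

/-- The answer of the oracles is at least as good as any feasible solution. -/
theorem sum_inner_le_of_feasible (hn : 0 < n) {Y v : Fin n → EuclideanSpace ℝ (Fin d)}
    {z : EuclideanSpace ℝ (Fin d)}
    (hv : ∀ i, ∀ w ∈ Ω i, inner ℝ (Y i) (v i) ≤ inner ℝ (Y i) w)
    (hz : ∀ i, ∀ w ∈ Ω i, inner ℝ (-∑ i, Y i) z ≤ inner ℝ (-∑ i, Y i) w)
    {z' : EuclideanSpace ℝ (Fin d)} {v' : Fin n → EuclideanSpace ℝ (Fin d)} {r : ℝ}
    (hf : Feasible Ω z' v' r) :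
    ∑ i, inner ℝ (Y i) (v i - z) ≤ r * ∑ i, ‖Y i‖ := by
  -- The center oracle is only known to beat points of the `Ω i`, hence of their hull; the arbitrary
  -- center `z'` is replaced by a point `p` of that hull.
  obtain ⟨p, hp, hpv⟩ := exists_mem_convexHull_norm_sub_le hn z' v'
  have hzp : inner ℝ (-∑ i, Y i) z ≤ inner ℝ (-∑ i, Y i) p := by
    have hconv : Convex ℝ {x | inner ℝ (-∑ i, Y i) z ≤ inner ℝ (-∑ i, Y i) x} :=
      convex_halfSpace_ge (f := fun x => inner ℝ (-∑ i, Y i) x)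
        ⟨fun x y => inner_add_right _ x y, fun c x => inner_smul_right _ x c⟩ _
    refine convexHull_min ?_ hconv hp
    rintro _ ⟨i, rfl⟩
    exact hz i _ (hf i).2
  have e : ∀ (u : Fin n → EuclideanSpace ℝ (Fin d)) (x : EuclideanSpace ℝ (Fin d)),
      ∑ i, inner ℝ (Y i) (u i - x) = ∑ i, inner ℝ (Y i) (u i) + inner ℝ (-∑ i, Y i) x := by
    intro u x
    simp only [inner_sub_right, Finset.sum_sub_distrib, inner_neg_left, sum_inner]
    ring
  calc ∑ i, inner ℝ (Y i) (v i - z) ≤ ∑ i, inner ℝ (Y i) (v' i - p) := by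
        rw [e, e]
        exact add_le_add (Finset.sum_le_sum fun i _ => hv i _ (hf i).2) hzp
    _ ≤ ∑ i, r * ‖Y i‖ := by
        refine Finset.sum_le_sum fun i _ => (real_inner_le_norm _ _).trans ?_
        rw [mul_comm, norm_sub_rev]
        exact mul_le_mul_of_nonneg_right ((hpv i).trans (hf i).1) (norm_nonneg _)
    _ = _ := by rw [Finset.mul_sum]

/-- The invariant of a phase of the algorithm after `t` iterations. -/
structure Phase (Ω : Fin n → Set (EuclideanSpace ℝ (Fin d))) (η ρ : ℝ) (t : ℕ)
    (Vs : Fin n → EuclideanSpace ℝ (Fin d)) (Zs : EuclideanSpace ℝ (Fin d)) : Prop where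
  points : ∀ i, ∃ u ∈ Ω i, Vs i = (t : ℝ) • u
  -- Quantifying over all feasible radii avoids showing that the infimum `r*` is attained; the
  -- infimum is taken only after the phase.
  potential : ∀ z v r, Feasible Ω z v r →
    ∑ i, Real.cosh (η * ‖Vs i - Zs‖) ≤ n * Real.exp (t * ((η * ρ) ^ 2 + η * r))

theorem Phase.zero (hne : ∀ i, (Ω i).Nonempty) (η ρ : ℝ) : Phase Ω η ρ 0 0 0 := by
  refine ⟨fun i => ?_, fun z v r _ => by simp⟩
  obtain ⟨u, hu⟩ := hne i
  exact ⟨u, hu, by simp⟩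

variable {η ρ : ℝ} {t : ℕ} {Vs : Fin n → EuclideanSpace ℝ (Fin d)}
  {Zs : EuclideanSpace ℝ (Fin d)}

theorem Feasible.nonneg (hn : 0 < n) {z : EuclideanSpace ℝ (Fin d)}
    {v : Fin n → EuclideanSpace ℝ (Fin d)} {r : ℝ} (h : Feasible Ω z v r) : 0 ≤ r :=
  (norm_nonneg _).trans (h ⟨0, hn⟩).1

/-- Summing the second-order bound over the blocks, the quadratic terms give `(η ρ)² Φ`. The
gradient pieces have norm at most `2 cosh`, so by `sum_inner_le_of_feasible` the linear term is at
most `η / 2 * r * 2 Φ`. Hence `Φ` grows by at most the factor `1 + (η ρ)² + η r ≤ exp ((η ρ)² + η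
r)`. -/
theorem Phase.step (h : Phase Ω η ρ t Vs Zs) (hn : 0 < n) (hc : ∀ i, Convex ℝ (Ω i))
    (hη : 0 < η) (hηρ : η * ρ ≤ 1) {v : Fin n → EuclideanSpace ℝ (Fin d)}
    {z : EuclideanSpace ℝ (Fin d)} (hvΩ : ∀ i, v i ∈ Ω i)
    (hv : ∀ i, ∀ w ∈ Ω i, inner ℝ (gradWeight η (Vs i - Zs) • (Vs i - Zs)) (v i) ≤
      inner ℝ (gradWeight η (Vs i - Zs) • (Vs i - Zs)) w)
    (hz : ∀ i, ∀ w ∈ Ω i, inner ℝ (-∑ i, gradWeight η (Vs i - Zs) • (Vs i - Zs)) z ≤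
      inner ℝ (-∑ i, gradWeight η (Vs i - Zs) • (Vs i - Zs)) w)
    (hρ : ∀ i, ‖v i - z‖ ≤ ρ) :
    Phase Ω η ρ (t + 1) (fun i => Vs i + v i) (Zs + z) := by
  constructor
  · intro i
    obtain ⟨u, hu, hu'⟩ := h.points i
    have ht : (0 : ℝ) < (t : ℝ) + 1 := by positivity
    refine ⟨((t : ℝ) / (t + 1)) • u + (1 / ((t : ℝ) + 1)) • v i,
      hc i hu (hvΩ i) (by positivity) (by positivity) (by field_simp), ?_⟩
    rw [hu', smul_add, smul_smul, smul_smul]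
    push_cast
    rw [mul_div_cancel₀ _ ht.ne', mul_one_div_cancel ht.ne', one_smul]
  · intro z' v' r hf
    have hr := hf.nonneg hn
    set X := fun i => Vs i - Zs with hX
    have hρ0 : 0 ≤ ρ := (norm_nonneg _).trans (hρ ⟨0, hn⟩)
    have hsum := sum_inner_le_of_feasible hn hv hz hf
    set Φ := ∑ i, Real.cosh (η * ‖X i‖) with hΦ
    have hstep : ∀ i, Real.cosh (η * ‖Vs i + v i - (Zs + z)‖) ≤
        Real.cosh (η * ‖X i‖) * (1 + (η * ρ) ^ 2) +
          η / 2 * inner ℝ (gradWeight η (X i) • X i) (v i - z) := by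
      intro i
      have e : Vs i + v i - (Zs + z) = X i + (v i - z) := by simp only [hX]; abel
      have hs : η * ‖v i - z‖ ≤ η * ρ := mul_le_mul_of_nonneg_left (hρ i) hη.le
      rw [e]
      refine (cosh_mul_norm_add_le hη (X i) (v i - z) (hs.trans hηρ)).trans ?_
      refine add_le_add ?_ (le_of_eq ?_)
      · have := Real.cosh_pos (η * ‖X i‖)
        gcongr
      · rw [inner_smul_left, gradWeight_eq]
        simp
        ring
    have hY : ∀ i, ‖gradWeight η (X i) • X i‖ ≤ 2 * Real.cosh (η * ‖X i‖) := by
      intro i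
      have h0 : 0 ≤ Real.sinh (η * ‖X i‖) := Real.sinh_nonneg_iff.2 (by positivity)
      have h1 : Real.sinh (η * ‖X i‖) ≤ Real.cosh (η * ‖X i‖) := (Real.sinh_lt_cosh _).le
      rw [norm_smul, gradWeight_eq, Real.norm_of_nonneg (by positivity)]
      rcases eq_or_ne (X i) 0 with hx | hx
      · simp [hx]
      · have : ‖X i‖ ≠ 0 := norm_ne_zero_iff.2 hx
        rw [mul_assoc, div_mul_cancel₀ _ this]
        linarith
    have hYs : ∑ i, ‖gradWeight η (X i) • X i‖ ≤ 2 * Φ := by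
      rw [hΦ, Finset.mul_sum]
      exact Finset.sum_le_sum fun i _ => hY i
    have hpot : Φ ≤ n * Real.exp (t * ((η * ρ) ^ 2 + η * r)) := h.potential z' v' r hf
    have hΦ0 : 0 ≤ Φ := Finset.sum_nonneg fun i _ => (Real.cosh_pos _).le
    calc ∑ i, Real.cosh (η * ‖Vs i + v i - (Zs + z)‖)
        ≤ ∑ i, (Real.cosh (η * ‖X i‖) * (1 + (η * ρ) ^ 2) +
          η / 2 * inner ℝ (gradWeight η (X i) • X i) (v i - z)) :=
          Finset.sum_le_sum fun i _ => hstep i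
      _ = Φ * (1 + (η * ρ) ^ 2) +
          η / 2 * ∑ i, inner ℝ (gradWeight η (X i) • X i) (v i - z) := by
          rw [Finset.sum_add_distrib, ← Finset.sum_mul, ← Finset.mul_sum]
      _ ≤ Φ * (1 + (η * ρ) ^ 2) + η / 2 * (r * (2 * Φ)) := by
          gcongr
          exact hsum.trans (mul_le_mul_of_nonneg_left hYs hr)
      _ = Φ * (((η * ρ) ^ 2 + η * r) + 1) := by ring
      _ ≤ (n * Real.exp (t * ((η * ρ) ^ 2 + η * r))) * Real.exp ((η * ρ) ^ 2 + η * r) := by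
          gcongr
          exact Real.add_one_le_exp _
      _ = n * Real.exp (((t + 1 : ℕ) : ℝ) * ((η * ρ) ^ 2 + η * r)) := by
          rw [mul_assoc, ← Real.exp_add]
          congr 2
          push_cast
          ring

/-- A single summand is at most `Φ`, and `exp x ≤ 2 cosh x`, so `η a ≤ L + t ((η ρ)² + η r)` for the
distance `a`. The choice `η = δ / ρ²` makes `(η ρ)² = η δ`, and the length of the phase makes `L ≤ η
t δ`: each of the two errors costs one `δ` per iteration. -/
theorem Phase.norm_le (h : Phase Ω η ρ t Vs Zs) {δ L : ℝ} (hδ : 0 < δ)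
    (hρ : 0 < ρ) (hη : η = δ / ρ ^ 2) (hL : 2 * (n : ℝ) ≤ Real.exp L) (ht0 : 0 < t)
    (ht : L * ρ ^ 2 / δ ^ 2 ≤ t) {z : EuclideanSpace ℝ (Fin d)}
    {v : Fin n → EuclideanSpace ℝ (Fin d)} {r : ℝ} (hf : Feasible Ω z v r) (i : Fin n) :
    ‖Vs i - Zs‖ ≤ t * (r + 2 * δ) := by
  have hη0 : 0 < η := by rw [hη]; positivity
  have h1 := h.potential z v r hf
  set a := ‖Vs i - Zs‖ with ha
  have h2 : Real.cosh (η * a) ≤ ∑ i, Real.cosh (η * ‖Vs i - Zs‖) :=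
    Finset.single_le_sum (f := fun i => Real.cosh (η * ‖Vs i - Zs‖))
      (fun i _ => (Real.cosh_pos _).le) (Finset.mem_univ i)
  have h3 : Real.exp (η * a) / 2 ≤ Real.cosh (η * a) := by
    rw [Real.cosh_eq]
    have := Real.exp_pos (-(η * a))
    linarith
  have h4 : Real.exp (η * a) ≤ Real.exp (L + t * ((η * ρ) ^ 2 + η * r)) := by
    rw [Real.exp_add]
    have h5 := Real.exp_pos (t * ((η * ρ) ^ 2 + η * r))
    nlinarith
  have h6 := Real.exp_le_exp.1 h4
  have ht' : (0 : ℝ) < t := Nat.cast_pos.2 ht0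
  have h7 : L ≤ η * (t * δ) := by
    rw [hη]
    rw [div_le_iff₀ (by positivity)] at ht
    have e : δ / ρ ^ 2 * (t * δ) = t * δ ^ 2 / ρ ^ 2 := by ring
    rw [e, le_div_iff₀ (by positivity)]
    exact ht
  have h8 : (η * ρ) ^ 2 = η * δ := by
    rw [hη]
    field_simp
  rw [h8] at h6
  have h9 : η * a ≤ η * (t * (r + 2 * δ)) := by nlinarith
  exact le_of_mul_le_mul_left h9 hη0

end Phase

end SIB

/-! ### Compactness of reduced polytopes; the optimal radius. -/

namespace SIB

section Polytope

variable {d m : ℕ} (V : Matrix (Fin d) (Fin m) ℝ) (ν : ℝ)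

theorem convex_cappedSimplex : Convex ℝ (cappedSimplex m ν) := by
  intro b hb c hc p q hp hq hpq
  refine ⟨convex_stdSimplex ℝ _ hb.1 hc.1 hp hq hpq, fun j => ?_⟩
  have h1 := mul_le_mul_of_nonneg_left (hb.2 j) hp
  have h2 := mul_le_mul_of_nonneg_left (hc.2 j) hq
  have h3 : p * ν + q * ν = ν := by rw [← add_mul, hpq, one_mul]
  simp only [Pi.add_apply, Pi.smul_apply, smul_eq_mul]
  linarith

theorem isCompact_cappedSimplex : IsCompact (cappedSimplex m ν) := by
  have h : cappedSimplex m ν = stdSimplex ℝ (Fin m) ∩ ⋂ j, {b | b j ≤ ν} := by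
    ext b; simp [cappedSimplex]
  rw [h]
  exact (isCompact_stdSimplex ℝ (Fin m)).inter_right
    (isClosed_iInter fun j => isClosed_le (continuous_apply j) continuous_const)

variable {ν} in
theorem cappedSimplex_nonempty (hm : 0 < m) (hν : ν ∈ Set.Icc (1 / (m : ℝ)) 1) :
    (cappedSimplex m ν).Nonempty := by
  have hm' : (m : ℝ) ≠ 0 := Nat.cast_ne_zero.2 hm.ne'
  refine ⟨fun _ => 1 / (m : ℝ), ⟨fun j => by positivity, ?_⟩, fun j => hν.1⟩
  simp [hm']

/-- The linear map with matrix `V`, into Euclidean space. -/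
def toEuclideanMap : (Fin m → ℝ) →ₗ[ℝ] EuclideanSpace ℝ (Fin d) :=
  (WithLp.linearEquiv 2 ℝ (Fin d → ℝ)).symm.toLinearMap ∘ₗ V.mulVecLin

theorem reducedPolytope_eq_image :
    reducedPolytope V ν = toEuclideanMap V '' cappedSimplex m ν := by
  ext u
  constructor
  · rintro ⟨b, hb, rfl⟩
    exact ⟨b, hb, rfl⟩
  · rintro ⟨b, hb, rfl⟩
    exact ⟨b, hb, rfl⟩

theorem convex_reducedPolytope : Convex ℝ (reducedPolytope V ν) := by
  rw [reducedPolytope_eq_image]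
  exact (convex_cappedSimplex ν).linear_image _

theorem isCompact_reducedPolytope : IsCompact (reducedPolytope V ν) := by
  rw [reducedPolytope_eq_image]
  exact (isCompact_cappedSimplex ν).image (LinearMap.continuous_of_finiteDimensional _)

variable {ν} in
theorem reducedPolytope_nonempty (hm : 0 < m) (hν : ν ∈ Set.Icc (1 / (m : ℝ)) 1) :
    (reducedPolytope V ν).Nonempty := by
  rw [reducedPolytope_eq_image]
  exact (cappedSimplex_nonempty hm hν).image _

end Polytope

section Radius

variable {n d : ℕ} {Ω : Fin n → Set (EuclideanSpace ℝ (Fin d))}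

theorem optRadius_le (hn : 0 < n) {z : EuclideanSpace ℝ (Fin d)}
    {v : Fin n → EuclideanSpace ℝ (Fin d)} {r : ℝ} (h : Feasible Ω z v r) : optRadius Ω ≤ r :=
  csInf_le ⟨0, by rintro r ⟨z, v, h⟩; exact h.nonneg hn⟩ ⟨z, v, h⟩

theorem exists_feasible (hne : ∀ i, (Ω i).Nonempty) :
    ∃ z v r, Feasible Ω z v r := by
  choose v hv using hne
  refine ⟨0, v, ∑ i, ‖0 - v i‖, fun i => ⟨?_, hv i⟩⟩
  exact Finset.single_le_sum (f := fun i => ‖0 - v i‖) (fun i _ => norm_nonneg _)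
    (Finset.mem_univ i)

theorem le_optRadius (hne : ∀ i, (Ω i).Nonempty) {c : ℝ}
    (h : ∀ z v r, Feasible Ω z v r → c ≤ r) : c ≤ optRadius Ω := by
  obtain ⟨z, v, r, hf⟩ := exists_feasible hne
  exact le_csInf ⟨r, z, v, hf⟩ (by rintro r ⟨z, v, hf⟩; exact h z v r hf)

/-- On the compact first set, the sum of the distances to all the sets has a minimum `c`, positive
since no point is common to all. In a feasible tuple of radius `r`, the first point is within `2 r`
of every set, so `c ≤ 2 n r`. -/
theorem optRadius_pos (hn : 0 < n) (hne : ∀ i, (Ω i).Nonempty) (hc : ∀ i, IsCompact (Ω i))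
    (hempty : (⋂ i, Ω i) = ∅) : 0 < optRadius Ω := by
  set i0 : Fin n := ⟨0, hn⟩
  have hcont : Continuous fun u => ∑ i, Metric.infDist u (Ω i) :=
    continuous_finsetSum _ fun i _ => Metric.continuous_infDist_pt _
  obtain ⟨u0, hu0, hmin⟩ := (hc i0).exists_isMinOn (hne i0) hcont.continuousOn
  set c := ∑ i, Metric.infDist u0 (Ω i) with hcdef
  have hcpos : 0 < c := by
    refine lt_of_le_of_ne (Finset.sum_nonneg fun i _ => Metric.infDist_nonneg) fun h => ?_
    have h0 := (Finset.sum_eq_zero_iff_of_nonneg fun i _ => Metric.infDist_nonneg).1 h.symm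
    have : u0 ∈ ⋂ i, Ω i := Set.mem_iInter.2 fun i =>
      ((hc i).isClosed.mem_iff_infDist_zero (hne i)).2 (h0 i (Finset.mem_univ i))
    rw [hempty] at this
    exact this
  have hn' : (0 : ℝ) < n := Nat.cast_pos.2 hn
  refine lt_of_lt_of_le (b := c / (n * 2)) (by positivity) (le_optRadius hne ?_)
  intro z v r hf
  rw [div_le_iff₀ (by positivity)]
  have h1 : c ≤ ∑ i, Metric.infDist (v i0) (Ω i) := hmin (hf i0).2
  have h2 : ∑ i, Metric.infDist (v i0) (Ω i) ≤ ∑ _i : Fin n, 2 * r := by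
    refine Finset.sum_le_sum fun i _ => (Metric.infDist_le_dist_of_mem (hf i).2).trans ?_
    have h3 := dist_triangle_left (v i0) (v i) z
    rw [dist_eq_norm z, dist_eq_norm z] at h3
    linarith [(hf i0).1, (hf i).1]
  have h3 : ∑ _i : Fin n, 2 * r = r * (n * 2) := by simp; ring
  linarith

theorem norm_sub_le_inputDiam (hc : ∀ i, IsCompact (Ω i)) {i j : Fin n}
    {u w : EuclideanSpace ℝ (Fin d)} (hu : u ∈ Ω i) (hw : w ∈ Ω j) :
    ‖u - w‖ ≤ inputDiam Ω := by
  rw [← dist_eq_norm]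
  refine Metric.dist_le_diam_of_mem ?_ (subset_convexHull ℝ _ (Set.mem_iUnion.2 ⟨i, hu⟩))
    (subset_convexHull ℝ _ (Set.mem_iUnion.2 ⟨j, hw⟩))
  exact (isBounded_convexHull.2 (isCompact_iUnion hc).isBounded)

theorem optRadius_le_inputDiam (hn : 0 < n) (hne : ∀ i, (Ω i).Nonempty)
    (hc : ∀ i, IsCompact (Ω i)) : optRadius Ω ≤ inputDiam Ω := by
  choose v hv using hne
  exact optRadius_le hn (z := v ⟨0, hn⟩) (v := v) fun i =>
    ⟨norm_sub_le_inputDiam hc (hv _) (hv i), hv i⟩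

/-- The radius found at the end of a phase. -/
theorem Phase.le_optRadius {η ρ : ℝ} {t : ℕ} {Vs : Fin n → EuclideanSpace ℝ (Fin d)}
    {Zs : EuclideanSpace ℝ (Fin d)} (h : Phase Ω η ρ t Vs Zs)
    (hne : ∀ i, (Ω i).Nonempty) {δ L : ℝ} (hδ : 0 < δ)
    (hρ : 0 < ρ) (hη : η = δ / ρ ^ 2) (hL : 2 * (n : ℝ) ≤ Real.exp L) (ht0 : 0 < t)
    (ht : L * ρ ^ 2 / δ ^ 2 ≤ t) (i : Fin n) :
    ‖Vs i - Zs‖ ≤ t * (optRadius Ω + 2 * δ) := by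
  have ht' : (0 : ℝ) < t := Nat.cast_pos.2 ht0
  rw [mul_comm, ← div_le_iff₀ ht', ← sub_le_iff_le_add]
  refine SIB.le_optRadius hne fun z v r hf => ?_
  rw [sub_le_iff_le_add, div_le_iff₀ ht', mul_comm]
  exact h.norm_le hδ hρ hη hL ht0 ht hf i

/-- Averaging gives a feasible solution. -/
theorem Phase.feasible {η ρ : ℝ} {t : ℕ} {Vs : Fin n → EuclideanSpace ℝ (Fin d)}
    {Zs : EuclideanSpace ℝ (Fin d)} (h : Phase Ω η ρ t Vs Zs) (ht0 : 0 < t) {U : ℝ}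
    (hU : ∀ i, ‖Vs i - Zs‖ ≤ U) :
    Feasible Ω ((1 / (t : ℝ)) • Zs) (fun i => (1 / (t : ℝ)) • Vs i) (U / t) := by
  have ht' : (0 : ℝ) < t := Nat.cast_pos.2 ht0
  refine fun i => ⟨?_, ?_⟩
  · rw [← smul_sub, norm_smul, norm_sub_rev, Real.norm_of_nonneg (by positivity), one_div,
      inv_mul_eq_div]
    exact div_le_div_of_nonneg_right (hU i) ht'.le
  · obtain ⟨u, hu, e⟩ := h.points i
    change (1 / (t : ℝ)) • Vs i ∈ Ω i
    rw [e, smul_smul, one_div, inv_mul_cancel₀ ht'.ne', one_smul]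
    exact hu

end Radius

end SIB

/-! ### The approximation program and its components. -/

namespace RealRAM

open SIB

/-- The oracle calls of one iteration. The points are put into the array `8`, the center into the
array `9`, the maximal distance into the real variable `52`. -/
def iterate : Prog := .seq gradient (.seq pointsPass (.seq centerPass (maxDist 8 9)))

/-- Starts a new phase. -/
def reset : Prog :=
  .seq (block [.realConst 46 0, .realConst 47 0])
    (.seq (allRows 12 12 12)
      (.seq (block [.natConst 86 0])
        (.seq (rowLin 13 86 13 86 13 86)
          (block [.realConst 55 0, .realMul 60 54 54, .realDiv 53 56 60, .realMul 61 58 60,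
            .realMul 62 56 56, .realDiv 57 61 62]))))

/-- Adds the answers of the oracles to the sums. -/
def accumulate : Prog :=
  .seq (block [.natConst 86 0, .realConst 46 1, .realConst 47 1, .realConst 59 1,
      .realAdd 55 55 59])
    (.seq (allRows 12 12 8) (rowLin 13 86 13 86 9 86))

/-- Writes the output. -/
def output : Prog :=
  .seq (block [.realConst 59 1, .realDiv 46 59 55, .realConst 47 0, .natConst 86 0])
    (.seq (allRows 3 12 12)
      (.seq (rowLin 2 86 13 86 13 86) (block [.realCopy 0 52, .natConst 87 0])))

/-- Ends a phase: the algorithm stops or proceeds to a smaller accuracy. -/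
def finish : Prog :=
  .seq (maxDist 12 13)
    (.seq (block [.realDiv 52 52 55, .realConst 59 1, .realAdd 60 59 0, .realAdd 61 56 56,
        .realMul 60 61 60, .realMul 61 0 52])
      (.ite (.realLe 60 61) output
        (.seq (block [.realConst 59 2, .realDiv 56 56 59]) reset)))

/-- The body of the main loop. -/
def mainStep : Prog :=
  .seq iterate
    (.ite (.realLt 54 52) (.seq (block [.realAdd 54 52 52]) reset)
      (.seq accumulate (.ite (.realLe 57 55) finish .skip)))

/-- The least integer `L ≥ 1` with `exp L ≥ 2 n`, in the real variable `58`. -/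
def logBound : Prog :=
  .seq (block [.realOfNat 60 0, .realAdd 60 60 60, .realConst 58 1, .realConst 59 1,
      .realExp 61 58])
    (.loop (.realLt 61 60) (block [.realAdd 58 58 59, .realExp 61 58]))

/-- The product of the integer variables `0` and `1`, in the integer variable `84`. -/
def gridSize : Prog :=
  .seq (block [.natConst 84 0]) (forN 80 0 (block [.natAdd 84 84 1]))

/-- The approximation algorithm. -/
def mainProg : Prog :=
  .seq (block [.natConst 87 1, .natConst 88 0])
    (.seq logBound
      (.seq gridSize
        (.seq iterate
          (.seq (block [.realCopy 54 52, .realCopy 56 52])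
            (.seq reset (.loop (.natLt 88 87) mainStep))))))

section

variable {n d : ℕ} {m : Fin n → ℕ} {V : ∀ i, Matrix (Fin d) (Fin (m i)) ℝ} {ν : Fin n → ℝ}

/-- The rows of the array `a`, as vectors. -/
def rows (n d : ℕ) (s : Store) (a : ℕ) (i : Fin n) : EuclideanSpace ℝ (Fin d) :=
  vecAt d (s.realArr a) (i * d)

/-- The vector at the start of the array `a`. -/
def row0 (d : ℕ) (s : Store) (a : ℕ) : EuclideanSpace ℝ (Fin d) := vecAt d (s.realArr a) 0

theorem iterate_spec {s : Store} (hn : 0 < n) (hm : ∀ i, 0 < m i)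
    (hν : ∀ i, ν i ∈ Set.Icc (1 / (m i : ℝ)) 1) (hI : HasInput V ν s)
    (h84 : s.natVar 84 = n * d) {X : Fin n → EuclideanSpace ℝ (Fin d)}
    (hX : X = fun i => rows n d s 12 i - row0 d s 13) :
    Tri iterate s fun k s' => k ≤ 341000 * inputSize V + 100 ∧
      (∀ i, rows n d s' 8 i ∈ reducedPolytope (V i) (ν i)) ∧
      (∃ i, row0 d s' 9 ∈ reducedPolytope (V i) (ν i)) ∧
      (∀ i, ∀ w ∈ reducedPolytope (V i) (ν i),
        inner ℝ (gradWeight (s.realVar 53) (X i) • X i) (rows n d s' 8 i) ≤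
          inner ℝ (gradWeight (s.realVar 53) (X i) • X i) w) ∧
      (∀ i, ∀ w ∈ reducedPolytope (V i) (ν i),
        inner ℝ (-∑ i, gradWeight (s.realVar 53) (X i) • X i) (row0 d s' 9) ≤
          inner ℝ (-∑ i, gradWeight (s.realVar 53) (X i) • X i) w) ∧
      (∀ i, ‖rows n d s' 8 i - row0 d s' 9‖ ≤ s'.realVar 52) ∧
      ∀ c, 0 ≤ c → (∀ i, ‖rows n d s' 8 i - row0 d s' 9‖ ≤ c) → s'.realVar 52 ≤ c := by
  have hW := le_inputSize V
  have hdW : d ≤ inputSize V := (Nat.le_mul_of_pos_left d hn).trans (by omega)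
  refine Tri.andThen (gradient_spec hI.rows hI.dim h84
    (X := fun i => vecAt d (s.realArr 12) (i * d) - vecAt d (s.realArr 13) 0) fun _ => rfl) ?_
  rintro k1 s1 f1 ⟨hk1, hY, hg⟩
  have I1 : HasInput V ν s1 := hI.frame f1 rfl
  refine Tri.andThen (pointsPass_spec hm hν I1) ?_
  rintro k2 s2 f2 ⟨hk2, h8⟩
  have I2 : HasInput V ν s2 := I1.frame f2 rfl
  have a4 : s2.realArr 4 = s1.realArr 4 := f2.realArr 4 rfl
  refine Tri.andThen (centerPass_spec hm hν I2
    (by rw [f2.nat 84 rfl, f1.nat 84 rfl, h84]) ⟨⟨0, hn⟩, ?_⟩) ?_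
  · simpa using (h8 ⟨0, hn⟩).1
  rintro k3 s3 f3 ⟨hk3, h9, hz⟩
  have I3 : HasInput V ν s3 := I2.frame f3 rfl
  have b8 : s3.realArr 8 = s2.realArr 8 := f3.realArr 8 rfl
  refine (maxDist_spec I3.rows I3.dim (by norm_num) (by norm_num)).mono ?_
  rintro k4 s4 f4 ⟨hk4, hM1, hM2⟩
  have e8 : ∀ i, rows n d s4 8 i = vecAt d (s2.realArr 8) (i * d) := fun i => by
    rw [rows, f4.realArr 8 rfl, b8]
  have e9 : row0 d s4 9 = vecAt d (s3.realArr 9) 0 := by rw [row0, f4.realArr 9 rfl]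
  rw [a4, hg, ← Fin.sum_univ_eq_sum_range (fun i => gradWeight (s.realVar 53)
    (vecAt d (s.realArr 12) (i * d) - vecAt d (s.realArr 13) 0) •
      (vecAt d (s.realArr 12) (i * d) - vecAt d (s.realArr 13) 0))] at hz
  rw [b8] at hM1 hM2
  subst hX
  refine ⟨by omega, fun i => ?_, ?_, fun i w hw => ?_, ?_, fun i => ?_, fun c hc h => ?_⟩
  · rw [e8]; exact (h8 i).1
  · rw [e9]; exact h9
  · rw [e8]
    have := (h8 i).2 w hw
    rwa [hY i i.2] at this
  · rw [e9]; exact hz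
  · rw [e8, e9]; exact hM1 i i.2
  · refine hM2 c hc fun i hi => ?_
    have := h ⟨i, hi⟩
    rwa [e8, e9] at this

/-- Real variables of the algorithm: `53` is `η`, `54` the width `ρ`, `55` the count `t` within the
phase, `56` the accuracy `δ`, `57` the planned length `L ρ² / δ²`, `58` is `L`, and `0` holds `ε`
until the output. The arrays `12` and `13` hold the sums of points and centers. -/
theorem reset_spec {s : Store} (hI : HasInput V ν s) :
    Tri reset s fun k s' => k ≤ 14 * (n * d) + 20 * n + 14 * d + 30 ∧
      rows n d s' 12 = 0 ∧ row0 d s' 13 = 0 ∧ s'.realVar 55 = 0 ∧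
      s'.realVar 53 = s.realVar 56 / s.realVar 54 ^ 2 ∧
      s'.realVar 57 = s.realVar 58 * s.realVar 54 ^ 2 / s.realVar 56 ^ 2 := by
  refine Tri.block_seq ?_
  refine Tri.andThen (allRows_spec (n := n) (d := d) (by simp [hI.rows]) (by simp [hI.dim])) ?_
  rintro k1 s1 f1 ⟨hk1, e1⟩
  simp at e1
  have a1 : s1.natVar 1 = d := by rw [f1.nat 1 rfl]; simp [hI.dim]
  have a46 : s1.realVar 46 = 0 := by rw [f1.real 46 rfl]; simp
  have a47 : s1.realVar 47 = 0 := by rw [f1.real 47 rfl]; simp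
  have a54 : s1.realVar 54 = s.realVar 54 := by rw [f1.real 54 rfl]; simp
  have a56 : s1.realVar 56 = s.realVar 56 := by rw [f1.real 56 rfl]; simp
  have a58 : s1.realVar 58 = s.realVar 58 := by rw [f1.real 58 rfl]; simp
  refine Tri.block_seq ?_
  refine Tri.andThen (rowLin_spec (d := d) (by simp [a1]) (by simp) (by simp)
      (by norm_num) (by norm_num) (by norm_num)) ?_
  rintro k2 s2 f2 ⟨hk2, e2, -⟩
  simp [a46, a47] at e2
  have b12 : s2.realArr 12 = s1.realArr 12 := by rw [f2.realArr 12 rfl]; simp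
  have b54 : s2.realVar 54 = s.realVar 54 := by rw [f2.real 54 rfl]; simp [a54]
  have b56 : s2.realVar 56 = s.realVar 56 := by rw [f2.real 56 rfl]; simp [a56]
  have b58 : s2.realVar 58 = s.realVar 58 := by rw [f2.real 58 rfl]; simp [a58]
  refine Tri.block ⟨by simp; omega, ?_, ?_, by simp, ?_, ?_⟩
  · funext i
    simp [rows, b12, e1 i i.2]
  · simp [row0, e2]
  · simp [b54, b56, pow_two]
  · simp [b54, b56, b58, pow_two]

theorem accumulate_spec {s : Store} (hI : HasInput V ν s) :
    Tri accumulate s fun k s' => k ≤ 14 * (n * d) + 20 * n + 14 * d + 30 ∧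
      (rows n d s' 12 = fun i => rows n d s 12 i + rows n d s 8 i) ∧
      row0 d s' 13 = row0 d s 13 + row0 d s 9 ∧ s'.realVar 55 = s.realVar 55 + 1 := by
  refine Tri.block_seq ?_
  refine Tri.andThen (allRows_spec (n := n) (d := d) (by simp [hI.rows]) (by simp [hI.dim])) ?_
  rintro k1 s1 f1 ⟨hk1, e1⟩
  simp at e1
  have a1 : s1.natVar 1 = d := by rw [f1.nat 1 rfl]; simp [hI.dim]
  have a86 : s1.natVar 86 = 0 := by rw [f1.nat 86 rfl]; simp
  have a46 : s1.realVar 46 = 1 := by rw [f1.real 46 rfl]; simp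
  have a47 : s1.realVar 47 = 1 := by rw [f1.real 47 rfl]; simp
  have a55 : s1.realVar 55 = s.realVar 55 + 1 := by rw [f1.real 55 rfl]; simp
  have a9 : s1.realArr 9 = s.realArr 9 := by rw [f1.realArr 9 rfl]; simp
  have a13 : s1.realArr 13 = s.realArr 13 := by rw [f1.realArr 13 rfl]; simp
  refine (rowLin_spec (d := d) a1 (by simp) (by simp)
      (by norm_num) (by norm_num) (by norm_num)).mono ?_
  rintro k2 s2 f2 ⟨hk2, e2, -⟩
  rw [a46, a47, a86, a9, a13, one_smul, one_smul] at e2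
  refine ⟨by simp; omega, ?_, e2, ?_⟩
  · funext i
    rw [rows, f2.realArr 12 rfl, e1 i i.2]
    rfl
  · rw [f2.real 55 rfl, a55]

theorem output_spec {s : Store} (hI : HasInput V ν s) :
    Tri output s fun k s' => k ≤ 14 * (n * d) + 20 * n + 14 * d + 30 ∧
      outputPoints n d s' = (fun i => (1 / s.realVar 55) • rows n d s 12 i) ∧
      outputCenter d s' = (1 / s.realVar 55) • row0 d s 13 ∧
      outputRadius s' = s.realVar 52 ∧ s'.natVar 87 = 0 := by
  refine Tri.block_seq ?_
  refine Tri.andThen (allRows_spec (n := n) (d := d) (by simp [hI.rows]) (by simp [hI.dim])) ?_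
  rintro k1 s1 f1 ⟨hk1, e1⟩
  simp at e1
  have a1 : s1.natVar 1 = d := by rw [f1.nat 1 rfl]; simp [hI.dim]
  have a86 : s1.natVar 86 = 0 := by rw [f1.nat 86 rfl]; simp
  have a46 : s1.realVar 46 = 1 / s.realVar 55 := by rw [f1.real 46 rfl]; simp
  have a47 : s1.realVar 47 = 0 := by rw [f1.real 47 rfl]; simp
  have a52 : s1.realVar 52 = s.realVar 52 := by rw [f1.real 52 rfl]; simp
  have a13 : s1.realArr 13 = s.realArr 13 := by rw [f1.realArr 13 rfl]; simp
  refine Tri.andThen (rowLin_spec (d := d) a1 (by simp) (by simp)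
      (by norm_num) (by norm_num) (by norm_num)) ?_
  rintro k2 s2 f2 ⟨hk2, e2, -⟩
  rw [a46, a47, a86, a13, zero_smul, add_zero] at e2
  refine Tri.block ⟨by simp; omega, ?_, ?_, ?_, by simp⟩
  · funext i
    have : outputPoints n d s2 i = vecAt d (s2.realArr 3) (i * d) := rfl
    simp only [List.foldl, Instr.exec]
    change outputPoints n d s2 i = _
    rw [this, f2.realArr 3 rfl, e1 i i.2, one_div]
    rfl
  · simp only [List.foldl, Instr.exec]
    change outputCenter d s2 = _
    have : outputCenter d s2 = vecAt d (s2.realArr 2) 0 := by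
      ext k; simp [outputCenter]
    rw [this, e2]
    rfl
  · simp [outputRadius]
    rw [f2.real 52 rfl, a52]

/-- There is no logarithm to call, so `L` is raised by `1` until `exp L ≥ 2 n`. An increment happens
only while `exp L < 2 n`, which bounds the result by `log (2 n) + 1`; `exp x ≥ x + 1` bounds the
number of rounds by `2 n`. -/
theorem logBound_spec {s : Store} (h0 : s.natVar 0 = n) (hn : 0 < n) :
    Tri logBound s fun k s' => k ≤ 8 * n + 10 ∧ 1 ≤ s'.realVar 58 ∧
      2 * (n : ℝ) ≤ Real.exp (s'.realVar 58) ∧ s'.realVar 58 ≤ Real.log (2 * n) + 1 := by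
  have hn' : (1 : ℝ) ≤ n := by exact_mod_cast hn
  refine Tri.block_seq ?_
  refine Tri.loop_count (B := 2 * n) (c := 3) (I := fun j s1 => s1.realVar 58 = 1 + j ∧
    s1.realVar 61 = Real.exp (1 + j) ∧ (j : ℝ) ≤ Real.log (2 * n)) ?_ ?_ ?_
  · simp; exact Real.log_nonneg (by linarith)
  · rintro j s1 hf ⟨h58, h61, hj⟩ hc
    have a60 : s1.realVar 60 = 2 * n := by
      rw [hf.real 60 rfl]; simp [h0]; ring
    have a59 : s1.realVar 59 = 1 := by rw [hf.real 59 rfl]; simp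
    simp [a60, h61] at hc
    refine ⟨?_, Tri.block ⟨by simp, ?_, ?_, ?_⟩⟩
    · have := Real.add_one_le_exp (1 + (j : ℝ))
      have h2 : (j : ℝ) < 2 * n := by linarith
      exact_mod_cast h2
    · simp [h58, a59]; ring
    · simp [h58, a59]; ring
    · push_cast
      rw [Real.le_log_iff_exp_le (by linarith)]
      rw [add_comm]
      exact hc.le
  · rintro k s' j hf hk hj ⟨h58, h61, hj'⟩ hc
    have a60 : s'.realVar 60 = 2 * n := by
      rw [hf.real 60 rfl]; simp [h0]; ring
    simp [a60, h61] at hc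
    refine ⟨by simp; omega, ?_, ?_, ?_⟩
    · rw [h58]; have : (0 : ℝ) ≤ j := Nat.cast_nonneg j; linarith
    · rw [h58]; exact hc
    · rw [h58]; linarith

/-- Integers cannot be multiplied on this machine: `d`, held in variable `1`, is added `n` times. -/
theorem gridSize_spec {s : Store} (h0 : s.natVar 0 = n) (h1 : s.natVar 1 = d) :
    Tri gridSize s fun k s' => k ≤ 6 * n + 10 ∧ s'.natVar 84 = n * d := by
  refine Tri.block_seq ?_
  refine Tri.forN n (fun i s1 => s1.natVar 84 = i * d) (fun _ => 2) (by simp [h0]) rfl rfl rfl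
    (by simp) ?_ ?_
  · rintro i hi s1 hf h80 - h84
    have a1 : s1.natVar 1 = d := by rw [hf.nat 1 rfl]; simp [h1]
    exact Tri.block ⟨by simp, by simp [h84, a1]; ring⟩
  · rintro k s' hf - hk h
    exact ⟨by simp at hk ⊢; omega, h⟩

end

end RealRAM

/-! ### Instances and the smallest accuracy that can occur. -/

namespace SIB

variable {n d : ℕ} {m : Fin n → ℕ}

/-- The hypotheses on the input of the approximation algorithm. -/
structure IsInstance (V : ∀ i, Matrix (Fin d) (Fin (m i)) ℝ) (ν : Fin n → ℝ) (ε : ℝ) : Prop where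
  one_lt : 1 < n
  pos : ∀ i, 0 < m i
  cap : ∀ i, ν i ∈ Set.Icc (1 / (m i : ℝ)) 1
  empty : (⋂ i, reducedPolytope (V i) (ν i)) = ∅
  eps : 0 < ε

/-- The family of reduced polytopes of an instance. -/
abbrev polytopes (V : ∀ i, Matrix (Fin d) (Fin (m i)) ℝ) (ν : Fin n → ℝ) :
    Fin n → Set (EuclideanSpace ℝ (Fin d)) := fun i => reducedPolytope (V i) (ν i)

/-- A lower bound for the accuracies used by the algorithm. -/
def minAccuracy (V : ∀ i, Matrix (Fin d) (Fin (m i)) ℝ) (ν : Fin n → ℝ) (ε : ℝ) : ℝ :=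
  min ε 1 * optRadius (polytopes V ν) / 8

namespace IsInstance

variable {V : ∀ i, Matrix (Fin d) (Fin (m i)) ℝ} {ν : Fin n → ℝ} {ε : ℝ}

theorem rows_pos (h : IsInstance V ν ε) : 0 < n := zero_lt_one.trans h.one_lt

theorem nonempty (h : IsInstance V ν ε) (i : Fin n) : (polytopes V ν i).Nonempty :=
  reducedPolytope_nonempty (V i) (h.pos i) (h.cap i)

theorem isCompact (_ : IsInstance V ν ε) (i : Fin n) : IsCompact (polytopes V ν i) :=
  isCompact_reducedPolytope (V i) (ν i)

theorem convex (_ : IsInstance V ν ε) (i : Fin n) : Convex ℝ (polytopes V ν i) :=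
  convex_reducedPolytope (V i) (ν i)

theorem optRadius_pos (h : IsInstance V ν ε) : 0 < optRadius (polytopes V ν) :=
  SIB.optRadius_pos h.rows_pos h.nonempty h.isCompact h.empty

theorem optRadius_le_inputDiam (h : IsInstance V ν ε) :
    optRadius (polytopes V ν) ≤ inputDiam (polytopes V ν) :=
  SIB.optRadius_le_inputDiam h.rows_pos h.nonempty h.isCompact

theorem inputDiam_pos (h : IsInstance V ν ε) : 0 < inputDiam (polytopes V ν) :=
  h.optRadius_pos.trans_le h.optRadius_le_inputDiam

theorem minAccuracy_pos (h : IsInstance V ν ε) : 0 < minAccuracy V ν ε := by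
  have := h.optRadius_pos
  have := lt_min h.eps one_pos
  unfold minAccuracy
  positivity

theorem minAccuracy_le (h : IsInstance V ν ε) :
    minAccuracy V ν ε ≤ optRadius (polytopes V ν) := by
  have h1 := h.optRadius_pos
  have h2 := mul_le_mul_of_nonneg_right (min_le_right ε 1) h1.le
  unfold minAccuracy
  linarith

/-- If the accuracy `δ` is not sufficient, half of it is not too small. -/
theorem minAccuracy_le_half (h : IsInstance V ν ε) {δ : ℝ} (hδ : 0 < δ)
    (hr : ε * optRadius (polytopes V ν) ≤ 2 * δ * (1 + ε)) : minAccuracy V ν ε ≤ δ / 2 := by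
  have h1 := h.optRadius_pos
  have h2 := h.eps
  suffices min ε 1 * optRadius (polytopes V ν) ≤ 4 * δ by unfold minAccuracy; linarith
  -- For `ε ≤ 1` use `1 + ε ≤ 2`; for `ε ≥ 1` use `1 + ε ≤ 2 ε` and cancel `ε`.
  rcases le_total ε 1 with h3 | h3
  · rw [min_eq_left h3]; nlinarith
  · rw [min_eq_right h3, one_mul]
    refine le_of_mul_le_mul_left ?_ h2
    nlinarith

end IsInstance

end SIB

/-! ### The invariant of the main loop. -/

namespace RealRAM

open SIB

variable {n d : ℕ} {m : Fin n → ℕ} {V : ∀ i, Matrix (Fin d) (Fin (m i)) ℝ} {ν : Fin n → ℝ}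
  {ε L : ℝ} {s s' : Store}

/-- The memory contains valid parameters for a phase of the algorithm. -/
structure Ready (V : ∀ i, Matrix (Fin d) (Fin (m i)) ℝ) (ν : Fin n → ℝ) (ε L : ℝ)
    (s : Store) : Prop where
  input : HasInput V ν s
  size : s.natVar 84 = n * d
  go : s.natVar 87 = 1
  zero : s.natVar 88 = 0
  eps : s.realVar 0 = ε
  log : s.realVar 58 = L
  accuracy_le : s.realVar 56 ≤ s.realVar 54
  width_le : s.realVar 54 ≤ 2 * inputDiam (polytopes V ν)
  le_accuracy : minAccuracy V ν ε ≤ s.realVar 56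

/-- Whether a program leaves the parameters of the phase untouched. -/
def Prog.keepsReady (P : Prog) : Bool :=
  P.keepsInput && !(P.any (Instr.writesNat 84) || P.any (Instr.writesNat 87) ||
    P.any (Instr.writesNat 88) || P.any (Instr.writesReal 0) || P.any (Instr.writesReal 58) ||
    P.any (Instr.writesReal 56) || P.any (Instr.writesReal 54))

theorem Ready.frame {P : Prog} (h : Ready V ν ε L s) (f : Frame P s s')
    (hP : P.keepsReady = true) : Ready V ν ε L s' := by
  simp only [Prog.keepsReady, Bool.and_eq_true, Bool.not_eq_true', Bool.or_eq_false_iff] at hP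
  obtain ⟨hI, ⟨⟨⟨⟨⟨h1, h2⟩, h3⟩, h4⟩, h5⟩, h6⟩, h7⟩ := hP
  refine ⟨h.input.frame f hI, (f.nat _ h1).trans h.size, (f.nat _ h2).trans h.go,
    (f.nat _ h3).trans h.zero, (f.real _ h4).trans h.eps, (f.real _ h5).trans h.log, ?_, ?_, ?_⟩
  · rw [f.real _ h6, f.real _ h7]; exact h.accuracy_le
  · rw [f.real _ h7]; exact h.width_le
  · rw [f.real _ h6]; exact h.le_accuracy

/-- The memory is that of a phase of the algorithm, `j` iterations having been done in total. -/
structure Running (V : ∀ i, Matrix (Fin d) (Fin (m i)) ℝ) (ν : Fin n → ℝ) (ε L : ℝ) (j : ℕ)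
    (s : Store) : Prop extends Ready V ν ε L s where
  rate : s.realVar 53 = s.realVar 56 / s.realVar 54 ^ 2
  bound : s.realVar 57 = L * s.realVar 54 ^ 2 / s.realVar 56 ^ 2
  -- Of the `j` iterations so far, `t` belong to the current phase. That all earlier ones number at
  -- most its planned length `s.realVar 57` is the geometric-series bound in inductive form.
  phase : ∃ t : ℕ, s.realVar 55 = t ∧ (t : ℝ) < s.realVar 57 ∧ (j : ℝ) ≤ t + s.realVar 57 ∧
    Phase (polytopes V ν) (s.realVar 53) (s.realVar 54) t (rows n d s 12) (row0 d s 13)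

/-- A third of the number of iterations that the algorithm needs at most. -/
def phaseBound (V : ∀ i, Matrix (Fin d) (Fin (m i)) ℝ) (ν : Fin n → ℝ) (ε L : ℝ) : ℝ :=
  L * (2 * inputDiam (polytopes V ν)) ^ 2 / minAccuracy V ν ε ^ 2

/-- The memory after `j` iterations. -/
def LoopInv (V : ∀ i, Matrix (Fin d) (Fin (m i)) ℝ) (ν : Fin n → ℝ) (ε L : ℝ) (j : ℕ)
    (s : Store) : Prop :=
  s.natVar 88 = 0 ∧ (Running V ν ε L j s ∨
    s.natVar 87 = 0 ∧ (j : ℝ) ≤ 3 * phaseBound V ν ε L ∧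
      IsApproxSolution (polytopes V ν) ε (outputCenter d s) (outputPoints n d s) (outputRadius s))

/-- A planned length of at least `1` absorbs the `+ 1` of the iteration that ends a phase. -/
theorem le_bound {ρ δ : ℝ} (hL : 1 ≤ L) (hδ : 0 < δ) (hρ : δ ≤ ρ) : 1 ≤ L * ρ ^ 2 / δ ^ 2 := by
  rw [le_div_iff₀ (by positivity)]
  have := pow_le_pow_left₀ hδ.le hρ 2
  nlinarith [sq_nonneg ρ]

theorem Ready.bound_le (h : Ready V ν ε L s) (hV : IsInstance V ν ε) (hL : 1 ≤ L) :
    L * s.realVar 54 ^ 2 / s.realVar 56 ^ 2 ≤ phaseBound V ν ε L := by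
  have h1 := hV.minAccuracy_pos
  have h2 := h1.trans_le h.le_accuracy
  have h3 := h.width_le
  have h4 := h.accuracy_le
  have h5 := h.le_accuracy
  unfold phaseBound
  gcongr
  linarith

theorem reset_running (hV : IsInstance V ν ε) (hL : 1 ≤ L) (h : Ready V ν ε L s) {j : ℕ}
    (hj : (j : ℝ) ≤ L * s.realVar 54 ^ 2 / s.realVar 56 ^ 2) :
    Tri reset s fun k s' => k ≤ 34 * inputSize V + 30 ∧ Running V ν ε L j s' := by
  have hW := le_inputSize V
  have hdW : d ≤ n * d := Nat.le_mul_of_pos_left d hV.rows_pos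
  refine (reset_spec h.input).mono ?_
  rintro k s' f ⟨hk, h12, h13, h55, h53, h57⟩
  have e54 : s'.realVar 54 = s.realVar 54 := f.real 54 rfl
  have e56 : s'.realVar 56 = s.realVar 56 := f.real 56 rfl
  refine ⟨by omega, h.frame f rfl, by rw [h53, e54, e56], by rw [h57, e54, e56, h.log], 0, ?_, ?_,
    ?_, ?_⟩
  · rw [h55, Nat.cast_zero]
  · rw [h57, h.log, Nat.cast_zero]
    exact one_pos.trans_le
      (le_bound hL (hV.minAccuracy_pos.trans_le h.le_accuracy) h.accuracy_le)
  · rw [h57, h.log, Nat.cast_zero, zero_add]; exact hj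
  · rw [h12, h13]; exact Phase.zero hV.nonempty _ _

/-- The radius `u` found satisfies `r* ≤ u ≤ r* + 2 δ`. The test `2 δ (1 + ε) ≤ ε u` involves only
known quantities and implies `u ≤ (1 + ε) r*`. If it fails, `u ≥ r*` shows that `δ / 2` is still at
least `minAccuracy`. -/
theorem finish_spec (hV : IsInstance V ν ε) (hL : 1 ≤ L) (hLn : 2 * (n : ℝ) ≤ Real.exp L)
    (h : Ready V ν ε L s) {j t : ℕ} (ht0 : 0 < t) (h55 : s.realVar 55 = t)
    (ht : L * s.realVar 54 ^ 2 / s.realVar 56 ^ 2 ≤ t)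
    (hj : (j : ℝ) ≤ 3 * (L * s.realVar 54 ^ 2 / s.realVar 56 ^ 2))
    (hP : Phase (polytopes V ν) (s.realVar 56 / s.realVar 54 ^ 2) (s.realVar 54) t
      (rows n d s 12) (row0 d s 13)) :
    Tri finish s fun k s' => k ≤ 64 * inputSize V + 60 ∧ LoopInv V ν ε L j s' := by
  have hW := le_inputSize V
  have hdW : d ≤ n * d := Nat.le_mul_of_pos_left d hV.rows_pos
  have ht' : (0 : ℝ) < t := Nat.cast_pos.2 ht0
  have hδ := hV.minAccuracy_pos.trans_le h.le_accuracy
  have hρ := hδ.trans_le h.accuracy_le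
  have hr := hV.optRadius_pos
  have hε := hV.eps
  have hb := h.bound_le hV hL
  have hb1 := le_bound hL hδ h.accuracy_le
  refine Tri.andThen (maxDist_spec h.input.rows h.input.dim (by norm_num) (by norm_num)) ?_
  rintro k1 s1 f1 ⟨hk1, hM1, hM2⟩
  have R1 : Ready V ν ε L s1 := h.frame f1 rfl
  have e55 : s1.realVar 55 = t := (f1.real 55 rfl).trans h55
  have e54 : s1.realVar 54 = s.realVar 54 := f1.real 54 rfl
  have e56 : s1.realVar 56 = s.realVar 56 := f1.real 56 rfl
  have e12 : s1.realArr 12 = s.realArr 12 := f1.realArr 12 rfl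
  have e13 : s1.realArr 13 = s.realArr 13 := f1.realArr 13 rfl
  have hF := hP.feasible ht0 (fun i => hM1 i i.2)
  have hU1 := optRadius_le hV.rows_pos hF
  have hU2 : s1.realVar 52 / t ≤ optRadius (polytopes V ν) + 2 * s.realVar 56 := by
    rw [div_le_iff₀ ht', mul_comm]
    exact hM2 _ (by positivity)
      fun i hi => hP.le_optRadius hV.nonempty hδ hρ rfl hLn ht0 ht ⟨i, hi⟩
  refine Tri.block_seq ?_
  refine Tri.ite (fun hc => ?_) fun hc => ?_
  · refine (output_spec ((R1.input).exec rfl)).mono ?_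
    rintro k2 s2 f2 ⟨hk2, ho1, ho2, ho3, h87⟩
    refine ⟨by simp; omega, by rw [f2.nat 88 rfl]; simpa using R1.zero, Or.inr ⟨h87, by linarith, ?_⟩⟩
    simp [e55, e56, R1.eps] at hc ho1 ho2 ho3
    have a12 : (fun i => (t : ℝ)⁻¹ • rows n d s1 12 i) = fun i => (1 / (t : ℝ)) • rows n d s 12 i := by
      simp [rows, e12]
    have a13 : (t : ℝ)⁻¹ • row0 d s1 13 = (1 / (t : ℝ)) • row0 d s 13 := by
      simp [row0, e13]
    refine ⟨?_, ?_⟩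
    · rw [ho3, ho1, ho2]
      simpa [rows, row0, e12, e13] using hF
    · rw [ho3]
      nlinarith
  · refine Tri.block_seq ?_
    simp [e55, e56, R1.eps] at hc
    have hr' : ε * optRadius (polytopes V ν) ≤ 2 * s.realVar 56 * (1 + ε) := by
      have := mul_le_mul_of_nonneg_left hU1 hε.le
      linarith
    -- Halving `δ` quadruples the planned length, so the at most threefold old length already spent
    -- fits into the new one.
    have h4 : L * s.realVar 54 ^ 2 / (s.realVar 56 / 2) ^ 2 =
        4 * (L * s.realVar 54 ^ 2 / s.realVar 56 ^ 2) := by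
      field_simp; norm_num
    refine (reset_running (j := j) hV hL ⟨(R1.input.exec rfl).exec rfl, ?_, ?_, ?_, ?_, ?_, ?_, ?_, ?_⟩
      ?_).mono ?_
    · simpa using R1.size
    · simpa using R1.go
    · simpa using R1.zero
    · simpa using R1.eps
    · simpa using R1.log
    · simp [e54, e56]; linarith [h.accuracy_le]
    · simp [e54]; exact h.width_le
    · simp [e56]; exact hV.minAccuracy_le_half hδ hr'
    · simp [e54, e56, h4]; linarith
    · rintro k2 s2 f2 ⟨hk2, hR⟩
      exact ⟨by simp; omega, hR.zero, Or.inl hR⟩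

/-- With `B` the planned length, `j ≤ t + B`, `t < B` and `1 ≤ B` give `j + 1 ≤ 3 B`. A restart for
excessive width or for insufficient accuracy makes the length at least `4 B`, so the invariant
survives; otherwise `j` and `t` advance together. -/
theorem mainStep_spec (hV : IsInstance V ν ε) (hL : 1 ≤ L) (hLn : 2 * (n : ℝ) ≤ Real.exp L)
    {j : ℕ} (h : Running V ν ε L j s) :
    Tri mainStep s fun k s' => k ≤ 341200 * inputSize V + 300 ∧ LoopInv V ν ε L (j + 1) s' := by
  have hW := le_inputSize V
  have hdW : d ≤ n * d := Nat.le_mul_of_pos_left d hV.rows_pos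
  have hδ := hV.minAccuracy_pos.trans_le h.le_accuracy
  have hρ := hδ.trans_le h.accuracy_le
  have hb1 := le_bound hL hδ h.accuracy_le
  obtain ⟨t, h55, htb, hj, hP⟩ := h.phase
  refine Tri.andThen (iterate_spec hV.rows_pos hV.pos hV.cap h.input h.size rfl) ?_
  rintro k1 s1 f1 ⟨hk1, hv, ⟨i0, hz⟩, hv', hz', hM1, hM2⟩
  have R1 : Ready V ν ε L s1 := h.toReady.frame f1 rfl
  have e53 : s1.realVar 53 = s.realVar 53 := f1.real 53 rfl
  have e54 : s1.realVar 54 = s.realVar 54 := f1.real 54 rfl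
  have e55 : s1.realVar 55 = t := (f1.real 55 rfl).trans h55
  have e56 : s1.realVar 56 = s.realVar 56 := f1.real 56 rfl
  have e57 : s1.realVar 57 = s.realVar 57 := f1.real 57 rfl
  have e12 : rows n d s1 12 = rows n d s 12 := by unfold rows; rw [f1.realArr 12 rfl]
  have e13 : row0 d s1 13 = row0 d s 13 := by unfold row0; rw [f1.realArr 13 rfl]
  rw [h.bound] at htb hj
  refine Tri.ite (fun hc => ?_) fun hc => ?_
  · have hMD : s1.realVar 52 ≤ inputDiam (polytopes V ν) :=
      hM2 _ hV.inputDiam_pos.le fun i => norm_sub_le_inputDiam hV.isCompact (hv i) hz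
    have hc' : s.realVar 54 < s1.realVar 52 := by simpa [e54] using hc
    -- The new width is twice the observed distance, hence more than twice the old one, and still at
    -- most `2 D`. The answers of this iteration are discarded.
    have h4 : 4 * (L * s.realVar 54 ^ 2 / s.realVar 56 ^ 2) ≤
        L * (s1.realVar 52 + s1.realVar 52) ^ 2 / s.realVar 56 ^ 2 := by
      rw [← mul_div_assoc, mul_left_comm]
      gcongr
      nlinarith
    refine Tri.block_seq ((reset_running (j := j + 1) hV hL
      ⟨R1.input.exec rfl, ?_, ?_, ?_, ?_, ?_, ?_, ?_, ?_⟩ ?_).mono ?_)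
    · simpa using R1.size
    · simpa using R1.go
    · simpa using R1.zero
    · simpa using R1.eps
    · simpa using R1.log
    · simp [e56]; linarith [h.accuracy_le]
    · simp; linarith
    · simpa using R1.le_accuracy
    · simp [e56]; linarith
    · rintro k2 s2 f2 ⟨hk2, hR⟩
      exact ⟨by simp; omega, hR.zero, Or.inl hR⟩
  · have hc' : s1.realVar 52 ≤ s.realVar 54 := by simpa [e54] using hc
    refine Tri.andThen (accumulate_spec R1.input) ?_
    rintro k2 s2 f2 ⟨hk2, h12, h13, h55'⟩
    have R2 : Ready V ν ε L s2 := R1.frame f2 rfl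
    have a53 : s2.realVar 53 = s.realVar 53 := (f2.real 53 rfl).trans e53
    have a54 : s2.realVar 54 = s.realVar 54 := (f2.real 54 rfl).trans e54
    have a55 : s2.realVar 55 = ((t + 1 : ℕ) : ℝ) := by rw [h55', e55]; push_cast; rfl
    have a56 : s2.realVar 56 = s.realVar 56 := (f2.real 56 rfl).trans e56
    have a57 : s2.realVar 57 = L * s.realVar 54 ^ 2 / s.realVar 56 ^ 2 :=
      (f2.real 57 rfl).trans (e57.trans h.bound)
    have hP' : Phase (polytopes V ν) (s.realVar 53) (s.realVar 54) (t + 1) (rows n d s2 12)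
        (row0 d s2 13) := by
      rw [h12, h13, e12, e13]
      refine hP.step hV.rows_pos hV.convex ?_ ?_ hv hv' hz' fun i => (hM1 i).trans hc'
      · rw [h.rate]; positivity
      -- `η ρ = δ / ρ ≤ 1`, because the accuracy never exceeds the width.
      · rw [h.rate]
        rw [div_mul_eq_mul_div, div_le_one (by positivity), pow_two]
        exact mul_le_mul_of_nonneg_right h.accuracy_le hρ.le
    refine Tri.ite (fun hd => ?_) fun hd => ?_
    · simp [a57, a55] at hd
      refine (finish_spec (j := j + 1) (t := t + 1) hV hL hLn R2 (Nat.succ_pos t) a55 ?_ ?_ ?_).mono ?_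
      · rw [a54, a56]; push_cast; exact hd
      · rw [a54, a56]; push_cast; linarith
      · rw [a54, a56, ← h.rate]; exact hP'
      · rintro k3 s3 - ⟨hk3, hI⟩
        exact ⟨by omega, hI⟩
    · simp [a57, a55] at hd
      refine Tri.skip ⟨by omega, R2.zero, Or.inl ⟨R2, ?_, ?_, t + 1, a55, ?_, ?_, ?_⟩⟩
      · rw [a53, a54, a56, h.rate]
      · rw [a54, a56, a57]
      · rw [a57]; push_cast; exact hd
      · rw [a57]; push_cast; linarith
      · rw [a53, a54]; exact hP'

/-- A preliminary iteration produces points and a center in the polytopes; only this membership is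
used. Their largest distance `M` satisfies `r* ≤ M ≤ D` and starts both `ρ` and `δ`. -/
theorem mainProg_spec (hV : IsInstance V ν ε) :
    Tri mainProg (inputStore V ν ε) fun k s' =>
      IsApproxSolution (polytopes V ν) ε (outputCenter d s') (outputPoints n d s')
          (outputRadius s') ∧
        ∃ L : ℝ, 1 ≤ L ∧ L ≤ Real.log (2 * n) + 1 ∧
          (k : ℝ) ≤ 2 * 10 ^ 6 * inputSize V * (3 * phaseBound V ν ε L + 2) := by
  have hn := hV.rows_pos
  have hW := le_inputSize V
  have hI0 := hasInput_inputStore V ν ε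
  refine Tri.block_seq ?_
  refine Tri.andThen (logBound_spec (n := n) (by simpa using hI0.rows) hn) ?_
  rintro k1 s1 f1 ⟨hk1, hL, hLn, hLle⟩
  have I1 : HasInput V ν s1 := (hI0.exec rfl).frame f1 rfl
  refine Tri.andThen (gridSize_spec I1.rows I1.dim) ?_
  rintro k2 s2 f2 ⟨hk2, h84⟩
  have I2 : HasInput V ν s2 := I1.frame f2 rfl
  refine Tri.andThen (iterate_spec hn hV.pos hV.cap I2 h84 rfl) ?_
  rintro k3 s3 f3 ⟨hk3, hv, ⟨i0, hz⟩, -, -, hM1, hM2⟩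
  have I3 : HasInput V ν s3 := I2.frame f3 rfl
  have e0 : s3.realVar 0 = ε := by
    rw [f3.real 0 rfl, f2.real 0 rfl, f1.real 0 rfl]
    simp [inputStore, arrOfList]
  have e58 : s3.realVar 58 = s1.realVar 58 := by rw [f3.real 58 rfl, f2.real 58 rfl]
  have e84 : s3.natVar 84 = n * d := (f3.nat 84 rfl).trans h84
  have e87 : s3.natVar 87 = 1 := by
    rw [f3.nat 87 rfl, f2.nat 87 rfl, f1.nat 87 rfl]; simp
  have e88 : s3.natVar 88 = 0 := by
    rw [f3.nat 88 rfl, f2.nat 88 rfl, f1.nat 88 rfl]; simp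
  set L := s1.realVar 58 with hLdef
  have hMD : s3.realVar 52 ≤ inputDiam (polytopes V ν) :=
    hM2 _ hV.inputDiam_pos.le fun i => norm_sub_le_inputDiam hV.isCompact (hv i) hz
  have hrM : optRadius (polytopes V ν) ≤ s3.realVar 52 :=
    optRadius_le hn (z := row0 d s3 9) (v := rows n d s3 8)
      fun i => ⟨by rw [norm_sub_rev]; exact hM1 i, hv i⟩
  have hM := hV.optRadius_pos.trans_le hrM
  refine Tri.block_seq ?_
  refine Tri.andThen (reset_running (j := 0) (ε := ε) (L := L) hV hL
    ⟨I3.exec rfl, ?_, ?_, ?_, ?_, ?_, ?_, ?_, ?_⟩ ?_) ?_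
  · simpa using e84
  · simpa using e87
  · simpa using e88
  · simpa using e0
  · simpa using e58
  · simp
  · simp; linarith
  · simp; exact hV.minAccuracy_le.trans hrM
  · simp; positivity
  rintro k4 s4 f4 ⟨hk4, hR⟩
  have hB0 : 1 ≤ phaseBound V ν ε L := (le_bound hL
    (hV.minAccuracy_pos.trans_le hR.le_accuracy) hR.accuracy_le).trans (hR.bound_le hV hL)
  -- While the loop is active, `j ≤ t + B` and `t < B` for the planned length `B`, itself at most
  -- `phaseBound`; so `j` is less than twice `phaseBound`.
  refine Tri.loop_count (B := ⌈2 * phaseBound V ν ε L⌉₊) (c := 341200 * inputSize V + 300)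
    (I := LoopInv V ν ε L) ⟨hR.zero, Or.inl hR⟩ ?_ ?_
  · rintro j s5 - ⟨h88, hR5 | ⟨h87, -⟩⟩ hc
    · refine ⟨?_, mainStep_spec hV hL hLn hR5⟩
      obtain ⟨t, -, h1, h2, -⟩ := hR5.phase
      have h3 := hR5.bound_le hV hL
      rw [← hR5.bound] at h3
      exact Nat.lt_ceil.2 (by linarith)
    · exfalso
      simp [h88, h87] at hc
  · rintro k s5 j - hk - ⟨h88, hR5 | ⟨h87, hj, hS⟩⟩ hc
    · exfalso
      simp [h88, hR5.go] at hc
    · refine ⟨hS, L, hL, hLle, ?_⟩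
      have h1W : 1 ≤ inputSize V := by omega
      have hd : d ≤ n * d := Nat.le_mul_of_pos_left d hn
      have hk' : k ≤ j * (341501 * inputSize V) + 1 := by
        refine hk.trans (Nat.add_le_add_right (Nat.mul_le_mul_left j ?_) 1)
        omega
      have : [Instr.natConst 87 1, Instr.natConst 88 0].length + 1 + (k1 + (k2 + (k3 + (
          [Instr.realCopy 54 52, Instr.realCopy 56 52].length + 1 + (k4 + k))))) ≤
          1000000 * inputSize V + j * (341501 * inputSize V) := by
        simp only [List.length_cons, List.length_nil]
        omega
      refine (Nat.cast_le.2 this).trans ?_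
      push_cast
      have hW0 : (0 : ℝ) ≤ inputSize V := Nat.cast_nonneg _
      have := mul_le_mul_of_nonneg_left hj hW0
      nlinarith

end RealRAM

/-! ### The running time in terms of `N`, `n d`, `R` and `log n`. -/

namespace SIB

variable {n d : ℕ} {m : Fin n → ℕ} {V : ∀ i, Matrix (Fin d) (Fin (m i)) ℝ} {ν : Fin n → ℝ}
  {ε : ℝ}

theorem inputSize_eq (V : ∀ i, Matrix (Fin d) (Fin (m i)) ℝ) :
    inputSize V = numNonzero V + ∑ i, m i + n * d + n := by
  rw [inputSize, Finset.sum_range]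
  simp [blockNz, blockCols, Finset.sum_add_distrib, nzOff_eq, numNonzero]

/-- Every column but at most one has a nonzero entry. -/
theorem le_sum_colSupport_length {m : ℕ} (V : Matrix (Fin d) (Fin m) ℝ)
    (hV : ∀ j j' : Fin m, (∀ k, V k j = 0) → (∀ k, V k j' = 0) → j = j') :
    m ≤ ∑ j, (colSupport V j).length + 1 := by
  classical
  have hcard : (Finset.univ.filter fun j => (colSupport V j).length = 0).card ≤ 1 := by
    refine Finset.card_le_one.2 fun j hj j' hj' => hV j j' ?_ ?_
    · simpa [colSupport] using hj
    · simpa [colSupport] using hj'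
  have hsum : ∑ _j : Fin m, 1 ≤
      ∑ j, ((colSupport V j).length + if (colSupport V j).length = 0 then 1 else 0) :=
    Finset.sum_le_sum fun j _ => by split_ifs <;> omega
  rw [Finset.sum_add_distrib, ← Finset.card_filter] at hsum
  simp at hsum
  simp at hcard
  omega

/-- In dimension zero the nonempty polytopes all contain the only point, so their intersection is
not empty. -/
theorem IsInstance.dim_pos (h : IsInstance V ν ε) : 0 < d := by
  by_contra hd
  obtain rfl : d = 0 := by omega
  have := h.empty
  rw [Set.eq_empty_iff_forall_notMem] at this
  refine this 0 (Set.mem_iInter.2 fun i => ?_)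
  obtain ⟨u, hu⟩ := h.nonempty i
  rwa [Subsingleton.elim u 0] at hu

/-- The number of columns, which the format forces every pass to visit, is at most `N + n` because
the origin occurs at most once per matrix; and `n ≤ n d`. -/
theorem IsInstance.inputSize_le (h : IsInstance V ν ε)
    (hV : ∀ i (j j' : Fin (m i)), (∀ k, V i k j = 0) → (∀ k, V i k j' = 0) → j = j') :
    inputSize V ≤ 3 * (numNonzero V + n * d) := by
  have h1 : n ≤ n * d := Nat.le_mul_of_pos_right n h.dim_pos
  have h2 : ∑ i, m i ≤ numNonzero V + n := by
    refine (Finset.sum_le_sum fun i _ => le_sum_colSupport_length (V i) (hV i)).trans ?_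
    simp [Finset.sum_add_distrib, numNonzero]
  rw [inputSize_eq]
  omega

/-- For `n ≥ 2`, `3 log n ≥ 3 log 2 ≥ log 2 + 1`; this is where `n > 1` enters the running time. -/
theorem log_two_mul_add_one_le (hn : 1 < n) :
    Real.log (2 * n) + 1 ≤ 4 * Real.log n := by
  have h2 : (2 : ℝ) ≤ n := by exact_mod_cast hn
  have h3 := Real.log_le_log two_pos h2
  have h4 := Real.log_two_gt_d9
  rw [Real.log_mul two_ne_zero (by linarith)]
  linarith

/-- The approximation algorithm, with its running time. -/
theorem exists_approx_program : ∃ (P : RealRAM.Prog) (C : ℝ),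
    ∀ (n d : ℕ) (m : Fin n → ℕ) (V : ∀ i, Matrix (Fin d) (Fin (m i)) ℝ) (ν : Fin n → ℝ) (ε : ℝ),
      1 < n →
      (∀ i, 0 < m i) →
      (∀ i, ν i ∈ Set.Icc (1 / (m i : ℝ)) 1) →
      (∀ i (j j' : Fin (m i)), (∀ k, V i k j = 0) → (∀ k, V i k j' = 0) → j = j') →
      (⋂ i, reducedPolytope (V i) (ν i)) = ∅ →
      0 < ε →
      ∃ (T : ℕ) (s : RealRAM.Store),
        RealRAM.Runs P (inputStore V ν ε) T s ∧
        IsApproxSolution (fun i => reducedPolytope (V i) (ν i)) ε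
          (outputCenter d s) (outputPoints n d s) (outputRadius s) ∧
        (T : ℝ) ≤ C *
          ((inputDiam (fun i => reducedPolytope (V i) (ν i)) /
              optRadius (fun i => reducedPolytope (V i) (ν i))) ^ 2 *
            ((numNonzero V : ℝ) + (n : ℝ) * (d : ℝ)) * Real.log n / (min ε 1) ^ 2) := by
  refine ⟨RealRAM.mainProg, 2 * 10 ^ 10, fun n d m V ν ε hn hm hν hV hempty hε => ?_⟩
  have h : IsInstance V ν ε := ⟨hn, hm, hν, hempty, hε⟩
  obtain ⟨T, s, hr, hS, L, hL, hLle, hT⟩ := RealRAM.mainProg_spec h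
  refine ⟨T, s, hr, hS, hT.trans ?_⟩
  have hr0 := h.optRadius_pos
  have hD := h.optRadius_le_inputDiam
  have hμ : 0 < min ε 1 := lt_min hε one_pos
  change _ ≤ 2 * 10 ^ 10 * ((inputDiam (polytopes V ν) / optRadius (polytopes V ν)) ^ 2 *
    ((numNonzero V : ℝ) + (n : ℝ) * (d : ℝ)) * Real.log n / (min ε 1) ^ 2)
  set q := (inputDiam (polytopes V ν) / optRadius (polytopes V ν)) ^ 2 / (min ε 1) ^ 2 with hq
  have hq1 : 1 ≤ q := by
    rw [hq, le_div_iff₀ (by positivity), one_mul]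
    have h1 : 1 ≤ inputDiam (polytopes V ν) / optRadius (polytopes V ν) := (one_le_div hr0).2 hD
    exact pow_le_pow_left₀ hμ.le ((min_le_right ε 1).trans h1) 2
  -- `256 = 2² * 8²`: the width is at most `2 D` and the accuracy at least `min(ε,1) r* / 8`.
  have hB : RealRAM.phaseBound V ν ε L = 256 * (L * q) := by
    rw [hq, RealRAM.phaseBound, minAccuracy]
    field_simp
    ring
  have hW : (inputSize V : ℝ) ≤ 3 * ((numNonzero V : ℝ) + (n : ℝ) * (d : ℝ)) := by
    exact_mod_cast h.inputSize_le hV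
  have hL4 : L ≤ 4 * Real.log n := hLle.trans (log_two_mul_add_one_le hn)
  have hLq : 1 ≤ L * q := one_le_mul_of_one_le_of_one_le hL hq1
  -- `770 = 3 * 256 + 2`, the additive `2` being absorbed by `L q ≥ 1`.
  have h1 : 3 * RealRAM.phaseBound V ν ε L + 2 ≤ 770 * (4 * Real.log n * q) := by
    have := mul_le_mul_of_nonneg_right hL4 (zero_le_one.trans hq1)
    linarith
  have hX : 0 ≤ ((numNonzero V : ℝ) + (n : ℝ) * (d : ℝ)) * (Real.log n * q) := by
    have : 0 ≤ Real.log n := by linarith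
    positivity
  calc 2 * 10 ^ 6 * (inputSize V : ℝ) * (3 * RealRAM.phaseBound V ν ε L + 2)
      ≤ 2 * 10 ^ 6 * (3 * ((numNonzero V : ℝ) + (n : ℝ) * (d : ℝ))) *
        (770 * (4 * Real.log n * q)) := by
        gcongr
        rw [hB]; linarith
    _ = 18480000000 * (((numNonzero V : ℝ) + (n : ℝ) * (d : ℝ)) * (Real.log n * q)) := by ring
    _ ≤ 2 * 10 ^ 10 * (((numNonzero V : ℝ) + (n : ℝ) * (d : ℝ)) * (Real.log n * q)) := by
        gcongr; norm_num
    _ = _ := by rw [hq]; ring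

end SIB

end

theorem mainTheorem4 :
    -- the approximation algorithm for reduced polytopes
    (∃ (P : RealRAM.Prog) (C : ℝ),
      ∀ (n d : ℕ) (m : Fin n → ℕ) (V : ∀ i, Matrix (Fin d) (Fin (m i)) ℝ) (ν : Fin n → ℝ) (ε : ℝ),
        1 < n →
        (∀ i, 0 < m i) →
        (∀ i, ν i ∈ Set.Icc (1 / (m i : ℝ)) 1) →
        (∀ i (j j' : Fin (m i)), (∀ k, V i k j = 0) → (∀ k, V i k j' = 0) → j = j') →
        (⋂ i, SIB.reducedPolytope (V i) (ν i)) = ∅ →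
        0 < ε →
        ∃ (T : ℕ) (s : RealRAM.Store),
          RealRAM.Runs P (SIB.inputStore V ν ε) T s ∧
          SIB.IsApproxSolution (fun i => SIB.reducedPolytope (V i) (ν i)) ε
            (SIB.outputCenter d s) (SIB.outputPoints n d s) (SIB.outputRadius s) ∧
          (T : ℝ) ≤ C *
            ((SIB.inputDiam (fun i => SIB.reducedPolytope (V i) (ν i)) /
                SIB.optRadius (fun i => SIB.reducedPolytope (V i) (ν i))) ^ 2 *
              ((SIB.numNonzero V : ℝ) + (n : ℝ) * (d : ℝ)) * Real.log n / (min ε 1) ^ 2)) ∧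
    -- the linear oracle over the capped simplex
    (∃ (P : RealRAM.Prog) (C : ℝ),
      ∀ (m : ℕ) (h : Fin m → ℝ) (ν : ℝ),
        0 < m →
        ν ∈ Set.Icc (1 / (m : ℝ)) 1 →
        ∃ (T : ℕ) (s : RealRAM.Store),
          RealRAM.Runs P (SIB.oracleStore h ν) T s ∧
          SIB.IsTopSelection h ν (SIB.oracleOutput m s) ∧
          SIB.oracleOutput m s ∈ SIB.cappedSimplex m ν ∧
          IsMinOn (fun b : Fin m → ℝ => h ⬝ᵥ b) (SIB.cappedSimplex m ν) (SIB.oracleOutput m s) ∧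
          (T : ℝ) ≤ C * (m : ℝ)) := by
  exact ⟨SIB.exists_approx_program, SIB.exists_oracle_program⟩
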